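/- Theorem (backward error of the Frobenius factorization). Norms are Frobenius norms. Let $d,k\ge 1$, $n=dk$, let $M_0,\dots,M_{d-1}\in\mathbb C^{k\times k}$ with $M_0$ lower triangular, and let $S\in\mathbb C^{n\times n}$ be the block companion matrix with identity blocks $I_k$ on the block subdiagonal and last block column $-M_0,-M_1,\dots,-M_{d-1}$ (if $d=1$, assume $\|S\|\ge 1$; for $d\ge 2$ this is automatic). Let $S=S_1\cdots S_k=\mathcal Q R_1\,\mathcal Q R_2\cdots \mathcal Q R_k$ be its Frobenius factorization: with $J$ the downshift matrix and $\mathcal Q=J+e_1e_n^T$ the cyclic downshift, $S_j=J-a_je_n^T=\mathcal Q R_j$ is the scalar companion matrix for which $a_j$ is the $j$-th column of $[M_0;\dots;M_{d-1}]$ moved up by $j-1$ rows and filled up with zeros, and $R_j$ is the identity with its last column replaced by a spike. Storage. A core transformation is an identity matrix except for a unitary $2\times2$ diagonal block. Each $\mathcal Q$ is stored as a sequence of core transformations; each $R_j$ is stored by two sequences of core transformations of size $n+1$, with products $\mathcal C_j^*$ and $\mathcal B_j$, from which it is reconstructed as $R_j=P^T\mathcal C_j^*(\mathcal B_j+e_1y_j^T)P$,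 $y_j^T=-\rho_j^{-1}e_{n+1}^T\mathcal C_j^*\mathcal B_j$, $\rho_j=e_{n+1}^T\mathcal C_j^*e_1$, where $P$ consists of the first $n$ columns of $I_{n+1}$. Initially $\mathcal C_j$ is computed, in floating point, so that it maps the spike of $R_j$, extended by an entry $-1$, to a multiple of $e_1$. Algorithm. One operation is one of the following: a turnover (three adjacent core transformations $F_iG_{i+1}H_i$ are refactored as $F'_{i+1}G'_iH'_{i+1}$, or conversely, by a QR or QL factorization of the $3\times3$ product); a fusion of two core transformations acting on the same rows; an exchange of two core transformations acting on disjoint rows; setting to zero an off-diagonal entry of modulus at most $u$ in a core transformation; moving a core transformation across the boundary of two neighbouring sequences (between $\mathcal C_j^*$ and $\mathcal B_j$ if it fixes $e_1$, and out of $\mathcal C_j^*$ or $\mathcal B_j$ into a sequence of size $n$ if it fixes $e_{n+1}$); application or removal of a core transformation at the outer left or the outer right of the product. All arithmetic, including the initial computation of the $\mathcal C_j$, is floating point arithmetic obeying the standard model with unit round-off $u$: each real operation $+,-,\times,/,\sqrt{\ }$ is carried out with a relative error of at most $u$. Stored core transformations are understood to be normalized, so that the matrices they represent are exactly unitary. Let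 $\hat S$ be the matrix represented by the stored data after $N$ operations, and let $U$ and $V^*$ be the products of the core transformations (or their inverses) applied from the left and from the right, so that in exact arithmetic the result would be $USV^*$. Then there are a constant $K$ and an exponent $a$, both universal (independent of all data), such that for all $d,k,M_0,\dots,M_{d-1}$ as above and all $N$ there is $u_0>0$ such that for every $u\in[0,u_0]$, every arithmetic as above and every such computation with $N$ operations: $U$ and $V$ are unitary, all $\rho_j$ are nonzero, and $$\hat S=U(S+\delta S)V^*\quad\text{with}\quad \|\delta S\|\le K\,(dk)^a\,(N+1)\,\|S\|^2\,u .$$ In particular, if $N$ is bounded by a polynomial in $d$ and $k$, then $\|\delta S\|\lesssim\|S\|^2u$, where $\lesssim$ means less than up to multiplication with a polynomial in $d$ and $k$, for all sufficiently small $u$. -/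

import Mathlib

open Matrix

attribute [local instance] Matrix.frobeniusNormedAddCommGroup

noncomputable section

namespace CoreChasing

/-! ### Floating point arithmetic -/

/-- The standard model of floating point arithmetic with unit round-off `u`: every elementary
real operation returns the rounded value `fl x` of its exact result `x`, and rounding commits a
relative error of at most `u`. -/
def StandardModel (u : ℝ) (fl : ℝ → ℝ) : Prop :=
  ∀ x : ℝ, |fl x - x| ≤ u * |x|

/-- Floating point addition of complex numbers. -/
def flAdd (fl : ℝ → ℝ) (x y : ℂ) : ℂ :=
  ⟨fl (x.re + y.re), fl (x.im + y.im)⟩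

/-- Floating point subtraction of complex numbers. -/
def flSub (fl : ℝ → ℝ) (x y : ℂ) : ℂ :=
  ⟨fl (x.re - y.re), fl (x.im - y.im)⟩

/-- Floating point multiplication of complex numbers, from four real products. -/
def flMul (fl : ℝ → ℝ) (x y : ℂ) : ℂ :=
  ⟨fl (fl (x.re * y.re) - fl (x.im * y.im)), fl (fl (x.re * y.im) + fl (x.im * y.re))⟩

/-- Floating point division of a complex number by a real number. -/
def flDiv (fl : ℝ → ℝ) (x : ℂ) (r : ℝ) : ℂ :=
  ⟨fl (x.re / r), fl (x.im / r)⟩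

/-- Floating point evaluation of `|a|²`. -/
def flAbsSq (fl : ℝ → ℝ) (a : ℂ) : ℝ :=
  fl (fl (a.re * a.re) + fl (a.im * a.im))

/-- Floating point evaluation of `√(|a|² + |b|²)`. -/
def flHypot (fl : ℝ → ℝ) (a b : ℂ) : ℝ :=
  fl (Real.sqrt (fl (flAbsSq fl a + flAbsSq fl b)))

/-! ### Core transformations -/

/-- The stored data of a core transformation acting on the rows `idx` and `idx + 1`
(rows are numbered from `0`). Its active part is
`[c, -conj s * p; s, conj c * p]`; up to rounding, `|c|² + |s|² = 1` and `|p| = 1`. -/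
structure Core where
  /-- the first of the two rows acted upon -/
  idx : ℕ
  /-- the (1,1) entry of the active part -/
  c : ℂ
  /-- the (2,1) entry of the active part -/
  s : ℂ
  /-- the determinant of the active part -/
  p : ℂ

/-- The `m × m` core transformation represented by the stored data: the identity matrix except for
a unitary two by two block. The stored `(c, s)` and `p` are understood up to a positive
normalization factor (which is `1` up to rounding), so that stored core transformations always
stand for matrices that are exactly unitary. -/
def Core.toMatrix (m : ℕ) (g : Core) : Matrix (Fin m) (Fin m) ℂ :=
  Matrix.of fun a b =>
    let r : ℂ := ((Real.sqrt (‖g.c‖ ^ 2 + ‖g.s‖ ^ 2) : ℝ) : ℂ)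
    let t : ℂ := g.p / ((‖g.p‖ : ℝ) : ℂ)
    if a.val = g.idx ∧ b.val = g.idx then g.c / r
    else if a.val = g.idx ∧ b.val = g.idx + 1 then -(star g.s / r * t)
    else if a.val = g.idx + 1 ∧ b.val = g.idx then g.s / r
    else if a.val = g.idx + 1 ∧ b.val = g.idx + 1 then star g.c / r * t
    else if a = b then 1 else 0

/-- The product of a sequence of core transformations. -/
def word (m : ℕ) (w : List Core) : Matrix (Fin m) (Fin m) ℂ :=
  (w.map (Core.toMatrix m)).prod

/-- The core transformation at position `i` whose active part is proportional to
`(a, b)` in its first column and to `q` in its determinant, normalized in floating point. -/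
def mkCore (fl : ℝ → ℝ) (i : ℕ) (a b q : ℂ) : Core :=
  let r := flHypot fl a b
  let t := flHypot fl q 0
  { idx := i
    c := if r = 0 then 1 else flDiv fl a r
    s := if r = 0 then 0 else flDiv fl b r
    p := if t = 0 then 1 else flDiv fl q t }

/-- The (1,1) entry of the active part. -/
def Core.e11 (g : Core) : ℂ := g.c

/-- The (1,2) entry of the active part, in floating point. -/
def Core.e12 (fl : ℝ → ℝ) (g : Core) : ℂ := -(flMul fl (star g.s) g.p)

/-- The (2,1) entry of the active part. -/
def Core.e21 (g : Core) : ℂ := g.s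

/-- The (2,2) entry of the active part, in floating point. -/
def Core.e22 (fl : ℝ → ℝ) (g : Core) : ℂ := flMul fl (star g.c) g.p

/-- The floating point fusion of two core transformations acting on the same rows: the core
transformation that represents their product. -/
def fusion (fl : ℝ → ℝ) (F G : Core) : Core :=
  mkCore fl F.idx
    (flAdd fl (flMul fl F.e11 G.e11) (flMul fl (F.e12 fl) G.e21))
    (flAdd fl (flMul fl F.e21 G.e11) (flMul fl (F.e22 fl) G.e21))
    (flMul fl F.p G.p)

/-- The floating point turnover `F_i G_{i+1} H_i ↦ F'_{i+1} G'_i H'_{i+1}`. The first two columns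
of the unitary `3 × 3` matrix `M = F_i G_{i+1} H_i` are formed, and `M` is reduced to
`diag(1, H')` by its QR factorization: `F'` annihilates the entry (3,1) of `M` and `G'` the
entry (2,1). -/
def turnoverDown (fl : ℝ → ℝ) (F G H : Core) : Core × Core × Core :=
  let i := F.idx
  let x1 := flMul fl (F.e12 fl) G.e11
  let x2 := flMul fl (F.e22 fl) G.e11
  let m11 := flAdd fl (flMul fl F.e11 H.e11) (flMul fl x1 H.e21)
  let m21 := flAdd fl (flMul fl F.e21 H.e11) (flMul fl x2 H.e21)
  let m31 := flMul fl G.e21 H.e21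
  let m12 := flAdd fl (flMul fl F.e11 (H.e12 fl)) (flMul fl x1 (H.e22 fl))
  let m22 := flAdd fl (flMul fl F.e21 (H.e12 fl)) (flMul fl x2 (H.e22 fl))
  let m32 := flMul fl G.e21 (H.e22 fl)
  let F' := mkCore fl (i + 1) m21 m31 1
  let r := flHypot fl m21 m31
  let G' := mkCore fl i m11 (r : ℂ) 1
  let t2 := flAdd fl (flMul fl (star F'.c) m22) (flMul fl (star F'.s) m32)
  let t3 := flSub fl (flMul fl F'.c m32) (flMul fl F'.s m22)
  let n2 := flSub fl (flMul fl G'.c t2) (flMul fl G'.s m12)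
  let H' := mkCore fl (i + 1) n2 t3 (flMul fl (flMul fl F.p G.p) H.p)
  (F', G', H')

/-- The floating point turnover `F_{i+1} G_i H_{i+1} ↦ F'_i G'_{i+1} H'_i`. The first and the third
column of the unitary `3 × 3` matrix `M = F_{i+1} G_i H_{i+1}` are formed, and `M` is reduced to
`diag(H', 1)` by its QL factorization: `F'` annihilates the entry (1,3) of `M` and `G'` the
entry (2,3). -/
def turnoverUp (fl : ℝ → ℝ) (F G H : Core) : Core × Core × Core :=
  let i := G.idx
  let m11 := G.e11
  let m21 := flMul fl F.e11 G.e21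
  let m31 := flMul fl F.e21 G.e21
  let x := flMul fl (G.e22 fl) (H.e12 fl)
  let m13 := flMul fl (G.e12 fl) (H.e12 fl)
  let m23 := flAdd fl (flMul fl F.e11 x) (flMul fl (F.e12 fl) (H.e22 fl))
  let m33 := flAdd fl (flMul fl F.e21 x) (flMul fl (F.e22 fl) (H.e22 fl))
  let F' := mkCore fl i (star m23) (-(star m13)) 1
  let r := flHypot fl m13 m23
  let G' := mkCore fl (i + 1) (star m33) (-(r : ℂ)) 1
  let t1 := flAdd fl (flMul fl (star F'.c) m11) (flMul fl (star F'.s) m21)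
  let t2 := flSub fl (flMul fl F'.c m21) (flMul fl F'.s m11)
  let n2 := flAdd fl (flMul fl (star G'.c) t2) (flMul fl (star G'.s) m31)
  let H' := mkCore fl i t1 n2 (flMul fl (flMul fl F.p G.p) H.p)
  (F', G', H')

/-- One operation on a sequence of core transformations, carried out in floating point. -/
inductive WordStep (fl : ℝ → ℝ) (u : ℝ) : List Core → List Core → Prop
  /-- turnover `F_i G_{i+1} H_i ↦ F'_{i+1} G'_i H'_{i+1}` -/
  | down (l r : List Core) (F G H : Core) (hG : G.idx = F.idx + 1) (hH : H.idx = F.idx) :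
      WordStep fl u (l ++ F :: G :: H :: r)
        (l ++ (turnoverDown fl F G H).1 :: (turnoverDown fl F G H).2.1 ::
          (turnoverDown fl F G H).2.2 :: r)
  /-- turnover `F_{i+1} G_i H_{i+1} ↦ F'_i G'_{i+1} H'_i` -/
  | up (l r : List Core) (F G H : Core) (hF : F.idx = G.idx + 1) (hH : H.idx = G.idx + 1) :
      WordStep fl u (l ++ F :: G :: H :: r)
        (l ++ (turnoverUp fl F G H).1 :: (turnoverUp fl F G H).2.1 ::
          (turnoverUp fl F G H).2.2 :: r)
  /-- fusion of two core transformations acting on the same rows -/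
  | fuse (l r : List Core) (F G : Core) (h : G.idx = F.idx) :
      WordStep fl u (l ++ F :: G :: r) (l ++ fusion fl F G :: r)
  /-- two core transformations acting on disjoint sets of rows commute -/
  | swap (l r : List Core) (F G : Core) (h : F.idx + 1 < G.idx ∨ G.idx + 1 < F.idx) :
      WordStep fl u (l ++ F :: G :: r) (l ++ G :: F :: r)
  /-- deflation: an off-diagonal part not exceeding the unit round-off is set to zero -/
  | deflate (l r : List Core) (F : Core) (h : ‖F.s‖ ≤ u) :
      WordStep fl u (l ++ F :: r) (l ++ mkCore fl F.idx F.c 0 F.p :: r)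

/-! ### The factored form and its transformation -/

/-- The last row `yᵀ = -ρ⁻¹ e_{n+1}ᵀ C* B`, with `ρ = e_{n+1}ᵀ C* e₁`, of the rank-one part that is
implicitly encoded in the unitary matrices `C*` (the argument `Cs`) and `B`. -/
def implicitRow {n : ℕ} (Cs B : Matrix (Fin (n + 1)) (Fin (n + 1)) ℂ) : Fin (n + 1) → ℂ :=
  fun j => -((Cs (Fin.last n) 0)⁻¹ * (Cs * B) (Fin.last n) j)

/-- The unitary-plus-rank-one matrix `R = Pᵀ C* (B + e₁ yᵀ) P` reconstructed from its unitary part,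
where `P` consists of the first `n` columns of the identity matrix of size `n + 1`. -/
def unitaryPlusRankOne {n : ℕ} (Cs B : Matrix (Fin (n + 1)) (Fin (n + 1)) ℂ) :
    Matrix (Fin n) (Fin n) ℂ :=
  (Cs * (B + Matrix.vecMulVec (Pi.single 0 1) (implicitRow Cs B))).submatrix
    Fin.castSucc Fin.castSucc

/-- The data of the algorithm: a product `Q₁ R₁ Q₂ R₂ ⋯ Q_k R_k` of `n × n` matrices, where each
`Q_j` is stored as a sequence of core transformations, each `R_j` by the sequences of core
transformations `Cs_j = C_j*` and `B_j` of size `n + 1`, together with the unitary matrices `U` and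
`V` that have been applied so far. -/
@[ext]
structure State (n k : ℕ) where
  /-- the sequences of core transformations in front of the factors `R_j` -/
  Q : Fin k → List Core
  /-- the sequences of core transformations with product `C_j*` -/
  Cs : Fin k → List Core
  /-- the sequences of core transformations with product `B_j` -/
  B : Fin k → List Core
  /-- the accumulated transformation applied from the left -/
  U : Matrix (Fin n) (Fin n) ℂ
  /-- the adjoint of the accumulated transformation applied from the right -/
  V : Matrix (Fin n) (Fin n) ℂ

/-- The factor `R_j` reconstructed from the stored data. -/
def State.R {n k : ℕ} (st : State n k) (j : Fin k) : Matrix (Fin n) (Fin n) ℂ :=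
  unitaryPlusRankOne (word (n + 1) (st.Cs j)) (word (n + 1) (st.B j))

/-- The number `ρ_j = e_{n+1}ᵀ C_j* e₁` by which one divides to reconstruct `R_j`. -/
def State.rho {n k : ℕ} (st : State n k) (j : Fin k) : ℂ :=
  word (n + 1) (st.Cs j) (Fin.last n) 0

/-- The matrix `Q₁ R₁ Q₂ R₂ ⋯ Q_k R_k` represented by the stored data. -/
def State.value {n k : ℕ} (st : State n k) : Matrix (Fin n) (Fin n) ℂ :=
  (List.ofFn fun j : Fin k => word n (st.Q j) * st.R j).prod

/-- One operation of the algorithm in floating point arithmetic. The sequences of core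
transformations are modified by turnovers, fusions, and so on; core transformations move from
one sequence to a neighbouring one (for example, a core transformation is passed through `R_j`
from the right to the left by moving it to the end of `B_j`, a turnover in `B_j`, moving the
result to the end of `C_j*`, a turnover in `C_j*`, and moving the result to the end of `Q_j`), and
core transformations are applied to, or removed from, the outer left and the outer right. -/
inductive Step (fl : ℝ → ℝ) (u : ℝ) {n k : ℕ} : State n k → State n k → Prop
  | onQ (st : State n k) (j : Fin k) (w : List Core) (h : WordStep fl u (st.Q j) w) :
      Step fl u st { st with Q := Function.update st.Q j w }
  | onCs (st : State n k) (j : Fin k) (w : List Core) (h : WordStep fl u (st.Cs j) w) :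
      Step fl u st { st with Cs := Function.update st.Cs j w }
  | onB (st : State n k) (j : Fin k) (w : List Core) (h : WordStep fl u (st.B j) w) :
      Step fl u st { st with B := Function.update st.B j w }
  /-- from the end of `Q_j` to the front of `C_j*` -/
  | QtoCs (st : State n k) (j : Fin k) (w : List Core) (G : Core) (h : st.Q j = w ++ [G]) :
      Step fl u st
        { st with Q := Function.update st.Q j w, Cs := Function.update st.Cs j (G :: st.Cs j) }
  /-- from the front of `C_j*` to the end of `Q_j`, for `G e_{n+1} = e_{n+1}` -/
  | CstoQ (st : State n k) (j : Fin k) (w : List Core) (G : Core) (h : st.Cs j = G :: w)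
      (hG : G.idx + 1 < n) :
      Step fl u st
        { st with Q := Function.update st.Q j (st.Q j ++ [G]), Cs := Function.update st.Cs j w }
  /-- from the end of `C_j*` to the front of `B_j`, for `G e₁ = e₁` -/
  | CstoB (st : State n k) (j : Fin k) (w : List Core) (G : Core) (h : st.Cs j = w ++ [G])
      (hG : 0 < G.idx) :
      Step fl u st
        { st with Cs := Function.update st.Cs j w, B := Function.update st.B j (G :: st.B j) }
  /-- from the front of `B_j` to the end of `C_j*`, for `G e₁ = e₁` -/
  | BtoCs (st : State n k) (j : Fin k) (w : List Core) (G : Core) (h : st.B j = G :: w)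
      (hG : 0 < G.idx) :
      Step fl u st
        { st with Cs := Function.update st.Cs j (st.Cs j ++ [G]), B := Function.update st.B j w }
  /-- from the end of `B_j` to the front of `Q_{j+1}`, for `G e_{n+1} = e_{n+1}` -/
  | BtoQ (st : State n k) (j j' : Fin k) (hj : j'.val = j.val + 1) (w : List Core) (G : Core)
      (h : st.B j = w ++ [G]) (hG : G.idx + 1 < n) :
      Step fl u st
        { st with B := Function.update st.B j w, Q := Function.update st.Q j' (G :: st.Q j') }
  /-- from the front of `Q_{j+1}` to the end of `B_j` -/
  | QtoB (st : State n k) (j j' : Fin k) (hj : j'.val = j.val + 1) (w : List Core) (G : Core)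
      (h : st.Q j' = G :: w) :
      Step fl u st
        { st with B := Function.update st.B j (st.B j ++ [G]), Q := Function.update st.Q j' w }
  /-- a core transformation is applied from the left -/
  | applyLeft (st : State n k) (j : Fin k) (hj : j.val = 0) (i : ℕ) (hi : i + 1 < n) (a b q : ℂ) :
      Step fl u st
        { st with
          Q := Function.update st.Q j (mkCore fl i a b q :: st.Q j)
          U := (mkCore fl i a b q).toMatrix n * st.U }
  /-- the leftmost core transformation is removed by a multiplication with its inverse -/
  | removeLeft (st : State n k) (j : Fin k) (hj : j.val = 0) (w : List Core) (G : Core)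
      (h : st.Q j = G :: w) :
      Step fl u st
        { st with
          Q := Function.update st.Q j w
          U := (G.toMatrix n)ᴴ * st.U }
  /-- a core transformation is applied from the right -/
  | applyRight (st : State n k) (j : Fin k) (hj : j.val + 1 = k) (i : ℕ) (hi : i + 1 < n)
      (a b q : ℂ) :
      Step fl u st
        { st with
          B := Function.update st.B j (st.B j ++ [mkCore fl i a b q])
          V := ((mkCore fl i a b q).toMatrix n)ᴴ * st.V }
  /-- the rightmost core transformation is removed by a multiplication with its inverse -/
  | removeRight (st : State n k) (j : Fin k) (hj : j.val + 1 = k) (w : List Core) (G : Core)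
      (h : st.B j = w ++ [G]) (hG : G.idx + 1 < n) :
      Step fl u st
        { st with
          B := Function.update st.B j w
          V := G.toMatrix n * st.V }

/-- `Run fl u N st st'`: the data `st'` result from `st` by `N` floating point operations of the
algorithm. -/
inductive Run (fl : ℝ → ℝ) (u : ℝ) {n k : ℕ} : ℕ → State n k → State n k → Prop
  | refl (st : State n k) : Run fl u 0 st st
  | step {N : ℕ} {st st' st'' : State n k} (h : Run fl u N st st') (h' : Step fl u st' st'') :
      Run fl u (N + 1) st st''

/-! ### The block companion matrix and the storage of its Frobenius factorization -/

/-- The block companion matrix with identity blocks `I_k` on the block subdiagonal and last block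
column `-M₀, -M₁, …, -M_{d-1}`. -/
def blockCompanion {d k : ℕ} (M : Fin d → Matrix (Fin k) (Fin k) ℂ) :
    Matrix (Fin (d * k)) (Fin (d * k)) ℂ :=
  Matrix.reindex finProdFinEquiv finProdFinEquiv
    (Matrix.of fun (x y : Fin d × Fin k) =>
      (if x.1.val = y.1.val + 1 ∧ x.2 = y.2 then (1 : ℂ) else 0)
        - (if y.1.val + 1 = d then M x.1 x.2 y.2 else 0))

/-- The coefficients `a₀, …, a_{n-1}` of the `j`-th Frobenius companion factor
`S_j = J - a e_nᵀ` of the block companion matrix, where `J` is the downshift matrix and `n = dk`: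
the `j`-th column of the stacked matrix `[M₀; M₁; …; M_{d-1}]`, moved up by `j` rows (`j` is
counted from `0`) and filled up with zeros. -/
def frobeniusCoeff {d k : ℕ} (M : Fin d → Matrix (Fin k) (Fin k) ℂ) (j : Fin k) (i : ℕ) : ℂ :=
  if h : i + j.val < d * k then
    M (Fin.divNat ⟨i + j.val, h⟩) (Fin.modNat ⟨i + j.val, h⟩) j
  else 0

/-- The last column (the spike) of `R_j = 𝒬* S_j` for the `j`-th Frobenius companion factor `S_j`,
where `𝒬` is the cyclic downshift matrix; all the other columns of `R_j` are those of the
identity. -/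
def frobeniusSpike {d k : ℕ} (M : Fin d → Matrix (Fin k) (Fin k) ℂ) (j : Fin k) (i : ℕ) : ℂ :=
  if i + 1 < d * k then -frobeniusCoeff M j (i + 1) else -frobeniusCoeff M j 0

/-- The floating point norms of the trailing parts, consisting of `t + 1` entries, of the vector
`(v₀, …, v_{n-1}, -1)` (for `t = 0`, the last entry itself). -/
def trailingNorm (fl : ℝ → ℝ) (n : ℕ) (v : ℕ → ℂ) : ℕ → ℂ
  | 0 => -1
  | t + 1 => ((flHypot fl (v (n - 1 - t)) (trailingNorm fl n v t) : ℝ) : ℂ)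

/-- The core transformations `C_{i+1}*` with `C₁ ⋯ C_n x = α e₁` for `x = (v₀, …, v_{n-1}, -1)`,
in floating point (the index `i` is counted from `0`). -/
def spikeCore (fl : ℝ → ℝ) (n : ℕ) (v : ℕ → ℂ) (i : ℕ) : Core :=
  mkCore fl i (v i) (trailingNorm fl n v (n - 1 - i)) 1

/-- The stored sequence for `C* = C_n* ⋯ C₁*`. -/
def storeCs (fl : ℝ → ℝ) (n : ℕ) (v : ℕ → ℂ) : List Core :=
  ((List.range n).map (spikeCore fl n v)).reverse

/-- The stored sequence for `B = C₁ ⋯ C_{n-1} (C_n F_n)`, where `F_n` exchanges the rows `n` and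
`n + 1`. (No arithmetic is involved; the determinant of each `spikeCore` is `1`.) -/
def storeB (fl : ℝ → ℝ) (n : ℕ) (v : ℕ → ℂ) : List Core :=
  (List.range n).map fun i =>
    let g := spikeCore fl n v i
    if i + 1 < n then { idx := i, c := star g.c, s := -g.s, p := 1 }
    else { idx := i, c := star g.s, s := g.c, p := -1 }

/-- The stored sequence of the cyclic downshift matrix `𝒬`, a product of `n - 1` core
transformations with active part `[0, 1; 1, 0]`. -/
def storeQ (n : ℕ) : List Core :=
  (List.range (n - 1)).map fun i => { idx := i, c := 0, s := 1, p := -1 }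

/-- The floating point data with which the algorithm starts: the Frobenius factorization
`S = 𝒬 R₁ 𝒬 R₂ ⋯ 𝒬 R_k` of the block companion matrix in structured storage. -/
def frobeniusStart (fl : ℝ → ℝ) {d k : ℕ} (M : Fin d → Matrix (Fin k) (Fin k) ℂ) :
    State (d * k) k where
  Q := fun _ => storeQ (d * k)
  Cs := fun j => storeCs fl (d * k) (frobeniusSpike M j)
  B := fun j => storeB fl (d * k) (frobeniusSpike M j)
  U := 1
  V := 1

end CoreChasing

end

/-!
# Backward stability of core chasing on a Frobenius factorization

The factors `R_j` cannot be followed individually through the computation: reconstructing `R_j`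
divides by the possibly small number `ρ_j`, so that small errors of the stored core
transformations may become large errors of `R_j`. What changes little under rounding are the
vector `x_j = diag(Q_j, 1) C_j* e₁` and the unitary matrix `W_j = diag(Q_j, 1) C_j* B_j`, and they
determine the factor: `Q_j R_j` is the leading `n × n` part of `Π_j W_j`, where `Π_j` is the
oblique projection along `x_j` onto the vectors with vanishing last entry
(`State.Good.word_mul_R`).

*Operations.* A turnover, fusion or deflation changes the represented unitary matrix by `O(u)`
(`turnoverDown_approx`, `turnoverUp_approx`, `fusion_approx`, `deflate_approx`). For a turnover
this is not a matter of continuity, as the computed rotations do not depend continuously on the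
data. It holds since the exactly unitary matrix that remains after the removal of the first two
computed rotations has a first (or last) column close to that of the identity, and the entries of
a unitary `3 × 3` matrix are conjugate cofactors up to the determinant, so that the remainder is
close to a core transformation. Moves across the boundary of two sequences either leave all `x_j`
and `W_j` unchanged or amount to a unitary change of coordinates between two neighbouring factors
(`Represents.gauge`). Hence, after `N` operations, `x_j` and `W_j` are the initial ones up to such
coordinate changes and an error `ε = O(N u)` times a power of `n` (`exists_run_represents`). The
coordinate changes cancel in the product, except for the outer ones, which are `U` and `V`
(`State.Represents.exists_value_eq`).

*Initial data.* The sequences for `C_j*` and `B_j` are made from the same numbers, so that `W_j`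
is exactly the cyclic downshift of size `n + 1`, whereas `x_j` is a multiple of `(a_j, 1)` up to
`O(u)`, with a last entry of modulus at least a multiple of `1 / ‖S‖`
(`frobeniusStart_represents`).

*The product.* If `x` and `W` are perturbed by `δ` and `D`, then the error of a factor is
`L (D - δ wᵀ / x_{n+1})` with `L = [I, -a_j]` and the last row `wᵀ` of the perturbed `W`
(`obliqueFactor_sub_companion`). Bounding all the factors by powers of `‖S‖` would be hopeless,
but products of consecutive companion factors `S_p ⋯ S_q` are explicit: they have only entries
`0`, `1` and entries of `S` (`segment_companion_apply`). The same holds for `S_1 ⋯ S_{j-1} L`, so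
this product contributes one power of `‖S‖`; the term with `1 / x_{n+1}` contributes the second
power, because `wᵀ` is close to `e_nᵀ`, and the last row of `S_{j+1} ⋯ S_k` is a row of zeros and
ones. The other term has no factor `1 / x_{n+1}`, and the second power stems from `S_{j+1} ⋯ S_k`.
Summing over `j` gives the bound `‖S‖² ε` times a power of `n` (`norm_prod_obliqueFactor_sub_le`).
The restriction to small `u` serves to replace perturbed factors by exact ones in `S_{j+1} ⋯ S_k`,
and to keep the perturbed `x_{n+1}` away from zero.
-/

noncomputable section

namespace CoreChasing

/-! ### Rounding errors of the elementary operations -/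

theorem StandardModel.abs_sub_le_of_approx {u : ℝ} {fl : ℝ → ℝ} (h : StandardModel u fl)
    (hu : 0 ≤ u) {x y e : ℝ} (hy : 0 ≤ y) (hxy : |x - y| ≤ e * y) :
    |fl x - y| ≤ (e + u * (1 + e)) * y := by
  have h1 := h x
  have h2 : |x| ≤ (1 + e) * y := by
    calc |x| = |(x - y) + y| := by ring_nf
      _ ≤ |x - y| + |y| := abs_add_le _ _
      _ ≤ e * y + y := by rw [abs_of_nonneg hy]; linarith
      _ = (1 + e) * y := by ring
  calc |fl x - y| = |(fl x - x) + (x - y)| := by ring_nf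
    _ ≤ |fl x - x| + |x - y| := abs_add_le _ _
    _ ≤ u * ((1 + e) * y) + e * y := by
        gcongr
        exact h1.trans (by gcongr)
    _ = _ := by ring

theorem StandardModel.map_zero {u : ℝ} {fl : ℝ → ℝ} (h : StandardModel u fl) : fl 0 = 0 := by
  simpa using h 0

/-- The complex number obtained by rounding the real and the imaginary part. -/
def flC (fl : ℝ → ℝ) (z : ℂ) : ℂ := ⟨fl z.re, fl z.im⟩

theorem StandardModel.norm_flC_sub_le {u : ℝ} {fl : ℝ → ℝ} (h : StandardModel u fl)
    (hu : 0 ≤ u) (z : ℂ) : ‖flC fl z - z‖ ≤ u * ‖z‖ := by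
  have h1 : (fl z.re - z.re) ^ 2 ≤ u ^ 2 * z.re ^ 2 := by
    rw [← mul_pow]; exact sq_le_sq.2 ((h z.re).trans (by rw [abs_mul, abs_of_nonneg hu]))
  have h2 : (fl z.im - z.im) ^ 2 ≤ u ^ 2 * z.im ^ 2 := by
    rw [← mul_pow]; exact sq_le_sq.2 ((h z.im).trans (by rw [abs_mul, abs_of_nonneg hu]))
  refine le_of_sq_le_sq ?_ (by positivity)
  rw [mul_pow, Complex.sq_norm, Complex.sq_norm, Complex.normSq_apply, Complex.normSq_apply]
  simp only [flC, Complex.sub_re, Complex.sub_im]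
  nlinarith

theorem StandardModel.norm_flAdd_sub_le {u : ℝ} {fl : ℝ → ℝ} (h : StandardModel u fl)
    (hu : 0 ≤ u) (x y : ℂ) : ‖flAdd fl x y - (x + y)‖ ≤ u * ‖x + y‖ :=
  h.norm_flC_sub_le hu (x + y)

theorem StandardModel.norm_flSub_sub_le {u : ℝ} {fl : ℝ → ℝ} (h : StandardModel u fl)
    (hu : 0 ≤ u) (x y : ℂ) : ‖flSub fl x y - (x - y)‖ ≤ u * ‖x - y‖ :=
  h.norm_flC_sub_le hu (x - y)

theorem StandardModel.norm_flDiv_sub_le {u : ℝ} {fl : ℝ → ℝ} (h : StandardModel u fl)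
    (hu : 0 ≤ u) (x : ℂ) (r : ℝ) : ‖flDiv fl x r - x / r‖ ≤ u * ‖x / r‖ := by
  have : flDiv fl x r = flC fl (x / r) := by
    simp [flDiv, flC, Complex.div_ofReal_re, Complex.div_ofReal_im]
  rw [this]
  exact h.norm_flC_sub_le hu _

theorem StandardModel.norm_flMul_sub_le {u : ℝ} {fl : ℝ → ℝ} (h : StandardModel u fl)
    (hu : 0 ≤ u) (hu1 : u ≤ 1) (x y : ℂ) : ‖flMul fl x y - x * y‖ ≤ 8 * u * (‖x‖ * ‖y‖) := by
  set P := ‖x‖ * ‖y‖ with hP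
  have hb : ∀ a b : ℝ, |a| ≤ ‖x‖ → |b| ≤ ‖y‖ → |a * b| ≤ P := fun a b ha hb => by
    rw [abs_mul]; exact mul_le_mul ha hb (abs_nonneg _) (norm_nonneg _)
  have hr : ∀ a b : ℝ, |a| ≤ ‖x‖ → |b| ≤ ‖y‖ → |fl (a * b) - a * b| ≤ u * P := fun a b ha hb' =>
    (h _).trans (by gcongr; exact hb a b ha hb')
  have xr := Complex.abs_re_le_norm x
  have xi := Complex.abs_im_le_norm x
  have yr := Complex.abs_re_le_norm y
  have yi := Complex.abs_im_le_norm y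
  have hP0 : 0 ≤ P := by positivity
  have sub_case : ∀ s t p q : ℝ, |s - p| ≤ u * P → |t - q| ≤ u * P → |p - q| ≤ P →
      |fl (s - t) - (p - q)| ≤ 5 * u * P := by
    intro s t p q h1 h2 h3
    have h4 := h (s - t)
    have e1 : |(s - t) - (p - q)| ≤ 2 * (u * P) := by
      calc |(s - t) - (p - q)| = |(s - p) - (t - q)| := by ring_nf
        _ ≤ |s - p| + |t - q| := abs_sub _ _
        _ ≤ _ := by linarith
    have e2 : |s - t| ≤ 3 * P := by
      calc |s - t| = |((s - t) - (p - q)) + (p - q)| := by ring_nf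
        _ ≤ |(s - t) - (p - q)| + |p - q| := abs_add_le _ _
        _ ≤ 2 * (1 * P) + P := by
            refine add_le_add (e1.trans ?_) h3
            gcongr
        _ = _ := by ring
    calc |fl (s - t) - (p - q)| = |(fl (s - t) - (s - t)) + ((s - t) - (p - q))| := by ring_nf
      _ ≤ |fl (s - t) - (s - t)| + |(s - t) - (p - q)| := abs_add_le _ _
      _ ≤ u * (3 * P) + 2 * (u * P) := add_le_add (h4.trans (by gcongr)) e1
      _ = _ := by ring
  have hre : |(x * y).re| ≤ P := (Complex.abs_re_le_norm _).trans_eq (norm_mul _ _)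
  have him : |(x * y).im| ≤ P := (Complex.abs_im_le_norm _).trans_eq (norm_mul _ _)
  rw [Complex.mul_re] at hre
  rw [Complex.mul_im] at him
  have h1 := sub_case _ _ _ _ (hr _ _ xr yr) (hr _ _ xi yi) hre
  have h2 := sub_case (fl (x.re * y.im)) (-fl (x.im * y.re)) (x.re * y.im) (-(x.im * y.re))
    (hr _ _ xr yi) (by
      have := hr _ _ xi yr
      rwa [← abs_neg, show -(-fl (x.im * y.re) - -(x.im * y.re)) = fl (x.im * y.re) - x.im * y.re
        by ring]) (by rwa [sub_neg_eq_add])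
  rw [sub_neg_eq_add, sub_neg_eq_add] at h2
  refine le_of_sq_le_sq ?_ (by positivity)
  rw [Complex.sq_norm, Complex.normSq_apply]
  simp only [flMul, Complex.sub_re, Complex.sub_im, Complex.mul_re, Complex.mul_im]
  have s1 := sq_le_sq.2 (h1.trans (le_abs_self _))
  have s2 := sq_le_sq.2 (h2.trans (le_abs_self _))
  nlinarith [mul_nonneg (mul_nonneg hu hu) (mul_nonneg hP0 hP0)]

/-- The exact value of `√(|a|² + |b|²)`. -/
def hypot (a b : ℂ) : ℝ := Real.sqrt (‖a‖ ^ 2 + ‖b‖ ^ 2)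

theorem hypot_nonneg (a b : ℂ) : 0 ≤ hypot a b := Real.sqrt_nonneg _

theorem hypot_sq (a b : ℂ) : hypot a b ^ 2 = ‖a‖ ^ 2 + ‖b‖ ^ 2 := Real.sq_sqrt (by positivity)

theorem norm_le_hypot_left (a b : ℂ) : ‖a‖ ≤ hypot a b :=
  Real.le_sqrt_of_sq_le (by nlinarith [sq_nonneg ‖b‖])

theorem norm_le_hypot_right (a b : ℂ) : ‖b‖ ≤ hypot a b :=
  Real.le_sqrt_of_sq_le (by nlinarith [sq_nonneg ‖a‖])

theorem hypot_zero_right (a : ℂ) : hypot a 0 = ‖a‖ := by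
  simp [hypot]

theorem StandardModel.abs_flAbsSq_sub_le {u : ℝ} {fl : ℝ → ℝ} (h : StandardModel u fl)
    (hu : 0 ≤ u) (hu1 : u ≤ 1) (a : ℂ) : |flAbsSq fl a - ‖a‖ ^ 2| ≤ 3 * u * ‖a‖ ^ 2 := by
  have h1 := h (a.re * a.re)
  have h2 := h (a.im * a.im)
  rw [abs_of_nonneg (mul_self_nonneg a.re)] at h1
  rw [abs_of_nonneg (mul_self_nonneg a.im)] at h2
  have h3 : |fl (a.re * a.re) + fl (a.im * a.im) - ‖a‖ ^ 2| ≤ u * ‖a‖ ^ 2 := by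
    rw [Complex.sq_norm, Complex.normSq_apply]
    calc _ = |(fl (a.re * a.re) - a.re * a.re) + (fl (a.im * a.im) - a.im * a.im)| := by ring_nf
      _ ≤ _ := (abs_add_le _ _).trans (by linarith)
  refine (h.abs_sub_le_of_approx hu (by positivity) h3).trans ?_
  gcongr
  nlinarith

theorem StandardModel.abs_flHypot_sub_le {u : ℝ} {fl : ℝ → ℝ} (h : StandardModel u fl)
    (hu : 0 ≤ u) (hu1 : u ≤ 1 / 1000) (a b : ℂ) :
    |flHypot fl a b - hypot a b| ≤ 7 * u * hypot a b := by
  have h1 := h.abs_flAbsSq_sub_le hu (by linarith) a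
  have h2 := h.abs_flAbsSq_sub_le hu (by linarith) b
  set z := fl (flAbsSq fl a + flAbsSq fl b) with hz
  have h3 : |flAbsSq fl a + flAbsSq fl b - (‖a‖ ^ 2 + ‖b‖ ^ 2)| ≤ 3 * u * (‖a‖ ^ 2 + ‖b‖ ^ 2) := by
    calc _ = |(flAbsSq fl a - ‖a‖ ^ 2) + (flAbsSq fl b - ‖b‖ ^ 2)| := by ring_nf
      _ ≤ _ := (abs_add_le _ _).trans (by linarith)
  have h4 : |z - hypot a b ^ 2| ≤ 5 * u * hypot a b ^ 2 := by
    rw [hypot_sq]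
    refine (h.abs_sub_le_of_approx hu (by positivity) h3).trans ?_
    gcongr
    nlinarith
  have hh := hypot_nonneg a b
  have hz0 : 0 ≤ z := by
    have := (abs_le.1 h4).1
    nlinarith [sq_nonneg (hypot a b)]
  have h5 : |Real.sqrt z - hypot a b| ≤ 5 * u * hypot a b := by
    rcases hh.eq_or_lt with h0 | h0
    · rw [← h0] at h4 ⊢
      have : z = 0 := by simpa using h4
      simp [this]
    · have hs := Real.sqrt_nonneg z
      have e : (Real.sqrt z - hypot a b) * (Real.sqrt z + hypot a b) = z - hypot a b ^ 2 := by
        rw [← Real.sq_sqrt hz0]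
        simp only [Real.sqrt_sq hs]
        ring
      have e2 : |Real.sqrt z - hypot a b| * (Real.sqrt z + hypot a b) ≤ 5 * u * hypot a b ^ 2 := by
        rw [← abs_of_nonneg (add_nonneg hs hh), ← abs_mul, e]
        exact h4
      have e3 : |Real.sqrt z - hypot a b| * hypot a b ≤ 5 * u * hypot a b * hypot a b := by
        nlinarith [abs_nonneg (Real.sqrt z - hypot a b)]
      exact le_of_mul_le_mul_right e3 h0
  refine (h.abs_sub_le_of_approx hu hh h5).trans ?_
  gcongr
  nlinarith

/-! ### Normalization of stored core transformations -/

/-- The (1,1) entry of the active part of the matrix represented by the stored data. -/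
def Core.cosine (g : Core) : ℂ := g.c / (hypot g.c g.s : ℝ)

/-- The (2,1) entry of the active part of the matrix represented by the stored data. -/
def Core.sine (g : Core) : ℂ := g.s / (hypot g.c g.s : ℝ)

/-- The determinant of the active part of the matrix represented by the stored data. -/
def Core.phase (g : Core) : ℂ := g.p / (‖g.p‖ : ℝ)

/-- The stored data are those of a unitary matrix up to a multiple of the unit round-off. -/
structure Core.Normalized (u : ℝ) (g : Core) : Prop where
  hypot_le : |hypot g.c g.s - 1| ≤ 20 * u
  phase_le : |‖g.p‖ - 1| ≤ 20 * u

theorem Core.Normalized.hypot_pos {u : ℝ} {g : Core} (hg : g.Normalized u) (hu1 : u ≤ 1 / 1000) :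
    0 < hypot g.c g.s := by
  have := (abs_le.1 hg.hypot_le).1
  linarith

theorem Core.Normalized.phase_pos {u : ℝ} {g : Core} (hg : g.Normalized u) (hu1 : u ≤ 1 / 1000) :
    0 < ‖g.p‖ := by
  have := (abs_le.1 hg.phase_le).1
  linarith

theorem norm_div_sub_le {a : ℂ} {r : ℝ} (hr : 0 < r) (ha : ‖a‖ ≤ r) {e : ℝ} (h : |r - 1| ≤ e) :
    ‖a - a / (r : ℂ)‖ ≤ e := by
  have hr' : (r : ℂ) ≠ 0 := by exact_mod_cast hr.ne'
  have : a - a / (r : ℂ) = a / (r : ℂ) * ((r - 1 : ℝ) : ℂ) := by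
    push_cast
    field_simp
  rw [this, norm_mul, norm_div, Complex.norm_real, Complex.norm_real, Real.norm_eq_abs,
    Real.norm_eq_abs, abs_of_pos hr]
  calc ‖a‖ / r * |r - 1| ≤ 1 * e :=
        mul_le_mul ((div_le_one hr).2 ha) h (abs_nonneg _) zero_le_one
    _ = e := one_mul e

theorem Core.Normalized.norm_c_sub {u : ℝ} {g : Core} (hg : g.Normalized u) (hu1 : u ≤ 1 / 1000) :
    ‖g.c - g.cosine‖ ≤ 20 * u :=
  norm_div_sub_le (hg.hypot_pos hu1) (norm_le_hypot_left _ _) hg.hypot_le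

theorem Core.Normalized.norm_s_sub {u : ℝ} {g : Core} (hg : g.Normalized u) (hu1 : u ≤ 1 / 1000) :
    ‖g.s - g.sine‖ ≤ 20 * u :=
  norm_div_sub_le (hg.hypot_pos hu1) (norm_le_hypot_right _ _) hg.hypot_le

theorem Core.Normalized.norm_p_sub {u : ℝ} {g : Core} (hg : g.Normalized u) (hu1 : u ≤ 1 / 1000) :
    ‖g.p - g.phase‖ ≤ 20 * u :=
  norm_div_sub_le (hg.phase_pos hu1) le_rfl hg.phase_le

theorem Core.Normalized.cosine_sq_add {u : ℝ} {g : Core} (hg : g.Normalized u)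
    (hu1 : u ≤ 1 / 1000) : star g.cosine * g.cosine + star g.sine * g.sine = 1 := by
  have h := hg.hypot_pos hu1
  have h2 : ((hypot g.c g.s : ℝ) : ℂ) ^ 2 = star g.c * g.c + star g.s * g.s := by
    have := hypot_sq g.c g.s
    simp only [Complex.star_def, Complex.conj_mul']
    exact_mod_cast congrArg (fun x : ℝ => (x : ℂ)) this
  have h3 : ((hypot g.c g.s : ℝ) : ℂ) ≠ 0 := by exact_mod_cast h.ne'
  simp only [Core.cosine, Core.sine, star_div₀, Complex.star_def, Complex.conj_ofReal] at h2 ⊢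
  field_simp
  rw [h2]

theorem Core.Normalized.phase_mul {u : ℝ} {g : Core} (hg : g.Normalized u)
    (hu1 : u ≤ 1 / 1000) : star g.phase * g.phase = 1 := by
  have h := hg.phase_pos hu1
  have h3 : ((‖g.p‖ : ℝ) : ℂ) ≠ 0 := by exact_mod_cast h.ne'
  simp only [Core.phase, star_div₀, Complex.star_def, Complex.conj_ofReal]
  field_simp
  rw [mul_comm, Complex.mul_conj']

/-- A vector `(a, b)` and its floating point normalization: the latter has norm one up to rounding,
and the exactly normalized result is proportional to `(a, b)` with small componentwise relative
errors. -/
theorem normalize_spec {u : ℝ} {fl : ℝ → ℝ} (h : StandardModel u fl) (hu : 0 ≤ u)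
    (hu1 : u ≤ 1 / 1000) (a b c s : ℂ)
    (hc : c = if flHypot fl a b = 0 then 1 else flDiv fl a (flHypot fl a b))
    (hs : s = if flHypot fl a b = 0 then 0 else flDiv fl b (flHypot fl a b)) :
    |hypot c s - 1| ≤ 20 * u ∧
    ‖c / (hypot c s : ℝ) * (hypot a b : ℝ) - a‖ ≤ 20 * u * ‖a‖ ∧
    ‖s / (hypot c s : ℝ) * (hypot a b : ℝ) - b‖ ≤ 20 * u * ‖b‖ := by
  have hr := h.abs_flHypot_sub_le hu hu1 a b
  set r := flHypot fl a b with hr_def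
  set t := hypot a b with ht
  have ht0 : 0 ≤ t := hypot_nonneg a b
  rcases ht0.eq_or_lt with h0 | h0
  · have hr0 : r = 0 := by rw [← h0] at hr; simpa using hr
    have ha : a = 0 := norm_le_zero_iff.1 (by rw [h0]; exact norm_le_hypot_left a b)
    have hb : b = 0 := norm_le_zero_iff.1 (by rw [h0]; exact norm_le_hypot_right a b)
    rw [if_pos hr0] at hc hs
    subst hc hs
    rw [← h0, ha, hb]
    simp [hypot]
    exact hu
  · have hr1 := (abs_le.1 hr).1
    have hrpos : 0 < r := by nlinarith
    rw [if_neg hrpos.ne'] at hc hs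
    have key : ∀ x y : ℂ, y = flDiv fl x r → ‖y * (t : ℂ) - x‖ ≤ 9 * u * ‖x‖ := by
      intro x y hy
      have h1 := h.norm_flDiv_sub_le hu x r
      rw [← hy, norm_div, Complex.norm_real, Real.norm_eq_abs, abs_of_pos hrpos] at h1
      have hrc : (r : ℂ) ≠ 0 := by exact_mod_cast hrpos.ne'
      have e : y * (t : ℂ) - x = (y - x / r) * (t : ℂ) - x / r * ((r - t : ℝ) : ℂ) := by
        push_cast
        field_simp
        ring
      rw [e]
      refine (norm_sub_le _ _).trans ?_
      rw [norm_mul, norm_mul, norm_div, Complex.norm_real, Complex.norm_real, Complex.norm_real,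
        Real.norm_eq_abs, Real.norm_eq_abs, Real.norm_eq_abs, abs_of_pos hrpos, abs_of_pos h0]
      calc _ ≤ u * (‖x‖ / r) * t + ‖x‖ / r * (7 * u * t) := by gcongr
        _ = 8 * u * t * ‖x‖ / r := by ring
        _ ≤ 9 * u * ‖x‖ := by
          rw [div_le_iff₀ hrpos]
          have : 8 * t ≤ 9 * r := by nlinarith
          calc 8 * u * t * ‖x‖ = (u * ‖x‖) * (8 * t) := by ring
            _ ≤ (u * ‖x‖) * (9 * r) := by gcongr
            _ = _ := by ring
    have kc := key a c hc
    have ks := key b s hs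
    have habs : ∀ x y : ℂ, ‖y * (t : ℂ) - x‖ ≤ 9 * u * ‖x‖ →
        (1 - 9 * u) * ‖x‖ ≤ ‖y‖ * t ∧ ‖y‖ * t ≤ (1 + 9 * u) * ‖x‖ := by
      intro x y hxy
      have h1 : ‖y * (t : ℂ)‖ = ‖y‖ * t := by
        rw [norm_mul, Complex.norm_real, Real.norm_eq_abs, abs_of_pos h0]
      have h2 := abs_le.1 ((abs_norm_sub_norm_le (y * (t : ℂ)) x).trans hxy)
      rw [h1] at h2
      constructor <;> linarith [h2.1, h2.2]
    have hq : |hypot c s - 1| ≤ 9 * u := by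
      obtain ⟨c1, c2⟩ := habs a c kc
      obtain ⟨s1, s2⟩ := habs b s ks
      have e : (hypot c s * t) ^ 2 = (‖c‖ * t) ^ 2 + (‖s‖ * t) ^ 2 := by
        rw [mul_pow, hypot_sq]; ring
      have et : t ^ 2 = ‖a‖ ^ 2 + ‖b‖ ^ 2 := hypot_sq a b
      have hn := hypot_nonneg c s
      have l1 : (1 - 9 * u) * t ≤ hypot c s * t := by
        refine le_of_sq_le_sq ?_ (by positivity)
        rw [e, mul_pow, et, mul_add, ← mul_pow, ← mul_pow]
        have h9 : 0 ≤ 1 - 9 * u := by linarith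
        gcongr
      have l2 : hypot c s * t ≤ (1 + 9 * u) * t := by
        refine le_of_sq_le_sq ?_ (by positivity)
        rw [e, mul_pow (1 + 9 * u), et, mul_add, ← mul_pow, ← mul_pow]
        gcongr
      have l1' := le_of_mul_le_mul_right l1 h0
      have l2' := le_of_mul_le_mul_right l2 h0
      rw [abs_le]
      constructor <;> linarith
    have hpos : 0 < hypot c s := by
      have := (abs_le.1 hq).1
      linarith
    have fin : ∀ x y : ℂ, ‖y * (t : ℂ) - x‖ ≤ 9 * u * ‖x‖ →
        ‖y / (hypot c s : ℝ) * (t : ℂ) - x‖ ≤ 20 * u * ‖x‖ := by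
      intro x y hxy
      have hqc : ((hypot c s : ℝ) : ℂ) ≠ 0 := by exact_mod_cast hpos.ne'
      have e : y / (hypot c s : ℝ) * (t : ℂ) - x
          = ((y * (t : ℂ) - x) - x * ((hypot c s - 1 : ℝ) : ℂ)) / (hypot c s : ℝ) := by
        push_cast
        field_simp
        ring
      rw [e, norm_div, Complex.norm_real, Real.norm_eq_abs, abs_of_pos hpos, div_le_iff₀ hpos]
      refine (norm_sub_le _ _).trans ?_
      rw [norm_mul, Complex.norm_real, Real.norm_eq_abs]
      have := (abs_le.1 hq).1
      calc _ ≤ 9 * u * ‖x‖ + ‖x‖ * (9 * u) := by gcongr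
        _ = (u * ‖x‖) * 18 := by ring
        _ ≤ (u * ‖x‖) * (20 * hypot c s) := by gcongr; linarith
        _ = _ := by ring
    exact ⟨hq.trans (by linarith), fin a c kc, fin b s ks⟩

theorem mkCore_normalized {u : ℝ} {fl : ℝ → ℝ} (h : StandardModel u fl) (hu : 0 ≤ u)
    (hu1 : u ≤ 1 / 1000) (i : ℕ) (a b q : ℂ) : (mkCore fl i a b q).Normalized u := by
  refine ⟨(normalize_spec h hu hu1 a b _ _ rfl rfl).1, ?_⟩
  have hz : (0 : ℂ) = if flHypot fl q 0 = 0 then 0 else flDiv fl 0 (flHypot fl q 0) := by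
    split_ifs
    · rfl
    · simp [flDiv, h.map_zero, Complex.ext_iff]
  have := (normalize_spec h hu hu1 q 0 _ _ rfl hz).1
  rwa [hypot_zero_right] at this

theorem mkCore_cosine {u : ℝ} {fl : ℝ → ℝ} (h : StandardModel u fl) (hu : 0 ≤ u)
    (hu1 : u ≤ 1 / 1000) (i : ℕ) (a b q : ℂ) :
    ‖(mkCore fl i a b q).cosine * (hypot a b : ℝ) - a‖ ≤ 20 * u * ‖a‖ :=
  (normalize_spec h hu hu1 a b _ _ rfl rfl).2.1

theorem mkCore_sine {u : ℝ} {fl : ℝ → ℝ} (h : StandardModel u fl) (hu : 0 ≤ u)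
    (hu1 : u ≤ 1 / 1000) (i : ℕ) (a b q : ℂ) :
    ‖(mkCore fl i a b q).sine * (hypot a b : ℝ) - b‖ ≤ 20 * u * ‖b‖ :=
  (normalize_spec h hu hu1 a b _ _ rfl rfl).2.2

theorem mkCore_phase {u : ℝ} {fl : ℝ → ℝ} (h : StandardModel u fl) (hu : 0 ≤ u)
    (hu1 : u ≤ 1 / 1000) (i : ℕ) (a b q : ℂ) :
    ‖(mkCore fl i a b q).phase * (‖q‖ : ℝ) - q‖ ≤ 20 * u * ‖q‖ := by
  have hz : (0 : ℂ) = if flHypot fl q 0 = 0 then 0 else flDiv fl 0 (flHypot fl q 0) := by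
    split_ifs
    · rfl
    · simp [flDiv, h.map_zero, Complex.ext_iff]
  have := (normalize_spec h hu hu1 q 0 _ _ rfl hz).2.1
  rwa [hypot_zero_right, hypot_zero_right] at this

/-- A real positive determinant is stored as a positive number, whose phase is exactly one. -/
theorem mkCore_phase_one {u : ℝ} {fl : ℝ → ℝ} (h : StandardModel u fl) (hu : 0 ≤ u)
    (hu1 : u ≤ 1 / 1000) (i : ℕ) (a b : ℂ) : (mkCore fl i a b 1).phase = 1 := by
  have hn := mkCore_normalized h hu hu1 i a b 1
  have h1 := mkCore_phase h hu hu1 i a b 1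
  have hpos := hn.phase_pos hu1
  have him : (mkCore fl i a b 1).p.im = 0 := by
    simp only [mkCore]
    split_ifs
    · simp
    · simp [flDiv, h.map_zero]
  have hre : (mkCore fl i a b 1).p = (((mkCore fl i a b 1).p.re : ℝ) : ℂ) := by
    apply Complex.ext <;> simp [him]
  have hphase : (mkCore fl i a b 1).phase
      = (((mkCore fl i a b 1).p.re / |(mkCore fl i a b 1).p.re| : ℝ) : ℂ) := by
    rw [Core.phase, hre, Complex.norm_real, Real.norm_eq_abs]
    simp
  rw [hphase] at h1 ⊢
  have hne : (mkCore fl i a b 1).p.re ≠ 0 := by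
    intro h0
    rw [hre, h0] at hpos
    simp at hpos
  rcases lt_or_gt_of_ne hne with h2 | h2
  · rw [abs_of_neg h2, div_neg, div_self hne] at h1
    norm_num at h1
    linarith
  · rw [abs_of_pos h2, div_self hne]
    simp

/-! ### Uniform first order error calculus -/

/-- A floating point arithmetic obeying the standard model with a unit round-off of at most
`1 / 1000`. -/
structure Arith where
  /-- the unit round-off -/
  u : ℝ
  /-- the rounding function -/
  fl : ℝ → ℝ
  nonneg : 0 ≤ u
  le : u ≤ 1 / 1000
  model : StandardModel u fl

/-- Two families of complex numbers, indexed by data `θ` each of which comes with an arithmetic `a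
θ`, agree up to a uniform multiple of the unit round-off, and the second one is uniformly bounded.
Constants that do not depend on `θ` need not be named in this calculus. -/
def Approx {Θ : Type} (a : Θ → Arith) (f g : Θ → ℂ) : Prop :=
  ∃ C : ℝ, ∀ θ, ‖f θ - g θ‖ ≤ C * (a θ).u ∧ ‖g θ‖ ≤ C

namespace Approx

variable {Θ : Type} {a : Θ → Arith} {f g f₁ g₁ f₂ g₂ : Θ → ℂ}

theorem exists_nonneg (h : Approx a f g) :
    ∃ C : ℝ, 0 ≤ C ∧ ∀ θ, ‖f θ - g θ‖ ≤ C * (a θ).u ∧ ‖g θ‖ ≤ C ∧ ‖f θ‖ ≤ 2 * C := by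
  obtain ⟨C, hC⟩ := h
  refine ⟨|C|, abs_nonneg C, fun θ => ?_⟩
  have hu := (a θ).nonneg
  have hu1 := (a θ).le
  have h1 : ‖f θ - g θ‖ ≤ |C| * (a θ).u :=
    (hC θ).1.trans (mul_le_mul_of_nonneg_right (le_abs_self C) hu)
  have h2 : ‖g θ‖ ≤ |C| := (hC θ).2.trans (le_abs_self C)
  refine ⟨h1, h2, ?_⟩
  have h3 : ‖f θ‖ ≤ ‖f θ - g θ‖ + ‖g θ‖ := by
    simpa using norm_add_le (f θ - g θ) (g θ)
  nlinarith [abs_nonneg C]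

theorem of_norm_le {C : ℝ} (h : ∀ θ, ‖g θ‖ ≤ C) : Approx a g g :=
  ⟨|C|, fun θ => by
    simpa using ⟨mul_nonneg (abs_nonneg C) (a θ).nonneg, (h θ).trans (le_abs_self C)⟩⟩

theorem const (c : ℂ) : Approx a (fun _ => c) (fun _ => c) := of_norm_le (C := ‖c‖) fun _ => le_rfl

theorem congr (h : Approx a f g) (hf : ∀ θ, f θ = f₁ θ) (hg : ∀ θ, g θ = g₁ θ) :
    Approx a f₁ g₁ := by
  obtain rfl : f = f₁ := funext hf
  obtain rfl : g = g₁ := funext hg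
  exact h

theorem congr_right (h : Approx a f g) (hg : ∀ θ, g θ = g₁ θ) : Approx a f g₁ :=
  h.congr (fun _ => rfl) hg

theorem symm (h : Approx a f g) : Approx a g f := by
  obtain ⟨C, hC, h⟩ := h.exists_nonneg
  refine ⟨2 * C, fun θ => ⟨?_, (h θ).2.2⟩⟩
  rw [norm_sub_rev]
  refine (h θ).1.trans ?_
  nlinarith [mul_nonneg hC (a θ).nonneg]

theorem trans (h₁ : Approx a f g) (h₂ : Approx a g g₁) : Approx a f g₁ := by
  obtain ⟨C₁, hC₁, h₁⟩ := h₁.exists_nonneg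
  obtain ⟨C₂, hC₂, h₂⟩ := h₂.exists_nonneg
  refine ⟨C₁ + C₂, fun θ => ⟨?_, by linarith [(h₂ θ).2.1]⟩⟩
  have := norm_sub_le_norm_sub_add_norm_sub (f θ) (g θ) (g₁ θ)
  linarith [(h₁ θ).1, (h₂ θ).1]

theorem add (h₁ : Approx a f₁ g₁) (h₂ : Approx a f₂ g₂) :
    Approx a (fun θ => f₁ θ + f₂ θ) (fun θ => g₁ θ + g₂ θ) := by
  obtain ⟨C₁, h₁⟩ := h₁
  obtain ⟨C₂, h₂⟩ := h₂
  refine ⟨C₁ + C₂, fun θ => ⟨?_, (norm_add_le _ _).trans (add_le_add (h₁ θ).2 (h₂ θ).2)⟩⟩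
  rw [add_sub_add_comm, add_mul]
  exact (norm_add_le _ _).trans (add_le_add (h₁ θ).1 (h₂ θ).1)

theorem neg (h : Approx a f g) : Approx a (fun θ => -f θ) (fun θ => -g θ) := by
  obtain ⟨C, h⟩ := h
  refine ⟨C, fun θ => ?_⟩
  rw [norm_neg, ← neg_sub', norm_neg]
  exact h θ

theorem conj (h : Approx a f g) : Approx a (fun θ => star (f θ)) (fun θ => star (g θ)) := by
  obtain ⟨C, h⟩ := h
  refine ⟨C, fun θ => ?_⟩
  rw [← star_sub, norm_star, norm_star]
  exact h θ

theorem sub (h₁ : Approx a f₁ g₁) (h₂ : Approx a f₂ g₂) :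
    Approx a (fun θ => f₁ θ - f₂ θ) (fun θ => g₁ θ - g₂ θ) :=
  (h₁.add h₂.neg).congr (fun _ => (sub_eq_add_neg _ _).symm) (fun _ => (sub_eq_add_neg _ _).symm)

theorem mul (h₁ : Approx a f₁ g₁) (h₂ : Approx a f₂ g₂) :
    Approx a (fun θ => f₁ θ * f₂ θ) (fun θ => g₁ θ * g₂ θ) := by
  obtain ⟨C₁, hC₁, h₁⟩ := h₁.exists_nonneg
  obtain ⟨C₂, hC₂, h₂⟩ := h₂.exists_nonneg
  refine ⟨3 * (C₁ * C₂), fun θ => ⟨?_, ?_⟩⟩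
  · have e : f₁ θ * f₂ θ - g₁ θ * g₂ θ = (f₁ θ - g₁ θ) * f₂ θ + g₁ θ * (f₂ θ - g₂ θ) := by ring
    rw [e]
    refine (norm_add_le _ _).trans ?_
    rw [norm_mul, norm_mul]
    have hu := (a θ).nonneg
    calc _ ≤ (C₁ * (a θ).u) * (2 * C₂) + C₁ * (C₂ * (a θ).u) := by
          gcongr
          · exact (h₁ θ).1
          · exact (h₂ θ).2.2
          · exact (h₁ θ).2.1
          · exact (h₂ θ).1
      _ = _ := by ring
  · rw [norm_mul]
    calc _ ≤ C₁ * C₂ := mul_le_mul (h₁ θ).2.1 (h₂ θ).2.1 (norm_nonneg _) hC₁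
      _ ≤ _ := by nlinarith [mul_nonneg hC₁ hC₂]

theorem of_rel {K : ℝ} (hK : 0 ≤ K) (h : Approx a f g)
    (hf : ∀ θ, ‖f₁ θ - f θ‖ ≤ K * (a θ).u * ‖f θ‖) : Approx a f₁ g := by
  refine Approx.trans ?_ h
  obtain ⟨C, hC, h⟩ := h.exists_nonneg
  refine ⟨K * (2 * C) + 2 * C, fun θ => ⟨(hf θ).trans ?_, ?_⟩⟩
  · have hu := (a θ).nonneg
    have : K * (a θ).u * ‖f θ‖ ≤ K * (a θ).u * (2 * C) := by gcongr; exact (h θ).2.2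
    nlinarith [mul_nonneg hC hu]
  · nlinarith [(h θ).2.2, mul_nonneg hK hC]

theorem flMul (h₁ : Approx a f₁ g₁) (h₂ : Approx a f₂ g₂) :
    Approx a (fun θ => flMul (a θ).fl (f₁ θ) (f₂ θ)) (fun θ => g₁ θ * g₂ θ) :=
  (h₁.mul h₂).of_rel (K := 8) (by norm_num) fun θ => by
    rw [norm_mul]
    exact (a θ).model.norm_flMul_sub_le (a θ).nonneg ((a θ).le.trans (by norm_num)) _ _

theorem flAdd (h₁ : Approx a f₁ g₁) (h₂ : Approx a f₂ g₂) :
    Approx a (fun θ => flAdd (a θ).fl (f₁ θ) (f₂ θ)) (fun θ => g₁ θ + g₂ θ) :=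
  (h₁.add h₂).of_rel (K := 1) (by norm_num) fun θ => by
    rw [one_mul]
    exact (a θ).model.norm_flAdd_sub_le (a θ).nonneg _ _

theorem flSub (h₁ : Approx a f₁ g₁) (h₂ : Approx a f₂ g₂) :
    Approx a (fun θ => flSub (a θ).fl (f₁ θ) (f₂ θ)) (fun θ => g₁ θ - g₂ θ) :=
  (h₁.sub h₂).of_rel (K := 1) (by norm_num) fun θ => by
    rw [one_mul]
    exact (a θ).model.norm_flSub_sub_le (a θ).nonneg _ _

theorem hypot (h₁ : Approx a f₁ g₁) (h₂ : Approx a f₂ g₂) :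
    Approx a (fun θ => ((hypot (f₁ θ) (f₂ θ) : ℝ) : ℂ))
      (fun θ => ((CoreChasing.hypot (f₁ θ) (f₂ θ) : ℝ) : ℂ)) := by
  obtain ⟨C₁, hC₁, h₁⟩ := h₁.exists_nonneg
  obtain ⟨C₂, hC₂, h₂⟩ := h₂.exists_nonneg
  refine of_norm_le (C := 2 * C₁ + 2 * C₂) fun θ => ?_
  rw [Complex.norm_real, Real.norm_eq_abs, abs_of_nonneg (hypot_nonneg _ _)]
  refine Real.sqrt_le_iff.2 ⟨by positivity, ?_⟩
  have e₁ := (h₁ θ).2.2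
  have e₂ := (h₂ θ).2.2
  nlinarith [norm_nonneg (f₁ θ), norm_nonneg (f₂ θ)]

theorem flHypot (h₁ : Approx a f₁ g₁) (h₂ : Approx a f₂ g₂) :
    Approx a (fun θ => ((flHypot (a θ).fl (f₁ θ) (f₂ θ) : ℝ) : ℂ))
      (fun θ => ((CoreChasing.hypot (f₁ θ) (f₂ θ) : ℝ) : ℂ)) :=
  (h₁.hypot h₂).of_rel (K := 7) (by norm_num) fun θ => by
    rw [← Complex.ofReal_sub, Complex.norm_real, Complex.norm_real, Real.norm_eq_abs,
      Real.norm_eq_abs, abs_of_nonneg (hypot_nonneg _ _)]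
    exact (a θ).model.abs_flHypot_sub_le (a θ).nonneg (a θ).le _ _

/-- A nonnegative number whose square is close to one is close to one. -/
theorem one_of_sq {h : Θ → ℝ} (h0 : ∀ θ, 0 ≤ h θ)
    (hh : Approx a (fun θ => ((h θ : ℝ) : ℂ) * ((h θ : ℝ) : ℂ)) (fun _ => 1)) :
    Approx a (fun θ => ((h θ : ℝ) : ℂ)) (fun _ => 1) := by
  obtain ⟨C, hC⟩ := hh
  refine ⟨C, fun θ => ⟨le_trans ?_ (hC θ).1, (hC θ).2⟩⟩
  have e : ((h θ : ℝ) : ℂ) * ((h θ : ℝ) : ℂ) - 1 =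
      (((h θ : ℝ) : ℂ) - 1) * (((h θ + 1 : ℝ)) : ℂ) := by
    push_cast; ring
  rw [e, norm_mul, Complex.norm_real, Real.norm_eq_abs, abs_of_nonneg (by linarith [h0 θ])]
  nlinarith [norm_nonneg (((h θ : ℝ) : ℂ) - 1), h0 θ]

theorem mkCore_cosine (h₁ : Approx a f₁ g₁) (i : Θ → ℕ) (q : Θ → ℂ) (f₂ : Θ → ℂ) :
    Approx a (fun θ => (mkCore (a θ).fl (i θ) (f₁ θ) (f₂ θ) (q θ)).cosine *
      ((CoreChasing.hypot (f₁ θ) (f₂ θ) : ℝ) : ℂ)) g₁ :=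
  h₁.of_rel (K := 20) (by norm_num) fun θ =>
    CoreChasing.mkCore_cosine (a θ).model (a θ).nonneg (a θ).le _ _ _ _

theorem mkCore_sine (h₂ : Approx a f₂ g₂) (i : Θ → ℕ) (q : Θ → ℂ) (f₁ : Θ → ℂ) :
    Approx a (fun θ => (mkCore (a θ).fl (i θ) (f₁ θ) (f₂ θ) (q θ)).sine *
      ((CoreChasing.hypot (f₁ θ) (f₂ θ) : ℝ) : ℂ)) g₂ :=
  h₂.of_rel (K := 20) (by norm_num) fun θ =>
    CoreChasing.mkCore_sine (a θ).model (a θ).nonneg (a θ).le _ _ _ _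

/-- Annihilation of the second of two entries by a rotation computed in floating point. -/
theorem rotation (h₁ : Approx a f₁ g₁) (h₂ : Approx a f₂ g₂) (i : Θ → ℕ) (q : Θ → ℂ) :
    ∃ h : Θ → ℝ, (∀ θ, 0 ≤ h θ) ∧
      Approx a (fun θ => (mkCore (a θ).fl (i θ) (f₁ θ) (f₂ θ) (q θ)).cosine * (h θ : ℂ)) g₁ ∧
      Approx a (fun θ => (mkCore (a θ).fl (i θ) (f₁ θ) (f₂ θ) (q θ)).sine * (h θ : ℂ)) g₂ ∧
      Approx a (fun θ => ((CoreChasing.flHypot (a θ).fl (f₁ θ) (f₂ θ) : ℝ) : ℂ))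
        (fun θ => (h θ : ℂ)) :=
  ⟨fun θ => CoreChasing.hypot (f₁ θ) (f₂ θ), fun _ => hypot_nonneg _ _,
    h₁.mkCore_cosine i q f₂, h₂.mkCore_sine i q f₁, h₁.flHypot h₂⟩

end Approx

section Stored

variable {Θ : Type} {a : Θ → Arith} {F : Θ → Core}

theorem norm_le_one_of_star_mul_add {x y : ℂ} (h : star x * x + star y * y = 1) : ‖x‖ ≤ 1 := by
  have h' : ‖x‖ ^ 2 + ‖y‖ ^ 2 = 1 := by
    simp only [Complex.star_def, Complex.conj_mul'] at h
    exact_mod_cast h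
  nlinarith [norm_nonneg x, sq_nonneg ‖y‖]

theorem norm_eq_one_of_star_mul {x : ℂ} (h : star x * x = 1) : ‖x‖ = 1 := by
  have h' : ‖x‖ ^ 2 = 1 := by
    simp only [Complex.star_def, Complex.conj_mul'] at h
    exact_mod_cast h
  nlinarith [norm_nonneg x]

theorem Core.Normalized.norm_cosine {u : ℝ} {g : Core} (hg : g.Normalized u)
    (hu1 : u ≤ 1 / 1000) : ‖g.cosine‖ ≤ 1 :=
  norm_le_one_of_star_mul_add (hg.cosine_sq_add hu1)

theorem Core.Normalized.norm_sine {u : ℝ} {g : Core} (hg : g.Normalized u)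
    (hu1 : u ≤ 1 / 1000) : ‖g.sine‖ ≤ 1 :=
  norm_le_one_of_star_mul_add ((add_comm _ _).trans (hg.cosine_sq_add hu1))

theorem Core.Normalized.norm_phase {u : ℝ} {g : Core} (hg : g.Normalized u)
    (hu1 : u ≤ 1 / 1000) : ‖g.phase‖ = 1 :=
  norm_eq_one_of_star_mul (hg.phase_mul hu1)

theorem Approx.cosine (hF : ∀ θ, (F θ).Normalized (a θ).u) :
    Approx a (fun θ => (F θ).cosine) (fun θ => (F θ).cosine) :=
  Approx.of_norm_le fun θ => (hF θ).norm_cosine (a θ).le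

theorem Approx.sine (hF : ∀ θ, (F θ).Normalized (a θ).u) :
    Approx a (fun θ => (F θ).sine) (fun θ => (F θ).sine) :=
  Approx.of_norm_le fun θ => (hF θ).norm_sine (a θ).le

theorem Approx.phase (hF : ∀ θ, (F θ).Normalized (a θ).u) :
    Approx a (fun θ => (F θ).phase) (fun θ => (F θ).phase) :=
  Approx.of_norm_le fun θ => ((hF θ).norm_phase (a θ).le).le

theorem Approx.stored_c (hF : ∀ θ, (F θ).Normalized (a θ).u) :
    Approx a (fun θ => (F θ).c) (fun θ => (F θ).cosine) :=
  ⟨20, fun θ => ⟨(hF θ).norm_c_sub (a θ).le,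
    ((hF θ).norm_cosine (a θ).le).trans (by norm_num)⟩⟩

theorem Approx.stored_s (hF : ∀ θ, (F θ).Normalized (a θ).u) :
    Approx a (fun θ => (F θ).s) (fun θ => (F θ).sine) :=
  ⟨20, fun θ => ⟨(hF θ).norm_s_sub (a θ).le,
    ((hF θ).norm_sine (a θ).le).trans (by norm_num)⟩⟩

theorem Approx.stored_p (hF : ∀ θ, (F θ).Normalized (a θ).u) :
    Approx a (fun θ => (F θ).p) (fun θ => (F θ).phase) :=
  ⟨20, fun θ => ⟨(hF θ).norm_p_sub (a θ).le,
    ((hF θ).norm_phase (a θ).le).le.trans (by norm_num)⟩⟩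

theorem Approx.e12 (hF : ∀ θ, (F θ).Normalized (a θ).u) :
    Approx a (fun θ => (F θ).e12 (a θ).fl) (fun θ => -(star (F θ).sine * (F θ).phase)) :=
  ((Approx.stored_s hF).conj.flMul (Approx.stored_p hF)).neg

theorem Approx.e22 (hF : ∀ θ, (F θ).Normalized (a θ).u) :
    Approx a (fun θ => (F θ).e22 (a θ).fl) (fun θ => star (F θ).cosine * (F θ).phase) :=
  (Approx.stored_c hF).conj.flMul (Approx.stored_p hF)

/-- Normalization in floating point is stable when the exact data are already normalized. -/
theorem Approx.mkCore_of_unit {x y q x' y' δ : Θ → ℂ} (i : Θ → ℕ) (hx : Approx a x x')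
    (hy : Approx a y y') (hq : Approx a q δ) (hδ : ∀ θ, star (δ θ) * δ θ = 1)
    (h1 : Approx a (fun θ => star (x' θ) * x' θ + star (y' θ) * y' θ) (fun _ => 1)) :
    Approx a (fun θ => (mkCore (a θ).fl (i θ) (x θ) (y θ) (q θ)).cosine) x' ∧
    Approx a (fun θ => (mkCore (a θ).fl (i θ) (x θ) (y θ) (q θ)).sine) y' ∧
    Approx a (fun θ => (mkCore (a θ).fl (i θ) (x θ) (y θ) (q θ)).phase) δ := by
  have hn : ∀ θ, (mkCore (a θ).fl (i θ) (x θ) (y θ) (q θ)).Normalized (a θ).u := fun θ =>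
    mkCore_normalized (a θ).model (a θ).nonneg (a θ).le _ _ _ _
  have hh : Approx a (fun θ => ((CoreChasing.hypot (x θ) (y θ) : ℝ) : ℂ)) (fun _ => 1) := by
    refine Approx.one_of_sq (fun θ => hypot_nonneg _ _) ?_
    refine Approx.trans ?_ h1
    refine ((hx.conj.mul hx).add (hy.conj.mul hy)).congr (fun θ => ?_) (fun _ => rfl)
    rw [← Complex.ofReal_mul, ← sq, hypot_sq]
    simp only [Complex.star_def, Complex.conj_mul']
    push_cast
    rfl
  have hq1 : Approx a (fun θ => ((‖q θ‖ : ℝ) : ℂ)) (fun _ => 1) := by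
    refine Approx.one_of_sq (fun θ => norm_nonneg _) ?_
    refine (hq.conj.mul hq).congr (fun θ => ?_) (fun θ => hδ θ)
    rw [Complex.star_def, Complex.conj_mul', sq]
  have step : ∀ {z w : Θ → ℂ} {h : Θ → ℂ}, Approx a z z → Approx a h (fun _ => 1) →
      Approx a (fun θ => z θ * h θ) w → Approx a z w := by
    intro z w h hz hh hw
    exact ((hz.mul hh).symm.congr (fun θ => mul_one _) (fun _ => rfl)).trans hw
  refine ⟨step (Approx.cosine hn) hh (hx.mkCore_cosine i q y),
    step (Approx.sine hn) hh (hy.mkCore_sine i q x), step (Approx.phase hn) hq1 ?_⟩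
  exact hq.of_rel (K := 20) (by norm_num) fun θ =>
    mkCore_phase (a θ).model (a θ).nonneg (a θ).le _ _ _ _

end Stored

/-! ### Backward stability of turnovers, fusions and deflations -/

/-- The active part of a core transformation. -/
def active (c s t : ℂ) : Matrix (Fin 2) (Fin 2) ℂ :=
  !![c, -(star s * t); s, star c * t]

/-- A core transformation of size three acting on the first two rows. -/
def lead (c s t : ℂ) : Matrix (Fin 3) (Fin 3) ℂ :=
  !![c, -(star s * t), 0; s, star c * t, 0; 0, 0, 1]

/-- A core transformation of size three acting on the last two rows. -/
def trail (c s t : ℂ) : Matrix (Fin 3) (Fin 3) ℂ :=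
  !![1, 0, 0; 0, c, -(star s * t); 0, s, star c * t]

theorem active_mem_unitaryGroup {c s t : ℂ} (h : star c * c + star s * s = 1)
    (ht : star t * t = 1) : active c s t ∈ unitaryGroup (Fin 2) ℂ := by
  rw [mem_unitaryGroup_iff']
  ext i j
  fin_cases i <;> fin_cases j <;>
    simp [active, star_eq_conjTranspose, Matrix.mul_apply, Fin.sum_univ_succ] at h ht ⊢ <;> grind

theorem lead_mem_unitaryGroup {c s t : ℂ} (h : star c * c + star s * s = 1)
    (ht : star t * t = 1) : lead c s t ∈ unitaryGroup (Fin 3) ℂ := by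
  rw [mem_unitaryGroup_iff']
  ext i j
  fin_cases i <;> fin_cases j <;>
    simp [lead, star_eq_conjTranspose, Matrix.mul_apply, Fin.sum_univ_succ] at h ht ⊢ <;> grind

theorem trail_mem_unitaryGroup {c s t : ℂ} (h : star c * c + star s * s = 1)
    (ht : star t * t = 1) : trail c s t ∈ unitaryGroup (Fin 3) ℂ := by
  rw [mem_unitaryGroup_iff']
  ext i j
  fin_cases i <;> fin_cases j <;>
    simp [trail, star_eq_conjTranspose, Matrix.mul_apply, Fin.sum_univ_succ] at h ht ⊢ <;> grind

theorem det_lead {c s t : ℂ} (h : star c * c + star s * s = 1) : (lead c s t).det = t := by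
  simp [lead, det_fin_three] at h ⊢
  grind

theorem det_trail {c s t : ℂ} (h : star c * c + star s * s = 1) : (trail c s t).det = t := by
  simp [trail, det_fin_three] at h ⊢
  grind

/-- The entries of a unitary matrix are, up to the determinant, the conjugate cofactors. -/
theorem unitary_apply_eq_cofactor {N : Matrix (Fin 3) (Fin 3) ℂ}
    (hN : N ∈ unitaryGroup (Fin 3) ℂ) (i j : Fin 3) :
    N i j = N.det * star (adjugate N j i) := by
  have h1 : adjugate N = N.det • star N := by
    calc adjugate N = adjugate N * (N * star N) := by
          rw [(mem_unitaryGroup_iff).1 hN, mul_one]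
      _ = _ := by rw [← Matrix.mul_assoc, adjugate_mul, smul_mul_assoc, one_mul]
  have h2 : star N.det * N.det = 1 := (det_of_mem_unitary hN).1
  rw [h1]
  simp only [Matrix.smul_apply, star_eq_conjTranspose, conjTranspose_apply, smul_eq_mul, star_mul',
    star_star]
  rw [← mul_assoc, mul_comm N.det, h2, one_mul]

/-- Entrywise agreement of two families of matrices up to a uniform multiple of the unit
round-off. -/
def MatApprox {Θ ι κ : Type} (a : Θ → Arith) (A B : Θ → Matrix ι κ ℂ) : Prop :=
  ∀ i j, Approx a (fun θ => A θ i j) (fun θ => B θ i j)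

theorem MatApprox.mul {Θ ι : Type} [Fintype ι] {a : Θ → Arith} {A B A' B' : Θ → Matrix ι ι ℂ}
    (h : MatApprox a A A') (h' : MatApprox a B B') :
    MatApprox a (fun θ => A θ * B θ) (fun θ => A' θ * B' θ) := by
  intro i j
  simp only [Matrix.mul_apply]
  have : ∀ s : Finset ι, Approx a (fun θ => ∑ l ∈ s, A θ i l * B θ l j)
      (fun θ => ∑ l ∈ s, A' θ i l * B' θ l j) := by
    intro s
    classical
    induction s using Finset.induction_on with
    | empty => simpa using Approx.const (a := a) 0
    | insert l s hl ih =>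
      simp only [Finset.sum_insert hl]
      exact ((h i l).mul (h' l j)).add ih
  exact this _

theorem MatApprox.of_unitary {Θ ι : Type} [Fintype ι] [DecidableEq ι] {a : Θ → Arith}
    {A : Θ → Matrix ι ι ℂ} (h : ∀ θ, A θ ∈ unitaryGroup ι ℂ) : MatApprox a A A := fun i j =>
  Approx.of_norm_le fun θ => entry_norm_bound_of_unitary (h θ) i j

/-- If the first column of a unitary matrix is close to that of the identity, then the matrix is
close to one that acts on the last two rows only. -/
theorem approx_trail {Θ : Type} {a : Θ → Arith} {N : Θ → Matrix (Fin 3) (Fin 3) ℂ}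
    (hN : ∀ θ, N θ ∈ unitaryGroup (Fin 3) ℂ) (h00 : Approx a (fun θ => N θ 0 0) (fun _ => 1))
    (h10 : Approx a (fun θ => N θ 1 0) (fun _ => 0))
    (h20 : Approx a (fun θ => N θ 2 0) (fun _ => 0)) :
    MatApprox a N (fun θ => trail (N θ 1 1) (N θ 2 1) (N θ).det) := by
  have hd : Approx a (fun θ => (N θ).det) (fun θ => (N θ).det) := Approx.of_norm_le (C := 1)
    fun θ => (norm_eq_one_of_star_mul (det_of_mem_unitary (hN θ)).1).le
  have hu := MatApprox.of_unitary (a := a) hN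
  have hcof : ∀ i j, Approx a (fun θ => (N θ).det * star (adjugate (N θ) j i))
      (fun θ => N θ i j) := fun i j =>
    (hu i j).congr (fun θ => unitary_apply_eq_cofactor (hN θ) i j) (fun _ => rfl)
  have h01 : Approx a (fun θ => N θ 0 1) (fun _ => 0) := by
    refine (hcof 0 1).symm.trans ?_
    refine (hd.mul ((h10.mul (hu 2 2)).neg.add ((hu 1 2).mul h20)).conj).congr (fun θ => ?_)
      (fun θ => by simp)
    simp [adjugate_fin_three]
  have h02 : Approx a (fun θ => N θ 0 2) (fun _ => 0) := by
    refine (hcof 0 2).symm.trans ?_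
    refine (hd.mul ((h10.mul (hu 2 1)).sub ((hu 1 1).mul h20)).conj).congr (fun θ => ?_)
      (fun θ => by simp)
    simp [adjugate_fin_three]
  have h12 : Approx a (fun θ => N θ 1 2) (fun θ => -(star (N θ 2 1) * (N θ).det)) := by
    refine (hcof 1 2).symm.trans ?_
    refine (hd.mul ((h00.mul (hu 2 1)).neg.add (h01.mul h20)).conj).congr (fun θ => ?_)
      (fun θ => by simp; ring)
    simp [adjugate_fin_three]
  have h22 : Approx a (fun θ => N θ 2 2) (fun θ => star (N θ 1 1) * (N θ).det) := by
    refine (hcof 2 2).symm.trans ?_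
    refine (hd.mul ((h00.mul (hu 1 1)).sub (h01.mul h10)).conj).congr (fun θ => ?_)
      (fun θ => by simp; ring)
    simp [adjugate_fin_three]
  intro i j
  fin_cases i <;> fin_cases j
  exacts [h00, h01, h02, h10, hu 1 1, h12, h20, hu 2 1, h22]

/-- If the last column of a unitary matrix is close to that of the identity, then the matrix is
close to one that acts on the first two rows only. -/
theorem approx_lead {Θ : Type} {a : Θ → Arith} {N : Θ → Matrix (Fin 3) (Fin 3) ℂ}
    (hN : ∀ θ, N θ ∈ unitaryGroup (Fin 3) ℂ) (h22 : Approx a (fun θ => N θ 2 2) (fun _ => 1))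
    (h12 : Approx a (fun θ => N θ 1 2) (fun _ => 0))
    (h02 : Approx a (fun θ => N θ 0 2) (fun _ => 0)) :
    MatApprox a N (fun θ => lead (N θ 0 0) (N θ 1 0) (N θ).det) := by
  have hd : Approx a (fun θ => (N θ).det) (fun θ => (N θ).det) := Approx.of_norm_le (C := 1)
    fun θ => (norm_eq_one_of_star_mul (det_of_mem_unitary (hN θ)).1).le
  have hu := MatApprox.of_unitary (a := a) hN
  have hcof : ∀ i j, Approx a (fun θ => (N θ).det * star (adjugate (N θ) j i))
      (fun θ => N θ i j) := fun i j =>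
    (hu i j).congr (fun θ => unitary_apply_eq_cofactor (hN θ) i j) (fun _ => rfl)
  have h20 : Approx a (fun θ => N θ 2 0) (fun _ => 0) := by
    refine (hcof 2 0).symm.trans ?_
    refine (hd.mul (((hu 0 1).mul h12).sub (h02.mul (hu 1 1))).conj).congr (fun θ => ?_)
      (fun θ => by simp)
    simp [adjugate_fin_three]
  have h21 : Approx a (fun θ => N θ 2 1) (fun _ => 0) := by
    refine (hcof 2 1).symm.trans ?_
    refine (hd.mul (((hu 0 0).mul h12).neg.add (h02.mul (hu 1 0))).conj).congr (fun θ => ?_)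
      (fun θ => by simp)
    simp [adjugate_fin_three]
  have h01 : Approx a (fun θ => N θ 0 1) (fun θ => -(star (N θ 1 0) * (N θ).det)) := by
    refine (hcof 0 1).symm.trans ?_
    refine (hd.mul (((hu 1 0).mul h22).neg.add (h12.mul h20)).conj).congr (fun θ => ?_)
      (fun θ => by simp; ring)
    simp [adjugate_fin_three]
  have h11 : Approx a (fun θ => N θ 1 1) (fun θ => star (N θ 0 0) * (N θ).det) := by
    refine (hcof 1 1).symm.trans ?_
    refine (hd.mul (((hu 0 0).mul h22).sub (h02.mul h20)).conj).congr (fun θ => ?_)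
      (fun θ => by simp; ring)
    simp [adjugate_fin_three]
  intro i j
  fin_cases i <;> fin_cases j
  exacts [hu 0 0, h01, h02, hu 1 0, h11, h12, h20, h21, h22]

theorem MatApprox.trail_congr {Θ : Type} {a : Θ → Arith} {c s t c' s' t' : Θ → ℂ}
    (hc : Approx a c c') (hs : Approx a s s') (ht : Approx a t t') :
    MatApprox a (fun θ => trail (c θ) (s θ) (t θ)) (fun θ => trail (c' θ) (s' θ) (t' θ)) := by
  intro i j
  fin_cases i <;> fin_cases j
  exacts [Approx.const 1, Approx.const 0, Approx.const 0, Approx.const 0, hc,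
    (hs.conj.mul ht).neg, Approx.const 0, hs, hc.conj.mul ht]

theorem MatApprox.lead_congr {Θ : Type} {a : Θ → Arith} {c s t c' s' t' : Θ → ℂ}
    (hc : Approx a c c') (hs : Approx a s s') (ht : Approx a t t') :
    MatApprox a (fun θ => lead (c θ) (s θ) (t θ)) (fun θ => lead (c' θ) (s' θ) (t' θ)) := by
  intro i j
  fin_cases i <;> fin_cases j
  exacts [hc, (hs.conj.mul ht).neg, Approx.const 0, hs, hc.conj.mul ht, Approx.const 0,
    Approx.const 0, Approx.const 0, Approx.const 1]

theorem MatApprox.trans {Θ ι κ : Type} {a : Θ → Arith} {A B C : Θ → Matrix ι κ ℂ}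
    (h : MatApprox a A B) (h' : MatApprox a B C) : MatApprox a A C :=
  fun i j => (h i j).trans (h' i j)

theorem MatApprox.symm {Θ ι κ : Type} {a : Θ → Arith} {A B : Θ → Matrix ι κ ℂ}
    (h : MatApprox a A B) : MatApprox a B A :=
  fun i j => (h i j).symm

/-- The active part of the matrix represented by stored data. -/
def Core.active (g : Core) : Matrix (Fin 2) (Fin 2) ℂ :=
  CoreChasing.active g.cosine g.sine g.phase

/-- The represented matrix of size three, acting on the first two rows. -/
def Core.lead (g : Core) : Matrix (Fin 3) (Fin 3) ℂ :=
  CoreChasing.lead g.cosine g.sine g.phase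

/-- The represented matrix of size three, acting on the last two rows. -/
def Core.trail (g : Core) : Matrix (Fin 3) (Fin 3) ℂ :=
  CoreChasing.trail g.cosine g.sine g.phase

theorem Core.Normalized.active_mem {u : ℝ} {g : Core} (hg : g.Normalized u)
    (hu1 : u ≤ 1 / 1000) : g.active ∈ unitaryGroup (Fin 2) ℂ :=
  active_mem_unitaryGroup (hg.cosine_sq_add hu1) (hg.phase_mul hu1)

theorem Core.Normalized.lead_mem {u : ℝ} {g : Core} (hg : g.Normalized u)
    (hu1 : u ≤ 1 / 1000) : g.lead ∈ unitaryGroup (Fin 3) ℂ :=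
  lead_mem_unitaryGroup (hg.cosine_sq_add hu1) (hg.phase_mul hu1)

theorem Core.Normalized.trail_mem {u : ℝ} {g : Core} (hg : g.Normalized u)
    (hu1 : u ≤ 1 / 1000) : g.trail ∈ unitaryGroup (Fin 3) ℂ :=
  trail_mem_unitaryGroup (hg.cosine_sq_add hu1) (hg.phase_mul hu1)

theorem Core.Normalized.det_lead {u : ℝ} {g : Core} (hg : g.Normalized u)
    (hu1 : u ≤ 1 / 1000) : g.lead.det = g.phase :=
  CoreChasing.det_lead (hg.cosine_sq_add hu1)

theorem Core.Normalized.det_trail {u : ℝ} {g : Core} (hg : g.Normalized u)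
    (hu1 : u ≤ 1 / 1000) : g.trail.det = g.phase :=
  CoreChasing.det_trail (hg.cosine_sq_add hu1)

theorem conjTranspose_mul_self_apply_of_unitary {ι : Type} [Fintype ι] [DecidableEq ι]
    {N : Matrix ι ι ℂ} (hN : N ∈ unitaryGroup ι ℂ) (j : ι) : ∑ l, star (N l j) * N l j = 1 := by
  have := congrFun (congrFun ((mem_unitaryGroup_iff').1 hN) j) j
  simpa [Matrix.mul_apply, star_eq_conjTranspose] using this

section

variable {Θ : Type} {a : Θ → Arith} {F G H : Θ → Core}

/-- The annihilating rotation of a QR or QL step need not depend continuously on the entries from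
which it is computed, so its stability is established through the matrix `N` that remains
after the exact rotations represented by the computed data have been removed. `N` is exactly
unitary and its first column is close to that of the identity. -/
theorem turnoverDown_approx (hF : ∀ θ, (F θ).Normalized (a θ).u)
    (hG : ∀ θ, (G θ).Normalized (a θ).u) (hH : ∀ θ, (H θ).Normalized (a θ).u) :
    MatApprox a
      (fun θ => (turnoverDown (a θ).fl (F θ) (G θ) (H θ)).1.trail *
        (turnoverDown (a θ).fl (F θ) (G θ) (H θ)).2.1.lead *
        (turnoverDown (a θ).fl (F θ) (G θ) (H θ)).2.2.trail)
      (fun θ => (F θ).lead * (G θ).trail * (H θ).lead) := by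
  set M : Θ → Matrix (Fin 3) (Fin 3) ℂ := fun θ => (F θ).lead * (G θ).trail * (H θ).lead with hM
  have hMu : ∀ θ, M θ ∈ unitaryGroup (Fin 3) ℂ := fun θ =>
    mul_mem (mul_mem ((hF θ).lead_mem (a θ).le) ((hG θ).trail_mem (a θ).le))
      ((hH θ).lead_mem (a θ).le)
  have cF := Approx.stored_c hF
  have sF := Approx.stored_s hF
  have pF := Approx.stored_p hF
  have cG := Approx.stored_c hG
  have sG := Approx.stored_s hG
  have pG := Approx.stored_p hG
  have cH := Approx.stored_c hH
  have sH := Approx.stored_s hH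
  have pH := Approx.stored_p hH
  have x1 := (Approx.e12 hF).flMul cG
  have x2 := (Approx.e22 hF).flMul cG
  have m11 := ((cF.flMul cH).flAdd (x1.flMul sH)).congr_right (g₁ := fun θ => M θ 0 0) fun θ => by
    simp [hM, Core.lead, Core.trail, lead, trail]
  have m21 := ((sF.flMul cH).flAdd (x2.flMul sH)).congr_right (g₁ := fun θ => M θ 1 0) fun θ => by
    simp [hM, Core.lead, Core.trail, lead, trail]
  have m31 := (sG.flMul sH).congr_right (g₁ := fun θ => M θ 2 0) fun θ => by
    simp [hM, Core.lead, Core.trail, lead, trail]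
  have m12 := ((cF.flMul (Approx.e12 hH)).flAdd (x1.flMul (Approx.e22 hH))).congr_right
    (g₁ := fun θ => M θ 0 1) fun θ => by
    simp [hM, Core.lead, Core.trail, lead, trail]
  have m22 := ((sF.flMul (Approx.e12 hH)).flAdd (x2.flMul (Approx.e22 hH))).congr_right
    (g₁ := fun θ => M θ 1 1) fun θ => by
    simp [hM, Core.lead, Core.trail, lead, trail]
  have m32 := (sG.flMul (Approx.e22 hH)).congr_right (g₁ := fun θ => M θ 2 1) fun θ => by
    simp [hM, Core.lead, Core.trail, lead, trail]
  set F' : Θ → Core := fun θ => (turnoverDown (a θ).fl (F θ) (G θ) (H θ)).1 with hF'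
  set G' : Θ → Core := fun θ => (turnoverDown (a θ).fl (F θ) (G θ) (H θ)).2.1 with hG'
  set H' : Θ → Core := fun θ => (turnoverDown (a θ).fl (F θ) (G θ) (H θ)).2.2 with hH'
  have nF' : ∀ θ, (F' θ).Normalized (a θ).u := fun θ =>
    mkCore_normalized (a θ).model (a θ).nonneg (a θ).le _ _ _ _
  have nG' : ∀ θ, (G' θ).Normalized (a θ).u := fun θ =>
    mkCore_normalized (a θ).model (a θ).nonneg (a θ).le _ _ _ _
  have uF' : ∀ θ, star (F' θ).cosine * (F' θ).cosine + star (F' θ).sine * (F' θ).sine = 1 :=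
    fun θ => (nF' θ).cosine_sq_add (a θ).le
  have uG' : ∀ θ, star (G' θ).cosine * (G' θ).cosine + star (G' θ).sine * (G' θ).sine = 1 :=
    fun θ => (nG' θ).cosine_sq_add (a θ).le
  have pF' : ∀ θ, (F' θ).phase = 1 := fun θ =>
    mkCore_phase_one (a θ).model (a θ).nonneg (a θ).le _ _ _
  have pG' : ∀ θ, (G' θ).phase = 1 := fun θ =>
    mkCore_phase_one (a θ).model (a θ).nonneg (a θ).le _ _ _
  have γ₁ := Approx.cosine nF'
  have σ₁ := Approx.sine nF'
  have γ₂ := Approx.cosine nG'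
  have σ₂ := Approx.sine nG'
  -- `N₁` is what remains of `M` after the removal of `F'`
  set N₁ : Θ → Matrix (Fin 3) (Fin 3) ℂ := fun θ => star (F' θ).trail * M θ with hN₁
  have hN₁u : ∀ θ, N₁ θ ∈ unitaryGroup (Fin 3) ℂ := fun θ =>
    mul_mem (Unitary.star_mem ((nF' θ).trail_mem (a θ).le)) (hMu θ)
  have e0 : ∀ θ j, N₁ θ 0 j = M θ 0 j := fun θ j => by
    simp [hN₁, Core.trail, trail, star_eq_conjTranspose, Matrix.mul_apply, Fin.sum_univ_succ]
  have e1 : ∀ θ j, N₁ θ 1 j = star (F' θ).cosine * M θ 1 j + star (F' θ).sine * M θ 2 j :=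
    fun θ j => by
    simp [hN₁, Core.trail, trail, star_eq_conjTranspose, Matrix.mul_apply, Fin.sum_univ_succ]
  have e2 : ∀ θ j, N₁ θ 2 j = (F' θ).cosine * M θ 2 j - (F' θ).sine * M θ 1 j := fun θ j => by
    simp [hN₁, Core.trail, trail, star_eq_conjTranspose, Matrix.mul_apply, Fin.sum_univ_succ, pF']
    ring
  obtain ⟨h₁, -, A1, A2, r1⟩ : ∃ h : Θ → ℝ, (∀ θ, 0 ≤ h θ) ∧
      Approx a (fun θ => (F' θ).cosine * (h θ : ℂ)) (fun θ => M θ 1 0) ∧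
      Approx a (fun θ => (F' θ).sine * (h θ : ℂ)) (fun θ => M θ 2 0) ∧ Approx a _ _ :=
    m21.rotation m31 (fun θ => (F θ).idx + 1) (fun _ => 1)
  have A1' := A1.symm
  have A2' := A2.symm
  have n10 : Approx a (fun θ => N₁ θ 1 0) (fun θ => (h₁ θ : ℂ)) := by
    refine ((γ₁.conj.mul A1').add (σ₁.conj.mul A2')).congr (fun θ => (e1 θ 0).symm) fun θ => ?_
    linear_combination (h₁ θ : ℂ) * uF' θ
  have n20 : Approx a (fun θ => N₁ θ 2 0) (fun _ => 0) := by
    refine ((γ₁.mul A2').sub (σ₁.mul A1')).congr (fun θ => (e2 θ 0).symm) fun θ => ?_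
    ring
  -- `N` is what remains after the removal of `G'`
  set N : Θ → Matrix (Fin 3) (Fin 3) ℂ := fun θ => star (G' θ).lead * N₁ θ with hN
  have hNu : ∀ θ, N θ ∈ unitaryGroup (Fin 3) ℂ := fun θ =>
    mul_mem (Unitary.star_mem ((nG' θ).lead_mem (a θ).le)) (hN₁u θ)
  have hNN := MatApprox.of_unitary (a := a) hNu
  have f0 : ∀ θ j, N θ 0 j = star (G' θ).cosine * N₁ θ 0 j + star (G' θ).sine * N₁ θ 1 j :=
    fun θ j => by
    simp [hN, Core.lead, lead, star_eq_conjTranspose, Matrix.mul_apply, Fin.sum_univ_succ]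
  have f1 : ∀ θ j, N θ 1 j = (G' θ).cosine * N₁ θ 1 j - (G' θ).sine * N₁ θ 0 j := fun θ j => by
    simp [hN, Core.lead, lead, star_eq_conjTranspose, Matrix.mul_apply, Fin.sum_univ_succ, pG']
    ring
  have f2 : ∀ θ j, N θ 2 j = N₁ θ 2 j := fun θ j => by
    simp [hN, Core.lead, lead, star_eq_conjTranspose, Matrix.mul_apply, Fin.sum_univ_succ]
  obtain ⟨h₂, h₂0, B1, B2, -⟩ : ∃ h : Θ → ℝ, (∀ θ, 0 ≤ h θ) ∧
      Approx a (fun θ => (G' θ).cosine * (h θ : ℂ)) (fun θ => M θ 0 0) ∧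
      Approx a (fun θ => (G' θ).sine * (h θ : ℂ)) (fun θ => (h₁ θ : ℂ)) ∧ Approx a _ _ :=
    m11.rotation r1 (fun θ => (F θ).idx) (fun _ => 1)
  have B1' := B1.symm
  have B2' := n10.trans B2.symm
  have N00 : Approx a (fun θ => N θ 0 0) (fun θ => (h₂ θ : ℂ)) := by
    refine ((γ₂.conj.mul B1').add (σ₂.conj.mul B2')).congr (fun θ => ?_) fun θ => ?_
    · rw [f0, e0]
    · linear_combination (h₂ θ : ℂ) * uG' θ
  have N10 : Approx a (fun θ => N θ 1 0) (fun _ => 0) := by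
    refine ((γ₂.mul B2').sub (σ₂.mul B1')).congr (fun θ => ?_) fun θ => ?_
    · rw [f1, e0]
    · ring
  have N20 : Approx a (fun θ => N θ 2 0) (fun _ => 0) := n20.congr (fun θ => (f2 θ 0).symm)
    fun _ => rfl
  have h₂one : Approx a (fun θ => (h₂ θ : ℂ)) (fun _ => 1) := by
    refine Approx.one_of_sq h₂0 ?_
    refine Approx.symm ((((N00.conj.mul N00).add (N10.conj.mul N10)).add
      (N20.conj.mul N20)).congr (fun θ => ?_) (fun θ => ?_))
    · have := conjTranspose_mul_self_apply_of_unitary (hNu θ) 0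
      rwa [Fin.sum_univ_three] at this
    · simp
  have NT := approx_trail hNu (N00.trans h₂one) N10 N20
  have t2 : Approx a _ (fun θ => N₁ θ 1 1) := (((Approx.stored_c nF').conj.flMul m22).flAdd
    ((Approx.stored_s nF').conj.flMul m32)).congr_right fun θ => (e1 θ 1).symm
  have t3 : Approx a _ (fun θ => N θ 2 1) := (((Approx.stored_c nF').flMul m32).flSub
    ((Approx.stored_s nF').flMul m22)).congr_right fun θ => by rw [f2, e2]
  have n2 : Approx a _ (fun θ => N θ 1 1) := (((Approx.stored_c nG').flMul t2).flSub
    ((Approx.stored_s nG').flMul m12)).congr_right fun θ => by rw [f1, e0]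
  have hdet : ∀ θ, (N θ).det = (F θ).phase * (G θ).phase * (H θ).phase := fun θ => by
    have d1 : (star (F' θ).trail).det = 1 := by
      rw [star_eq_conjTranspose, det_conjTranspose, (nF' θ).det_trail (a θ).le, pF', star_one]
    have d2 : (star (G' θ).lead).det = 1 := by
      rw [star_eq_conjTranspose, det_conjTranspose, (nG' θ).det_lead (a θ).le, pG', star_one]
    simp only [hN, hN₁, hM, det_mul, d1, d2, one_mul,
      (hF θ).det_lead (a θ).le, (hG θ).det_trail (a θ).le,
      (hH θ).det_lead (a θ).le]
  have q : Approx a _ (fun θ => (N θ).det) := ((pF.flMul pG).flMul pH).congr_right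
    fun θ => (hdet θ).symm
  have N01 := NT 0 1
  have unit : Approx a (fun θ => star (N θ 1 1) * N θ 1 1 + star (N θ 2 1) * N θ 2 1)
      (fun _ => 1) := by
    refine Approx.symm ((((N01.conj.mul N01).add ((hNN 1 1).conj.mul (hNN 1 1))).add
      ((hNN 2 1).conj.mul (hNN 2 1))).congr (fun θ => ?_) (fun θ => ?_))
    · have := conjTranspose_mul_self_apply_of_unitary (hNu θ) 1
      rwa [Fin.sum_univ_three] at this
    · simp [trail]
  obtain ⟨k1, k2, k3⟩ := Approx.mkCore_of_unit (fun θ => (F θ).idx + 1) n2 t3 q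
    (fun θ => (det_of_mem_unitary (hNu θ)).1) unit
  have hH'N : MatApprox a (fun θ => (H' θ).trail) N :=
    (MatApprox.trail_congr k1 k2 k3).trans NT.symm
  have hFG := (MatApprox.of_unitary (a := a) (fun θ => (nF' θ).trail_mem (a θ).le)).mul
    (MatApprox.of_unitary (a := a) (fun θ => (nG' θ).lead_mem (a θ).le))
  have key := hFG.mul hH'N
  intro i j
  refine (key i j).congr_right fun θ => ?_
  have h1 := (mem_unitaryGroup_iff).1 ((nF' θ).trail_mem (a θ).le)
  have h2 := (mem_unitaryGroup_iff).1 ((nG' θ).lead_mem (a θ).le)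
  have : (F' θ).trail * (G' θ).lead * N θ = M θ := by
    calc _ = (F' θ).trail * ((G' θ).lead * star (G' θ).lead) * star (F' θ).trail * M θ := by
          simp only [hN, hN₁, Matrix.mul_assoc]
      _ = _ := by rw [h2, mul_one, h1, one_mul]
  exact congrFun (congrFun this i) j

/-- The counterpart of `turnoverDown_approx` for the QL factorization; here the last column of the
remaining matrix is close to that of the identity. -/
theorem turnoverUp_approx (hF : ∀ θ, (F θ).Normalized (a θ).u)
    (hG : ∀ θ, (G θ).Normalized (a θ).u) (hH : ∀ θ, (H θ).Normalized (a θ).u) :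
    MatApprox a
      (fun θ => (turnoverUp (a θ).fl (F θ) (G θ) (H θ)).1.lead *
        (turnoverUp (a θ).fl (F θ) (G θ) (H θ)).2.1.trail *
        (turnoverUp (a θ).fl (F θ) (G θ) (H θ)).2.2.lead)
      (fun θ => (F θ).trail * (G θ).lead * (H θ).trail) := by
  set M : Θ → Matrix (Fin 3) (Fin 3) ℂ := fun θ => (F θ).trail * (G θ).lead * (H θ).trail with hM
  have hMu : ∀ θ, M θ ∈ unitaryGroup (Fin 3) ℂ := fun θ =>
    mul_mem (mul_mem ((hF θ).trail_mem (a θ).le) ((hG θ).lead_mem (a θ).le))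
      ((hH θ).trail_mem (a θ).le)
  have cF := Approx.stored_c hF
  have sF := Approx.stored_s hF
  have pF := Approx.stored_p hF
  have cG := Approx.stored_c hG
  have sG := Approx.stored_s hG
  have pG := Approx.stored_p hG
  have pH := Approx.stored_p hH
  have x := (Approx.e22 hG).flMul (Approx.e12 hH)
  have m11 := cG.congr_right (g₁ := fun θ => M θ 0 0) fun θ => by
    simp [hM, Core.lead, Core.trail, lead, trail]
  have m21 := (cF.flMul sG).congr_right (g₁ := fun θ => M θ 1 0) fun θ => by
    simp [hM, Core.lead, Core.trail, lead, trail]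
  have m31 := (sF.flMul sG).congr_right (g₁ := fun θ => M θ 2 0) fun θ => by
    simp [hM, Core.lead, Core.trail, lead, trail]
  have m13 := ((Approx.e12 hG).flMul (Approx.e12 hH)).congr_right
    (g₁ := fun θ => M θ 0 2) fun θ => by
    simp [hM, Core.lead, Core.trail, lead, trail]
  have m23 := ((cF.flMul x).flAdd ((Approx.e12 hF).flMul (Approx.e22 hH))).congr_right
    (g₁ := fun θ => M θ 1 2) fun θ => by
    simp [hM, Core.lead, Core.trail, lead, trail]; ring
  have m33 := ((sF.flMul x).flAdd ((Approx.e22 hF).flMul (Approx.e22 hH))).congr_right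
    (g₁ := fun θ => M θ 2 2) fun θ => by
    simp [hM, Core.lead, Core.trail, lead, trail]; ring
  set F' : Θ → Core := fun θ => (turnoverUp (a θ).fl (F θ) (G θ) (H θ)).1 with hF'
  set G' : Θ → Core := fun θ => (turnoverUp (a θ).fl (F θ) (G θ) (H θ)).2.1 with hG'
  set H' : Θ → Core := fun θ => (turnoverUp (a θ).fl (F θ) (G θ) (H θ)).2.2 with hH'
  have nF' : ∀ θ, (F' θ).Normalized (a θ).u := fun θ =>
    mkCore_normalized (a θ).model (a θ).nonneg (a θ).le _ _ _ _
  have nG' : ∀ θ, (G' θ).Normalized (a θ).u := fun θ =>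
    mkCore_normalized (a θ).model (a θ).nonneg (a θ).le _ _ _ _
  have uF' : ∀ θ, star (F' θ).cosine * (F' θ).cosine + star (F' θ).sine * (F' θ).sine = 1 :=
    fun θ => (nF' θ).cosine_sq_add (a θ).le
  have uG' : ∀ θ, star (G' θ).cosine * (G' θ).cosine + star (G' θ).sine * (G' θ).sine = 1 :=
    fun θ => (nG' θ).cosine_sq_add (a θ).le
  have pF' : ∀ θ, (F' θ).phase = 1 := fun θ =>
    mkCore_phase_one (a θ).model (a θ).nonneg (a θ).le _ _ _
  have pG' : ∀ θ, (G' θ).phase = 1 := fun θ =>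
    mkCore_phase_one (a θ).model (a θ).nonneg (a θ).le _ _ _
  have γ₁ := Approx.cosine nF'
  have σ₁ := Approx.sine nF'
  have γ₂ := Approx.cosine nG'
  have σ₂ := Approx.sine nG'
  -- `N₁` is what remains of `M` after the removal of `F'`
  set N₁ : Θ → Matrix (Fin 3) (Fin 3) ℂ := fun θ => star (F' θ).lead * M θ with hN₁
  have hN₁u : ∀ θ, N₁ θ ∈ unitaryGroup (Fin 3) ℂ := fun θ =>
    mul_mem (Unitary.star_mem ((nF' θ).lead_mem (a θ).le)) (hMu θ)
  have e0 : ∀ θ j, N₁ θ 0 j = star (F' θ).cosine * M θ 0 j + star (F' θ).sine * M θ 1 j :=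
    fun θ j => by
    simp [hN₁, Core.lead, lead, star_eq_conjTranspose, Matrix.mul_apply, Fin.sum_univ_succ]
  have e1 : ∀ θ j, N₁ θ 1 j = (F' θ).cosine * M θ 1 j - (F' θ).sine * M θ 0 j := fun θ j => by
    simp [hN₁, Core.lead, lead, star_eq_conjTranspose, Matrix.mul_apply, Fin.sum_univ_succ, pF']
    ring
  have e2 : ∀ θ j, N₁ θ 2 j = M θ 2 j := fun θ j => by
    simp [hN₁, Core.lead, lead, star_eq_conjTranspose, Matrix.mul_apply, Fin.sum_univ_succ]
  have hr : ∀ θ x y, flHypot (a θ).fl x y = flHypot (a θ).fl (star y) (-(star x)) := by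
    intro θ x y
    simp [flHypot, flAbsSq, add_comm]
  obtain ⟨h₁, -, A1, A2, r1⟩ : ∃ h : Θ → ℝ, (∀ θ, 0 ≤ h θ) ∧
      Approx a (fun θ => (F' θ).cosine * (h θ : ℂ)) (fun θ => star (M θ 1 2)) ∧
      Approx a (fun θ => (F' θ).sine * (h θ : ℂ)) (fun θ => -star (M θ 0 2)) ∧ Approx a _ _ :=
    m23.conj.rotation m13.conj.neg (fun θ => (G θ).idx) (fun _ => 1)
  have r1' := r1.congr (fun θ => by rw [← hr]) (fun θ => rfl)
  have A1' : Approx a (fun θ => M θ 1 2) (fun θ => star (F' θ).cosine * (h₁ θ : ℂ)) :=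
    A1.symm.conj.congr (fun θ => by simp) (fun θ => by simp)
  have A2' : Approx a (fun θ => M θ 0 2) (fun θ => -(star (F' θ).sine * (h₁ θ : ℂ))) :=
    A2.symm.conj.neg.congr (fun θ => by simp) (fun θ => by simp)
  have n02 : Approx a (fun θ => N₁ θ 0 2) (fun _ => 0) := by
    refine ((γ₁.conj.mul A2').add (σ₁.conj.mul A1')).congr (fun θ => (e0 θ 2).symm) fun θ => ?_
    ring
  have n12 : Approx a (fun θ => N₁ θ 1 2) (fun θ => (h₁ θ : ℂ)) := by
    refine ((γ₁.mul A1').sub (σ₁.mul A2')).congr (fun θ => (e1 θ 2).symm) fun θ => ?_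
    linear_combination (h₁ θ : ℂ) * uF' θ
  -- `N` is what remains after the removal of `G'`
  set N : Θ → Matrix (Fin 3) (Fin 3) ℂ := fun θ => star (G' θ).trail * N₁ θ with hN
  have hNu : ∀ θ, N θ ∈ unitaryGroup (Fin 3) ℂ := fun θ =>
    mul_mem (Unitary.star_mem ((nG' θ).trail_mem (a θ).le)) (hN₁u θ)
  have hNN := MatApprox.of_unitary (a := a) hNu
  have f0 : ∀ θ j, N θ 0 j = N₁ θ 0 j := fun θ j => by
    simp [hN, Core.trail, trail, star_eq_conjTranspose, Matrix.mul_apply, Fin.sum_univ_succ]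
  have f1 : ∀ θ j, N θ 1 j = star (G' θ).cosine * N₁ θ 1 j + star (G' θ).sine * N₁ θ 2 j :=
    fun θ j => by
    simp [hN, Core.trail, trail, star_eq_conjTranspose, Matrix.mul_apply, Fin.sum_univ_succ]
  have f2 : ∀ θ j, N θ 2 j = (G' θ).cosine * N₁ θ 2 j - (G' θ).sine * N₁ θ 1 j := fun θ j => by
    simp [hN, Core.trail, trail, star_eq_conjTranspose, Matrix.mul_apply, Fin.sum_univ_succ, pG']
    ring
  obtain ⟨h₂, h₂0, B1, B2, -⟩ : ∃ h : Θ → ℝ, (∀ θ, 0 ≤ h θ) ∧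
      Approx a (fun θ => (G' θ).cosine * (h θ : ℂ)) (fun θ => star (M θ 2 2)) ∧
      Approx a (fun θ => (G' θ).sine * (h θ : ℂ)) (fun θ => -(h₁ θ : ℂ)) ∧ Approx a _ _ :=
    m33.conj.rotation r1'.neg (fun θ => (G θ).idx + 1) (fun _ => 1)
  have B1' : Approx a (fun θ => N₁ θ 2 2) (fun θ => star (G' θ).cosine * (h₂ θ : ℂ)) :=
    B1.symm.conj.congr (fun θ => by rw [star_star, e2]) (fun θ => by simp)
  have B2' : Approx a (fun θ => N₁ θ 1 2) (fun θ => -(star (G' θ).sine * (h₂ θ : ℂ))) :=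
    n12.trans (B2.symm.conj.neg.congr (fun θ => by simp) (fun θ => by simp))
  have N12 : Approx a (fun θ => N θ 1 2) (fun _ => 0) := by
    refine ((γ₂.conj.mul B2').add (σ₂.conj.mul B1')).congr (fun θ => (f1 θ 2).symm) fun θ => ?_
    ring
  have N22 : Approx a (fun θ => N θ 2 2) (fun θ => (h₂ θ : ℂ)) := by
    refine ((γ₂.mul B1').sub (σ₂.mul B2')).congr (fun θ => (f2 θ 2).symm) fun θ => ?_
    linear_combination (h₂ θ : ℂ) * uG' θ
  have N02 : Approx a (fun θ => N θ 0 2) (fun _ => 0) := n02.congr (fun θ => (f0 θ 2).symm)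
    fun _ => rfl
  have h₂one : Approx a (fun θ => (h₂ θ : ℂ)) (fun _ => 1) := by
    refine Approx.one_of_sq h₂0 ?_
    refine Approx.symm ((((N02.conj.mul N02).add (N12.conj.mul N12)).add
      (N22.conj.mul N22)).congr (fun θ => ?_) (fun θ => ?_))
    · have := conjTranspose_mul_self_apply_of_unitary (hNu θ) 2
      rwa [Fin.sum_univ_three] at this
    · simp
  have NT := approx_lead hNu (N22.trans h₂one) N12 N02
  have t1 : Approx a _ (fun θ => N θ 0 0) := (((Approx.stored_c nF').conj.flMul m11).flAdd
    ((Approx.stored_s nF').conj.flMul m21)).congr_right fun θ => by rw [f0, e0]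
  have t2 : Approx a _ (fun θ => N₁ θ 1 0) := (((Approx.stored_c nF').flMul m21).flSub
    ((Approx.stored_s nF').flMul m11)).congr_right fun θ => (e1 θ 0).symm
  have n2 : Approx a _ (fun θ => N θ 1 0) := (((Approx.stored_c nG').conj.flMul t2).flAdd
    ((Approx.stored_s nG').conj.flMul m31)).congr_right fun θ => by rw [f1, e2]
  have hdet : ∀ θ, (N θ).det = (F θ).phase * (G θ).phase * (H θ).phase := fun θ => by
    have d1 : (star (F' θ).lead).det = 1 := by
      rw [star_eq_conjTranspose, det_conjTranspose, (nF' θ).det_lead (a θ).le, pF', star_one]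
    have d2 : (star (G' θ).trail).det = 1 := by
      rw [star_eq_conjTranspose, det_conjTranspose, (nG' θ).det_trail (a θ).le, pG', star_one]
    simp only [hN, hN₁, hM, det_mul, d1, d2, one_mul,
      (hF θ).det_trail (a θ).le, (hG θ).det_lead (a θ).le,
      (hH θ).det_trail (a θ).le]
  have q : Approx a _ (fun θ => (N θ).det) := ((pF.flMul pG).flMul pH).congr_right
    fun θ => (hdet θ).symm
  have N20 := NT 2 0
  have unit : Approx a (fun θ => star (N θ 0 0) * N θ 0 0 + star (N θ 1 0) * N θ 1 0)
      (fun _ => 1) := by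
    refine Approx.symm (((((hNN 0 0).conj.mul (hNN 0 0)).add ((hNN 1 0).conj.mul (hNN 1 0))).add
      (N20.conj.mul N20)).congr (fun θ => ?_) (fun θ => ?_))
    · have := conjTranspose_mul_self_apply_of_unitary (hNu θ) 0
      rwa [Fin.sum_univ_three] at this
    · simp [lead]
  obtain ⟨k1, k2, k3⟩ := Approx.mkCore_of_unit (fun θ => (G θ).idx) t1 n2 q
    (fun θ => (det_of_mem_unitary (hNu θ)).1) unit
  have hH'N : MatApprox a (fun θ => (H' θ).lead) N := (MatApprox.lead_congr k1 k2 k3).trans NT.symm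
  have hFG := (MatApprox.of_unitary (a := a) (fun θ => (nF' θ).lead_mem (a θ).le)).mul
    (MatApprox.of_unitary (a := a) (fun θ => (nG' θ).trail_mem (a θ).le))
  have key := hFG.mul hH'N
  intro i j
  refine (key i j).congr_right fun θ => ?_
  have h1 := (mem_unitaryGroup_iff).1 ((nF' θ).lead_mem (a θ).le)
  have h2 := (mem_unitaryGroup_iff).1 ((nG' θ).trail_mem (a θ).le)
  have : (F' θ).lead * (G' θ).trail * N θ = M θ := by
    calc _ = (F' θ).lead * ((G' θ).trail * star (G' θ).trail) * star (F' θ).lead * M θ := by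
          simp only [hN, hN₁, Matrix.mul_assoc]
      _ = _ := by rw [h2, mul_one, h1, one_mul]
  exact congrFun (congrFun this i) j

theorem MatApprox.active_congr {c s t c' s' t' : Θ → ℂ}
    (hc : Approx a c c') (hs : Approx a s s') (ht : Approx a t t') :
    MatApprox a (fun θ => active (c θ) (s θ) (t θ)) (fun θ => active (c' θ) (s' θ) (t' θ)) := by
  intro i j
  fin_cases i <;> fin_cases j
  exacts [hc, (hs.conj.mul ht).neg, hs, hc.conj.mul ht]

theorem fusion_approx (hF : ∀ θ, (F θ).Normalized (a θ).u)
    (hG : ∀ θ, (G θ).Normalized (a θ).u) :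
    MatApprox a (fun θ => (fusion (a θ).fl (F θ) (G θ)).active)
      (fun θ => (F θ).active * (G θ).active) := by
  set M : Θ → Matrix (Fin 2) (Fin 2) ℂ := fun θ => (F θ).active * (G θ).active with hM
  have hMu : ∀ θ, M θ ∈ unitaryGroup (Fin 2) ℂ := fun θ =>
    mul_mem ((hF θ).active_mem (a θ).le) ((hG θ).active_mem (a θ).le)
  have x : Approx a _ (fun θ => M θ 0 0) := (((Approx.stored_c hF).flMul (Approx.stored_c hG)).flAdd
    ((Approx.e12 hF).flMul (Approx.stored_s hG))).congr_right fun θ => by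
      simp [hM, Core.active, active]
  have y : Approx a _ (fun θ => M θ 1 0) := (((Approx.stored_s hF).flMul (Approx.stored_c hG)).flAdd
    ((Approx.e22 hF).flMul (Approx.stored_s hG))).congr_right fun θ => by
      simp [hM, Core.active, active]
  have hd : ∀ θ, star ((F θ).phase * (G θ).phase) * ((F θ).phase * (G θ).phase) = 1 := fun θ => by
    rw [star_mul', mul_mul_mul_comm, (hF θ).phase_mul (a θ).le, (hG θ).phase_mul (a θ).le, one_mul]
  obtain ⟨k1, k2, k3⟩ := Approx.mkCore_of_unit (fun θ => (F θ).idx) x y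
    ((Approx.stored_p hF).flMul (Approx.stored_p hG)) hd
    ((Approx.const 1).congr (fun _ => rfl) (fun _ => rfl) |>.congr (fun θ => by
      have := conjTranspose_mul_self_apply_of_unitary (hMu θ) 0
      rw [Fin.sum_univ_two] at this
      exact this.symm) (fun _ => rfl))
  intro i j
  refine (MatApprox.active_congr k1 k2 k3 i j).congr_right fun θ => ?_
  have hp := (hF θ).phase_mul (a θ).le
  simp only [Complex.star_def] at hp
  fin_cases i <;> fin_cases j <;> simp [hM, Core.active, active] <;> grind

theorem deflate_approx (hF : ∀ θ, (F θ).Normalized (a θ).u) (hs : ∀ θ, ‖(F θ).s‖ ≤ (a θ).u) :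
    MatApprox a (fun θ => (mkCore (a θ).fl (F θ).idx (F θ).c 0 (F θ).p).active)
      (fun θ => (F θ).active) := by
  have y : Approx a (fun _ => 0) (fun θ => (F θ).sine) :=
    Approx.trans ⟨1, fun θ => by
      have h1 := (a θ).le
      have h2 := hs θ
      rw [zero_sub, norm_neg, one_mul]
      exact ⟨h2, by linarith⟩⟩ (Approx.stored_s hF)
  obtain ⟨k1, k2, k3⟩ := Approx.mkCore_of_unit (fun θ => (F θ).idx) (Approx.stored_c hF) y
    (Approx.stored_p hF) (fun θ => (hF θ).phase_mul (a θ).le)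
    ((Approx.const 1).congr (fun θ => ((hF θ).cosine_sq_add (a θ).le).symm) (fun _ => rfl))
  exact MatApprox.active_congr k1 k2 k3

end

/-! ### The Frobenius norm -/

section Frobenius

variable {ι κ : Type} [Fintype ι] [Fintype κ]

theorem norm_sq_eq_sum (A : Matrix ι κ ℂ) : ‖A‖ ^ 2 = ∑ i, ∑ j, ‖A i j‖ ^ 2 := by
  rw [frobenius_norm_def, ← Real.sqrt_eq_rpow, Real.sq_sqrt (by positivity)]
  simp

theorem norm_apply_le (A : Matrix ι κ ℂ) (i : ι) (j : κ) : ‖A i j‖ ≤ ‖A‖ := by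
  refine le_of_sq_le_sq ?_ (norm_nonneg A)
  rw [norm_sq_eq_sum]
  calc ‖A i j‖ ^ 2 ≤ ∑ j, ‖A i j‖ ^ 2 :=
        Finset.single_le_sum (f := fun j => ‖A i j‖ ^ 2) (fun _ _ => by positivity)
          (Finset.mem_univ j)
    _ ≤ _ := Finset.single_le_sum (f := fun i => ∑ j, ‖A i j‖ ^ 2) (fun _ _ => by positivity)
          (Finset.mem_univ i)

theorem norm_le_sum_norm_apply (A : Matrix ι κ ℂ) : ‖A‖ ≤ ∑ i, ∑ j, ‖A i j‖ := by
  refine le_of_sq_le_sq ?_ (by positivity)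
  rw [norm_sq_eq_sum]
  calc ∑ i, ∑ j, ‖A i j‖ ^ 2 ≤ ∑ i, (∑ j, ‖A i j‖) ^ 2 :=
        Finset.sum_le_sum fun i _ => Finset.sum_sq_le_sq_sum_of_nonneg fun _ _ => norm_nonneg _
    _ ≤ _ := Finset.sum_sq_le_sq_sum_of_nonneg fun _ _ => by positivity

theorem norm_le_of_apply_le (A : Matrix ι κ ℂ) {r : ℝ} (h : ∀ i j, ‖A i j‖ ≤ r) :
    ‖A‖ ≤ Fintype.card ι * Fintype.card κ * r := by
  calc ‖A‖ ≤ ∑ i, ∑ j, ‖A i j‖ := norm_le_sum_norm_apply A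
    _ ≤ ∑ _i : ι, ∑ _j : κ, r := Finset.sum_le_sum fun i _ => Finset.sum_le_sum fun j _ => h i j
    _ = _ := by simp [mul_assoc]

theorem norm_unitary_le [DecidableEq ι] {U : Matrix ι ι ℂ} (hU : U ∈ unitaryGroup ι ℂ) :
    ‖U‖ ≤ (Fintype.card ι : ℝ) ^ 2 := by
  have := norm_le_of_apply_le U (entry_norm_bound_of_unitary hU)
  rwa [mul_one, ← sq] at this

theorem norm_mul_mul_le {ι' κ' : Type} [Fintype ι'] [Fintype κ'] (A : Matrix ι κ ℂ)
    (B : Matrix κ ι' ℂ) (C : Matrix ι' κ' ℂ) : ‖A * B * C‖ ≤ ‖A‖ * ‖B‖ * ‖C‖ :=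
  (frobenius_norm_mul _ _).trans
    (mul_le_mul_of_nonneg_right (frobenius_norm_mul _ _) (norm_nonneg _))

theorem MatApprox.exists_norm_le {Θ : Type} {a : Θ → Arith} {A B : Θ → Matrix ι κ ℂ}
    (h : MatApprox a A B) : ∃ C : ℝ, 0 ≤ C ∧ ∀ θ, ‖A θ - B θ‖ ≤ C * (a θ).u := by
  choose C hC0 hC using fun i j => (h i j).exists_nonneg
  refine ⟨∑ i, ∑ j, C i j, Finset.sum_nonneg fun i _ => Finset.sum_nonneg fun j _ => hC0 i j,
    fun θ => (norm_le_sum_norm_apply _).trans ?_⟩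
  simp only [Finset.sum_mul]
  exact Finset.sum_le_sum fun i _ => Finset.sum_le_sum fun j _ => (hC i j θ).1

end Frobenius

/-! ### Core transformations as matrices of larger size -/

/-- The columns `e p` of the identity matrix. -/
def inclusion {q m : ℕ} (e : Fin q → Fin m) : Matrix (Fin m) (Fin q) ℂ :=
  (1 : Matrix (Fin m) (Fin m) ℂ).submatrix id e

/-- The matrix that acts as `A` on the coordinates `e p` and as the identity on the others. -/
def extend {q m : ℕ} (e : Fin q → Fin m) (A : Matrix (Fin q) (Fin q) ℂ) :
    Matrix (Fin m) (Fin m) ℂ :=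
  1 + inclusion e * (A - 1) * (inclusion e)ᴴ

section Extend

variable {q m : ℕ} {e : Fin q → Fin m}

theorem inclusion_conjTranspose_mul (he : Function.Injective e) :
    (inclusion e)ᴴ * inclusion e = 1 := by
  ext i j
  simp [inclusion, Matrix.mul_apply, Matrix.one_apply, he.eq_iff]

theorem extend_mul (he : Function.Injective e) (A B : Matrix (Fin q) (Fin q) ℂ) :
    extend e A * extend e B = extend e (A * B) := by
  have h := inclusion_conjTranspose_mul he
  have h2 : inclusion e * (A - 1) * (inclusion e)ᴴ * (inclusion e * (B - 1) * (inclusion e)ᴴ)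
      = inclusion e * ((A - 1) * (B - 1)) * (inclusion e)ᴴ := by
    calc _ = inclusion e * (A - 1) * ((inclusion e)ᴴ * inclusion e) * (B - 1) * (inclusion e)ᴴ := by
          simp only [Matrix.mul_assoc]
      _ = _ := by rw [h, Matrix.mul_one]; simp only [Matrix.mul_assoc]
  rw [extend, extend, add_mul, mul_add, mul_add, one_mul, mul_one, h2, extend]
  have h3 : A * B - 1 = (A - 1) + (B - 1) + (A - 1) * (B - 1) := by noncomm_ring
  rw [h3, Matrix.mul_add, Matrix.mul_add, Matrix.add_mul, Matrix.add_mul]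
  simp only [one_mul]
  abel

theorem extend_one : extend e 1 = 1 := by simp [extend]

theorem extend_conjTranspose (A : Matrix (Fin q) (Fin q) ℂ) :
    (extend e A)ᴴ = extend e Aᴴ := by
  simp [extend, Matrix.conjTranspose_mul, Matrix.mul_assoc]

theorem extend_mem_unitaryGroup (he : Function.Injective e) {A : Matrix (Fin q) (Fin q) ℂ}
    (hA : A ∈ unitaryGroup (Fin q) ℂ) : extend e A ∈ unitaryGroup (Fin m) ℂ := by
  rw [mem_unitaryGroup_iff, star_eq_conjTranspose, extend_conjTranspose, extend_mul he,
    ← star_eq_conjTranspose, (mem_unitaryGroup_iff).1 hA, extend_one]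

theorem norm_inclusion_sq : ‖inclusion e‖ ^ 2 = q := by
  rw [norm_sq_eq_sum, Finset.sum_comm]
  have : ∀ j, ∑ i, ‖inclusion e i j‖ ^ 2 = 1 := fun j => by
    rw [Finset.sum_eq_single (e j)]
    · simp [inclusion, Matrix.one_apply]
    · intro b _ hb
      simp [inclusion, hb]
    · simp
  simp [this]

theorem norm_extend_sub_le (A B : Matrix (Fin q) (Fin q) ℂ) :
    ‖extend e A - extend e B‖ ≤ q * ‖A - B‖ := by
  have : extend e A - extend e B = inclusion e * (A - B) * (inclusion e)ᴴ := by
    rw [extend, extend, add_sub_add_left_eq_sub, ← Matrix.sub_mul, ← Matrix.mul_sub]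
    congr 2
    abel
  rw [this]
  refine (norm_mul_mul_le _ _ _).trans_eq ?_
  rw [frobenius_norm_conjTranspose, ← norm_inclusion_sq (e := e)]
  ring

end Extend

/-- The represented matrix in terms of the exactly normalized data. -/
theorem Core.toMatrix_apply (m : ℕ) (g : Core) (x y : Fin m) :
    g.toMatrix m x y =
      if x.val = g.idx ∧ y.val = g.idx then g.cosine
      else if x.val = g.idx ∧ y.val = g.idx + 1 then -(star g.sine * g.phase)
      else if x.val = g.idx + 1 ∧ y.val = g.idx then g.sine
      else if x.val = g.idx + 1 ∧ y.val = g.idx + 1 then star g.cosine * g.phase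
      else if x = y then 1 else 0 := by
  simp only [Core.toMatrix, Core.cosine, Core.sine, Core.phase, hypot, Matrix.of_apply,
    star_div₀, Complex.star_def, Complex.conj_ofReal]

theorem extend_apply {q m : ℕ} (e : Fin q → Fin m) (A : Matrix (Fin q) (Fin q) ℂ) (x y : Fin m) :
    extend e A x y = (if x = y then 1 else 0) +
      ∑ j, (∑ i, (if x = e i then (A - 1) i j else 0)) * (if y = e j then 1 else 0) := by
  simp [extend, inclusion, Matrix.mul_apply, Matrix.one_apply]
  simp only [eq_comm]

/-- The `q` consecutive coordinates from `i` on. -/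
def consecutive (q : ℕ) {m i : ℕ} (h : i + q ≤ m) (p : Fin q) : Fin m := ⟨i + p, by omega⟩

theorem consecutive_injective {q m i : ℕ} (h : i + q ≤ m) :
    Function.Injective (consecutive q h) := fun p p' hp => by
  simpa [consecutive, Fin.ext_iff] using hp

theorem Core.toMatrix_eq_extend_active {m : ℕ} {g : Core} (h : g.idx + 2 ≤ m) :
    g.toMatrix m = extend (consecutive 2 h) g.active := by
  ext ⟨x, hx⟩ ⟨y, hy⟩
  rw [Core.toMatrix_apply, extend_apply]
  simp only [Fin.sum_univ_two, consecutive, Core.active, CoreChasing.active, Fin.mk.injEq]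
  by_cases h1 : x = g.idx <;> by_cases h2 : x = g.idx + 1 <;> by_cases h3 : y = g.idx <;>
    by_cases h4 : y = g.idx + 1 <;> by_cases h5 : x = y <;>
    first
      | omega
      | simp [h1, h2, h3, h4, h5]

theorem Core.toMatrix_eq_extend_lead {m : ℕ} {g : Core} (h : g.idx + 3 ≤ m) :
    g.toMatrix m = extend (consecutive 3 h) g.lead := by
  ext ⟨x, hx⟩ ⟨y, hy⟩
  rw [Core.toMatrix_apply, extend_apply]
  simp only [Fin.sum_univ_three, consecutive, Core.lead, CoreChasing.lead, Fin.mk.injEq]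
  by_cases h1 : x = g.idx <;> by_cases h2 : x = g.idx + 1 <;> by_cases h3 : y = g.idx <;>
    by_cases h4 : y = g.idx + 1 <;> by_cases h5 : x = y <;>
    first
      | omega
      | simp [h1, h2, h3, h4, h5]

theorem Core.toMatrix_eq_extend_trail {m i : ℕ} {g : Core} (h : i + 3 ≤ m) (hi : g.idx = i + 1) :
    g.toMatrix m = extend (consecutive 3 h) g.trail := by
  ext ⟨x, hx⟩ ⟨y, hy⟩
  rw [Core.toMatrix_apply, extend_apply]
  simp only [Fin.sum_univ_three, consecutive, Core.trail, CoreChasing.trail, Fin.mk.injEq, hi]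
  by_cases h1 : x = i + 1 <;> by_cases h2 : x = i + 2 <;> by_cases h3 : y = i + 1 <;>
    by_cases h4 : y = i + 2 <;> by_cases h5 : x = y <;>
    first
      | omega
      | simp [h1, h2, h3, h4, h5]

/-! ### One operation on a sequence of core transformations -/

/-- A sequence of stored core transformations of size `m`, all normalized up to rounding. -/
def GoodWord (u : ℝ) (m : ℕ) (w : List Core) : Prop :=
  ∀ g ∈ w, g.Normalized u ∧ g.idx + 1 < m

theorem Core.Normalized.toMatrix_mem {u : ℝ} {m : ℕ} {g : Core} (hg : g.Normalized u)
    (hu1 : u ≤ 1 / 1000) (h : g.idx + 1 < m) : g.toMatrix m ∈ unitaryGroup (Fin m) ℂ := by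
  rw [Core.toMatrix_eq_extend_active (show g.idx + 2 ≤ m by omega)]
  exact extend_mem_unitaryGroup (consecutive_injective _) (hg.active_mem hu1)

theorem word_append (m : ℕ) (w w' : List Core) : word m (w ++ w') = word m w * word m w' := by
  simp [word]

theorem word_cons (m : ℕ) (g : Core) (w : List Core) :
    word m (g :: w) = g.toMatrix m * word m w := by
  simp [word]

theorem word_nil (m : ℕ) : word m [] = 1 := by
  simp [word]

theorem GoodWord.append {u : ℝ} {m : ℕ} {w w' : List Core} (h : GoodWord u m w)
    (h' : GoodWord u m w') : GoodWord u m (w ++ w') := fun g hg =>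
  (List.mem_append.1 hg).elim (h g) (h' g)

theorem GoodWord.mono {u : ℝ} {m m' : ℕ} {w : List Core} (h : GoodWord u m w) (hm : m ≤ m') :
    GoodWord u m' w := fun g hg => ⟨(h g hg).1, (h g hg).2.trans_le hm⟩

theorem GoodWord.word_mem {u : ℝ} {m : ℕ} {w : List Core} (h : GoodWord u m w)
    (hu1 : u ≤ 1 / 1000) : word m w ∈ unitaryGroup (Fin m) ℂ := by
  induction w with
  | nil => rw [word_nil]; exact one_mem _
  | cons g w ih =>
    rw [word_cons]
    have hg := h g (by simp)
    exact mul_mem (hg.1.toMatrix_mem hu1 hg.2) (ih fun g' hg' => h g' (by simp [hg']))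

theorem norm_word_sub_le {u : ℝ} {m : ℕ} {l r : List Core} (hl : GoodWord u m l)
    (hr : GoodWord u m r) (hu1 : u ≤ 1 / 1000) (v w : List Core) :
    ‖word m (l ++ w ++ r) - word m (l ++ v ++ r)‖ ≤ (m : ℝ) ^ 4 * ‖word m w - word m v‖ := by
  have : word m (l ++ w ++ r) - word m (l ++ v ++ r)
      = word m l * (word m w - word m v) * word m r := by
    simp only [word_append, Matrix.mul_sub, Matrix.sub_mul]
  rw [this]
  refine (norm_mul_mul_le _ _ _).trans ?_
  have h1 := norm_unitary_le (hl.word_mem hu1)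
  have h2 := norm_unitary_le (hr.word_mem hu1)
  rw [Fintype.card_fin] at h1 h2
  calc _ ≤ (m : ℝ) ^ 2 * ‖word m w - word m v‖ * (m : ℝ) ^ 2 := by gcongr
    _ = _ := by ring

theorem exists_turnoverDown_norm_le : ∃ C : ℝ, 0 ≤ C ∧ ∀ (a : Arith) (F G H : Core),
    F.Normalized a.u → G.Normalized a.u → H.Normalized a.u →
    ‖(turnoverDown a.fl F G H).1.trail * (turnoverDown a.fl F G H).2.1.lead *
      (turnoverDown a.fl F G H).2.2.trail - F.lead * G.trail * H.lead‖ ≤ C * a.u := by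
  obtain ⟨C, hC, h⟩ := (turnoverDown_approx
    (Θ := {θ : Arith × Core × Core × Core // θ.2.1.Normalized θ.1.u ∧ θ.2.2.1.Normalized θ.1.u ∧
      θ.2.2.2.Normalized θ.1.u}) (a := fun θ => θ.1.1) (F := fun θ => θ.1.2.1)
    (G := fun θ => θ.1.2.2.1) (H := fun θ => θ.1.2.2.2) (fun θ => θ.2.1) (fun θ => θ.2.2.1)
    (fun θ => θ.2.2.2)).exists_norm_le
  exact ⟨C, hC, fun a F G H hF hG hH => h ⟨(a, F, G, H), hF, hG, hH⟩⟩

theorem exists_turnoverUp_norm_le : ∃ C : ℝ, 0 ≤ C ∧ ∀ (a : Arith) (F G H : Core),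
    F.Normalized a.u → G.Normalized a.u → H.Normalized a.u →
    ‖(turnoverUp a.fl F G H).1.lead * (turnoverUp a.fl F G H).2.1.trail *
      (turnoverUp a.fl F G H).2.2.lead - F.trail * G.lead * H.trail‖ ≤ C * a.u := by
  obtain ⟨C, hC, h⟩ := (turnoverUp_approx
    (Θ := {θ : Arith × Core × Core × Core // θ.2.1.Normalized θ.1.u ∧ θ.2.2.1.Normalized θ.1.u ∧
      θ.2.2.2.Normalized θ.1.u}) (a := fun θ => θ.1.1) (F := fun θ => θ.1.2.1)
    (G := fun θ => θ.1.2.2.1) (H := fun θ => θ.1.2.2.2) (fun θ => θ.2.1) (fun θ => θ.2.2.1)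
    (fun θ => θ.2.2.2)).exists_norm_le
  exact ⟨C, hC, fun a F G H hF hG hH => h ⟨(a, F, G, H), hF, hG, hH⟩⟩

theorem exists_fusion_norm_le : ∃ C : ℝ, 0 ≤ C ∧ ∀ (a : Arith) (F G : Core),
    F.Normalized a.u → G.Normalized a.u →
    ‖(fusion a.fl F G).active - F.active * G.active‖ ≤ C * a.u := by
  obtain ⟨C, hC, h⟩ := (fusion_approx
    (Θ := {θ : Arith × Core × Core // θ.2.1.Normalized θ.1.u ∧ θ.2.2.Normalized θ.1.u})
    (a := fun θ => θ.1.1) (F := fun θ => θ.1.2.1)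
    (G := fun θ => θ.1.2.2) (fun θ => θ.2.1) (fun θ => θ.2.2)).exists_norm_le
  exact ⟨C, hC, fun a F G hF hG => h ⟨(a, F, G), hF, hG⟩⟩

theorem exists_deflate_norm_le : ∃ C : ℝ, 0 ≤ C ∧ ∀ (a : Arith) (F : Core),
    F.Normalized a.u → ‖F.s‖ ≤ a.u →
    ‖(mkCore a.fl F.idx F.c 0 F.p).active - F.active‖ ≤ C * a.u := by
  obtain ⟨C, hC, h⟩ := (deflate_approx
    (Θ := {θ : Arith × Core // θ.2.Normalized θ.1.u ∧ ‖θ.2.s‖ ≤ θ.1.u})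
    (a := fun θ => θ.1.1) (F := fun θ => θ.1.2) (fun θ => θ.2.1) (fun θ => θ.2.2)).exists_norm_le
  exact ⟨C, hC, fun a F hF hs => h ⟨(a, F), hF, hs⟩⟩

/-- Core transformations acting on disjoint sets of rows commute. -/
theorem Core.toMatrix_comm {m : ℕ} {F G : Core} (hF : F.idx + 1 < m) (hG : G.idx + 1 < m)
    (h : F.idx + 1 < G.idx ∨ G.idx + 1 < F.idx) :
    F.toMatrix m * G.toMatrix m = G.toMatrix m * F.toMatrix m := by
  have hF' : F.idx + 2 ≤ m := hF
  have hG' : G.idx + 2 ≤ m := hG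
  have h0 : ∀ {F G : Core} (hF' : F.idx + 2 ≤ m) (hG' : G.idx + 2 ≤ m),
      (F.idx + 1 < G.idx ∨ G.idx + 1 < F.idx) →
      (inclusion (consecutive 2 hF'))ᴴ * inclusion (consecutive 2 hG') = 0 := by
    intro F G hF' hG' h
    ext p p'
    have : consecutive 2 hF' p ≠ consecutive 2 hG' p' := by
      simp only [consecutive, ne_eq, Fin.mk.injEq]
      omega
    simp [inclusion, Matrix.mul_apply, Matrix.one_apply, this]
  rw [Core.toMatrix_eq_extend_active hF', Core.toMatrix_eq_extend_active hG', extend, extend]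
  have e : ∀ {F G : Core} (hF' : F.idx + 2 ≤ m) (hG' : G.idx + 2 ≤ m),
      (F.idx + 1 < G.idx ∨ G.idx + 1 < F.idx) → ∀ A B : Matrix (Fin 2) (Fin 2) ℂ,
      inclusion (consecutive 2 hF') * A * (inclusion (consecutive 2 hF'))ᴴ *
        (inclusion (consecutive 2 hG') * B * (inclusion (consecutive 2 hG'))ᴴ) = 0 := by
    intro F G hF' hG' h A B
    calc _ = inclusion (consecutive 2 hF') * A *
          ((inclusion (consecutive 2 hF'))ᴴ * inclusion (consecutive 2 hG')) * B *
            (inclusion (consecutive 2 hG'))ᴴ := by simp only [Matrix.mul_assoc]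
      _ = 0 := by rw [h0 hF' hG' h]; simp
  rw [add_mul, mul_add, mul_add, e hF' hG' h, add_mul, mul_add, mul_add, e hG' hF' h.symm]
  simp only [one_mul, mul_one]
  abel

/-- Every operation on a sequence of core transformations changes the represented unitary
matrix by a multiple of the unit round-off only, with a universal constant. -/
theorem exists_wordStep_norm_le : ∃ C : ℝ, 0 ≤ C ∧ ∀ (a : Arith) (m : ℕ) (w w' : List Core),
    WordStep a.fl a.u w w' → GoodWord a.u m w →
      GoodWord a.u m w' ∧ ‖word m w' - word m w‖ ≤ C * (m : ℝ) ^ 4 * a.u := by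
  obtain ⟨C₁, hC₁, h₁⟩ := exists_turnoverDown_norm_le
  obtain ⟨C₂, hC₂, h₂⟩ := exists_turnoverUp_norm_le
  obtain ⟨C₃, hC₃, h₃⟩ := exists_fusion_norm_le
  obtain ⟨C₄, hC₄, h₄⟩ := exists_deflate_norm_le
  -- the factor `3` is the size of the blocks, see `norm_extend_sub_le`
  refine ⟨3 * (C₁ + C₂ + C₃ + C₄), by positivity, ?_⟩
  intro a m w w' hs hw
  have hu := a.nonneg
  have mk : ∀ i x y q, (mkCore a.fl i x y q).Normalized a.u := fun i x y q =>
    mkCore_normalized a.model a.nonneg a.le i x y q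
  -- reduction to the part of the sequence that is changed
  have red : ∀ (l r v v' : List Core) (C : ℝ), GoodWord a.u m (l ++ v ++ r) →
      C ≤ 3 * (C₁ + C₂ + C₃ + C₄) → GoodWord a.u m v' → ‖word m v' - word m v‖ ≤ C * a.u →
      GoodWord a.u m (l ++ v' ++ r) ∧
        ‖word m (l ++ v' ++ r) - word m (l ++ v ++ r)‖
          ≤ 3 * (C₁ + C₂ + C₃ + C₄) * (m : ℝ) ^ 4 * a.u := by
    intro l r v v' C h hC hv' hn
    have hl : GoodWord a.u m l := fun g hg => h g (by simp [hg])
    have hr : GoodWord a.u m r := fun g hg => h g (by simp [hg])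
    refine ⟨(hl.append hv').append hr, (norm_word_sub_le hl hr a.le v v').trans ?_⟩
    calc (m : ℝ) ^ 4 * ‖word m v' - word m v‖ ≤ (m : ℝ) ^ 4 * (C * a.u) := by gcongr
      _ ≤ (m : ℝ) ^ 4 * (3 * (C₁ + C₂ + C₃ + C₄) * a.u) := by gcongr
      _ = _ := by ring
  cases hs with
  | down l r F G H hG hH =>
    have e : ∀ a b c : Core, l ++ a :: b :: c :: r = l ++ [a, b, c] ++ r := by simp
    rw [e] at hw ⊢
    rw [e]
    have gF := hw F (by simp)
    have gG := hw G (by simp)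
    have gH := hw H (by simp)
    refine red l r _ _ (3 * C₁) hw (by linarith) ?_ ?_
    · have hi : F.idx + 1 + 1 < m := hG ▸ gG.2
      intro g hg
      simp only [List.mem_cons, List.not_mem_nil, or_false] at hg
      rcases hg with rfl | rfl | rfl
      exacts [⟨mk _ _ _ _, hi⟩, ⟨mk _ _ _ _, gF.2⟩, ⟨mk _ _ _ _, hi⟩]
    · have h3 : F.idx + 3 ≤ m := by have := gG.2; omega
      simp only [word_cons, word_nil, mul_one]
      rw [Core.toMatrix_eq_extend_lead h3, Core.toMatrix_eq_extend_trail h3 hG,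
        Core.toMatrix_eq_extend_trail (i := F.idx) h3 rfl,
        Core.toMatrix_eq_extend_trail (g := (turnoverDown a.fl F G H).2.2) (i := F.idx) h3 rfl]
      have hH3 : H.idx + 3 ≤ m := by omega
      have eH : H.toMatrix m = extend (consecutive 3 h3) H.lead := by
        rw [Core.toMatrix_eq_extend_lead hH3]
        congr 2
      have eG : (turnoverDown a.fl F G H).2.1.toMatrix m
          = extend (consecutive 3 h3) (turnoverDown a.fl F G H).2.1.lead :=
        Core.toMatrix_eq_extend_lead (g := (turnoverDown a.fl F G H).2.1) h3
      have hi := consecutive_injective h3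
      rw [eH, eG, extend_mul hi, extend_mul hi, extend_mul hi, extend_mul hi, ← Matrix.mul_assoc,
        ← Matrix.mul_assoc]
      refine (norm_extend_sub_le _ _).trans ?_
      have := h₁ a F G H gF.1 gG.1 gH.1
      push_cast
      linarith
  | up l r F G H hF hH =>
    have e : ∀ a b c : Core, l ++ a :: b :: c :: r = l ++ [a, b, c] ++ r := by simp
    rw [e] at hw ⊢
    rw [e]
    have gF := hw F (by simp)
    have gG := hw G (by simp)
    have gH := hw H (by simp)
    refine red l r _ _ (3 * C₂) hw (by linarith) ?_ ?_
    · have hi : G.idx + 1 + 1 < m := hF ▸ gF.2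
      intro g hg
      simp only [List.mem_cons, List.not_mem_nil, or_false] at hg
      rcases hg with rfl | rfl | rfl
      exacts [⟨mk _ _ _ _, gG.2⟩, ⟨mk _ _ _ _, hi⟩, ⟨mk _ _ _ _, gG.2⟩]
    · have h3 : G.idx + 3 ≤ m := by have := gF.2; omega
      simp only [word_cons, word_nil, mul_one]
      have e1 : (turnoverUp a.fl F G H).1.toMatrix m
          = extend (consecutive 3 h3) (turnoverUp a.fl F G H).1.lead :=
        Core.toMatrix_eq_extend_lead (g := (turnoverUp a.fl F G H).1) h3
      have e2 : (turnoverUp a.fl F G H).2.1.toMatrix m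
          = extend (consecutive 3 h3) (turnoverUp a.fl F G H).2.1.trail :=
        Core.toMatrix_eq_extend_trail (g := (turnoverUp a.fl F G H).2.1) h3 rfl
      have e3 : (turnoverUp a.fl F G H).2.2.toMatrix m
          = extend (consecutive 3 h3) (turnoverUp a.fl F G H).2.2.lead :=
        Core.toMatrix_eq_extend_lead (g := (turnoverUp a.fl F G H).2.2) h3
      have hi := consecutive_injective h3
      rw [e1, e2, e3, Core.toMatrix_eq_extend_lead h3, Core.toMatrix_eq_extend_trail h3 hF,
        Core.toMatrix_eq_extend_trail h3 hH, extend_mul hi, extend_mul hi, extend_mul hi,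
        extend_mul hi, ← Matrix.mul_assoc, ← Matrix.mul_assoc]
      refine (norm_extend_sub_le _ _).trans ?_
      have := h₂ a F G H gF.1 gG.1 gH.1
      push_cast
      linarith
  | fuse l r F G h =>
    have e : ∀ a b : Core, l ++ a :: b :: r = l ++ [a, b] ++ r := by simp
    have e' : ∀ a : Core, l ++ a :: r = l ++ [a] ++ r := by simp
    rw [e] at hw ⊢
    rw [e']
    have gF := hw F (by simp)
    have gG := hw G (by simp)
    refine red l r _ _ (2 * C₃) hw (by linarith) ?_ ?_
    · intro g hg
      simp only [List.mem_cons, List.not_mem_nil, or_false] at hg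
      subst hg
      exact ⟨mk _ _ _ _, gF.2⟩
    · have h2 : F.idx + 2 ≤ m := gF.2
      have hG2 : G.idx + 2 ≤ m := gG.2
      simp only [word_cons, word_nil, mul_one]
      have eG : G.toMatrix m = extend (consecutive 2 h2) G.active := by
        rw [Core.toMatrix_eq_extend_active hG2]
        congr 2
      have e1 : (fusion a.fl F G).toMatrix m
          = extend (consecutive 2 h2) (fusion a.fl F G).active :=
        Core.toMatrix_eq_extend_active (g := fusion a.fl F G) h2
      rw [eG, e1, Core.toMatrix_eq_extend_active h2, extend_mul (consecutive_injective h2)]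
      refine (norm_extend_sub_le _ _).trans ?_
      have := h₃ a F G gF.1 gG.1
      push_cast
      linarith
  | swap l r F G h =>
    have e : ∀ a b : Core, l ++ a :: b :: r = l ++ [a, b] ++ r := by simp
    rw [e] at hw ⊢
    rw [e]
    have gF := hw F (by simp)
    have gG := hw G (by simp)
    refine red l r _ _ 0 hw (by positivity) ?_ ?_
    · intro g hg
      simp only [List.mem_cons, List.not_mem_nil, or_false] at hg
      rcases hg with rfl | rfl
      exacts [gG, gF]
    · simp only [word_cons, word_nil, mul_one]
      rw [Core.toMatrix_comm gF.2 gG.2 h, sub_self, norm_zero, zero_mul]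
  | deflate l r F h =>
    have e : ∀ a : Core, l ++ a :: r = l ++ [a] ++ r := by simp
    rw [e] at hw ⊢
    rw [e]
    have gF := hw F (by simp)
    refine red l r _ _ (2 * C₄) hw (by linarith) ?_ ?_
    · intro g hg
      simp only [List.mem_cons, List.not_mem_nil, or_false] at hg
      subst hg
      exact ⟨mk _ _ _ _, gF.2⟩
    · have h2 : F.idx + 2 ≤ m := gF.2
      simp only [word_cons, word_nil, mul_one]
      have e1 : (mkCore a.fl F.idx F.c 0 F.p).toMatrix m
          = extend (consecutive 2 h2) (mkCore a.fl F.idx F.c 0 F.p).active :=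
        Core.toMatrix_eq_extend_active (g := mkCore a.fl F.idx F.c 0 F.p) h2
      rw [e1, Core.toMatrix_eq_extend_active h2]
      refine (norm_extend_sub_le _ _).trans ?_
      have := h₄ a F gF.1 h
      push_cast
      linarith

theorem WordStep.append {fl : ℝ → ℝ} {u : ℝ} {w w' : List Core} (h : WordStep fl u w w')
    (p s : List Core) : WordStep fl u (p ++ w ++ s) (p ++ w' ++ s) := by
  cases h with
  | down l r F G H hG hH =>
    simpa using WordStep.down (fl := fl) (u := u) (p ++ l) (r ++ s) F G H hG hH
  | up l r F G H hF hH =>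
    simpa using WordStep.up (fl := fl) (u := u) (p ++ l) (r ++ s) F G H hF hH
  | fuse l r F G h => simpa using WordStep.fuse (fl := fl) (u := u) (p ++ l) (r ++ s) F G h
  | swap l r F G h => simpa using WordStep.swap (fl := fl) (u := u) (p ++ l) (r ++ s) F G h
  | deflate l r F h => simpa using WordStep.deflate (fl := fl) (p ++ l) (r ++ s) F h

/-! ### The reconstructed factors -/

/-- The matrix `diag(Z, 1)`. -/
def border {n : ℕ} (Z : Matrix (Fin n) (Fin n) ℂ) : Matrix (Fin (n + 1)) (Fin (n + 1)) ℂ :=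
  Matrix.of fun i j => Fin.lastCases (Fin.lastCases 1 (fun _ => 0) j)
    (fun i' => Fin.lastCases 0 (fun j' => Z i' j') j) i

section Border

variable {n : ℕ}

@[simp] theorem border_castSucc_castSucc (Z : Matrix (Fin n) (Fin n) ℂ) (i j : Fin n) :
    border Z i.castSucc j.castSucc = Z i j := by simp [border]

@[simp] theorem border_castSucc_last (Z : Matrix (Fin n) (Fin n) ℂ) (i : Fin n) :
    border Z i.castSucc (Fin.last n) = 0 := by simp [border]

@[simp] theorem border_last_castSucc (Z : Matrix (Fin n) (Fin n) ℂ) (j : Fin n) :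
    border Z (Fin.last n) j.castSucc = 0 := by simp [border]

@[simp] theorem border_last_last (Z : Matrix (Fin n) (Fin n) ℂ) :
    border Z (Fin.last n) (Fin.last n) = 1 := by simp [border]

theorem border_mul (Y Z : Matrix (Fin n) (Fin n) ℂ) : border (Y * Z) = border Y * border Z := by
  ext i j
  refine Fin.lastCases ?_ (fun i => ?_) i <;> refine Fin.lastCases ?_ (fun j => ?_) j <;>
    simp [Matrix.mul_apply, Fin.sum_univ_castSucc]

theorem border_one : border (1 : Matrix (Fin n) (Fin n) ℂ) = 1 := by
  ext i j
  refine Fin.lastCases ?_ (fun i => ?_) i <;> refine Fin.lastCases ?_ (fun j => ?_) j <;>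
    simp [Matrix.one_apply, Fin.ext_iff] <;> omega

theorem border_conjTranspose (Z : Matrix (Fin n) (Fin n) ℂ) : border Zᴴ = (border Z)ᴴ := by
  ext i j
  refine Fin.lastCases ?_ (fun i => ?_) i <;> refine Fin.lastCases ?_ (fun j => ?_) j <;> simp

theorem border_mem_unitaryGroup {Z : Matrix (Fin n) (Fin n) ℂ} (hZ : Z ∈ unitaryGroup (Fin n) ℂ) :
    border Z ∈ unitaryGroup (Fin (n + 1)) ℂ := by
  rw [mem_unitaryGroup_iff, star_eq_conjTranspose, ← border_conjTranspose, ← border_mul,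
    ← star_eq_conjTranspose, (mem_unitaryGroup_iff).1 hZ, border_one]

theorem Core.toMatrix_succ {g : Core} (h : g.idx + 1 < n) :
    g.toMatrix (n + 1) = border (g.toMatrix n) := by
  ext i j
  refine Fin.lastCases ?_ (fun i => ?_) i <;> refine Fin.lastCases ?_ (fun j => ?_) j
  · simp only [border_last_last, Core.toMatrix_apply, Fin.val_last]
    rw [if_neg (by omega), if_neg (by omega), if_neg (by omega), if_neg (by omega), if_pos trivial]
  · have := j.isLt
    simp only [border_last_castSucc, Core.toMatrix_apply, Fin.val_last, Fin.ext_iff,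
      Fin.val_castSucc]
    rw [if_neg (by omega), if_neg (by omega), if_neg (by omega), if_neg (by omega),
      if_neg (by omega)]
  · have := i.isLt
    simp only [border_castSucc_last, Core.toMatrix_apply, Fin.val_last, Fin.ext_iff,
      Fin.val_castSucc]
    rw [if_neg (by omega), if_neg (by omega), if_neg (by omega), if_neg (by omega),
      if_neg (by omega)]
  · simp [Core.toMatrix_apply]

theorem word_succ {u : ℝ} {w : List Core} (h : GoodWord u n w) :
    word (n + 1) w = border (word n w) := by
  induction w with
  | nil => simp [word_nil, border_one]
  | cons g w ih =>
    rw [word_cons, word_cons, border_mul, Core.toMatrix_succ (h g (by simp)).2,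
      ih fun g' hg' => h g' (by simp [hg'])]

end Border

/-- The first column of the identity matrix. -/
def firstColumn (n : ℕ) : Matrix (Fin (n + 1)) (Fin 1) ℂ :=
  Matrix.of fun i _ => if i = 0 then 1 else 0

theorem mul_firstColumn_apply {n : ℕ} (A : Matrix (Fin (n + 1)) (Fin (n + 1)) ℂ) (i : Fin (n + 1))
    (j : Fin 1) : (A * firstColumn n) i j = A i 0 := by
  simp [firstColumn, Matrix.mul_apply]

theorem norm_firstColumn (n : ℕ) : ‖firstColumn n‖ = 1 := by
  have : ‖firstColumn n‖ ^ 2 = 1 := by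
    rw [norm_sq_eq_sum, Finset.sum_comm]
    simp only [Finset.univ_unique, Finset.sum_singleton]
    rw [Finset.sum_eq_single 0]
    · simp [firstColumn]
    · intro b _ hb
      simp [firstColumn, hb]
    · simp
  nlinarith [norm_nonneg (firstColumn n)]

/-- The leading `n × n` part of `Π W`, where `Π` is the oblique projection along `x` onto the
vectors with vanishing last entry. The reconstructed factor `R` is of this form with `x = C* e₁`
and `W = C* B`, which are perturbed by rounding in a controlled way, unlike `R` itself. -/
def obliqueFactor {n : ℕ} (x : Matrix (Fin (n + 1)) (Fin 1) ℂ)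
    (W : Matrix (Fin (n + 1)) (Fin (n + 1)) ℂ) : Matrix (Fin n) (Fin n) ℂ :=
  Matrix.of fun i j => W i.castSucc j.castSucc
    - x i.castSucc 0 * (x (Fin.last n) 0)⁻¹ * W (Fin.last n) j.castSucc

theorem unitaryPlusRankOne_eq {n : ℕ} (Cs B : Matrix (Fin (n + 1)) (Fin (n + 1)) ℂ) :
    unitaryPlusRankOne Cs B = obliqueFactor (Cs * firstColumn n) (Cs * B) := by
  ext i j
  simp only [unitaryPlusRankOne, obliqueFactor, Matrix.submatrix_apply, Matrix.of_apply,
    mul_firstColumn_apply, Matrix.mul_add, Matrix.add_apply]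
  have : (Cs * (vecMulVec (Pi.single 0 1) (implicitRow Cs B) :
      Matrix (Fin (n + 1)) (Fin (n + 1)) ℂ)) i.castSucc j.castSucc
      = Cs i.castSucc 0 * implicitRow Cs B j.castSucc := by
    rw [Matrix.mul_apply, Finset.sum_eq_single 0]
    · simp [vecMulVec_apply]
    · intro b _ hb
      simp [vecMulVec_apply, hb]
    · simp
  rw [this, implicitRow]
  ring

theorem obliqueFactor_border_mul {n : ℕ} (Z : Matrix (Fin n) (Fin n) ℂ)
    (x : Matrix (Fin (n + 1)) (Fin 1) ℂ) (W : Matrix (Fin (n + 1)) (Fin (n + 1)) ℂ) :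
    obliqueFactor (border Z * x) (border Z * W) = Z * obliqueFactor x W := by
  ext i j
  simp [obliqueFactor, Matrix.mul_apply, Fin.sum_univ_castSucc, mul_sub, Finset.sum_mul, mul_assoc]

theorem obliqueFactor_mul_border {n : ℕ} (Z : Matrix (Fin n) (Fin n) ℂ)
    (x : Matrix (Fin (n + 1)) (Fin 1) ℂ) (W : Matrix (Fin (n + 1)) (Fin (n + 1)) ℂ) :
    obliqueFactor x (W * border Z) = obliqueFactor x W * Z := by
  ext i j
  simp [obliqueFactor, Matrix.mul_apply, Fin.sum_univ_castSucc, sub_mul, Finset.mul_sum, mul_assoc]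

/-- The vector `diag(Q_j, 1) C_j* e₁`. -/
def State.column {n k : ℕ} (st : State n k) (j : Fin k) : Matrix (Fin (n + 1)) (Fin 1) ℂ :=
  word (n + 1) (st.Q j ++ st.Cs j) * firstColumn n

/-- The unitary matrix `diag(Q_j, 1) C_j* B_j`. -/
def State.unitaryPart {n k : ℕ} (st : State n k) (j : Fin k) :
    Matrix (Fin (n + 1)) (Fin (n + 1)) ℂ :=
  word (n + 1) (st.Q j ++ st.Cs j ++ st.B j)

/-- All stored core transformations are normalized up to rounding and act on admissible rows. -/
def State.Good {n k : ℕ} (u : ℝ) (st : State n k) : Prop :=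
  ∀ j, GoodWord u n (st.Q j) ∧ GoodWord u (n + 1) (st.Cs j) ∧ GoodWord u (n + 1) (st.B j)

theorem State.Good.word_mul_R {n k : ℕ} {u : ℝ} {st : State n k} (h : st.Good u) (j : Fin k) :
    word n (st.Q j) * st.R j = obliqueFactor (st.column j) (st.unitaryPart j) := by
  rw [State.R, unitaryPlusRankOne_eq, ← obliqueFactor_border_mul, ← word_succ (h j).1,
    State.column, State.unitaryPart]
  simp only [word_append, Matrix.mul_assoc]

theorem State.Good.rho_eq {n k : ℕ} {u : ℝ} {st : State n k} (h : st.Good u) (j : Fin k) :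
    st.rho j = st.column j (Fin.last n) 0 := by
  rw [State.rho, State.column, mul_firstColumn_apply, word_append, word_succ (h j).1]
  simp [Matrix.mul_apply, Fin.sum_univ_castSucc]

/-! ### The factors in the original coordinates -/

/-- The vectors `x j` and the unitary matrices `W j` are, up to errors of norm at most `ε`, the
vectors `x₀ j` and the matrices `W₀ j` after unitary changes of coordinates `Z j` between the
factors; the outer ones of these changes of coordinates are `U` and `V`. -/
def Represents {n k : ℕ} (x₀ x : Fin k → Matrix (Fin (n + 1)) (Fin 1) ℂ)
    (W₀ W : Fin k → Matrix (Fin (n + 1)) (Fin (n + 1)) ℂ) (U V : Matrix (Fin n) (Fin n) ℂ)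
    (ε : ℝ) : Prop :=
  ∃ Z : ℕ → Matrix (Fin n) (Fin n) ℂ, (∀ i, Z i ∈ unitaryGroup (Fin n) ℂ) ∧ Z 0 = U ∧ Z k = V ∧
    ∀ j : Fin k, ‖(border (Z j))ᴴ * x j - x₀ j‖ ≤ ε ∧
      ‖(border (Z j))ᴴ * W j * border (Z (j + 1)) - W₀ j‖ ≤ ε

namespace Represents

variable {n k : ℕ} {x₀ x x' : Fin k → Matrix (Fin (n + 1)) (Fin 1) ℂ}
  {W₀ W W' : Fin k → Matrix (Fin (n + 1)) (Fin (n + 1)) ℂ} {U V : Matrix (Fin n) (Fin n) ℂ} {ε : ℝ}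

theorem mono {ε' : ℝ} (h : Represents x₀ x W₀ W U V ε) (hε : ε ≤ ε') :
    Represents x₀ x W₀ W U V ε' := by
  obtain ⟨Z, h1, h2, h3, h4⟩ := h
  exact ⟨Z, h1, h2, h3, fun j => ⟨(h4 j).1.trans hε, (h4 j).2.trans hε⟩⟩

/-- A change of coordinates at position `p`, that is, in front of the factor with number `p`. -/
theorem gauge (h : Represents x₀ x W₀ W U V ε) (p : ℕ) {G : Matrix (Fin n) (Fin n) ℂ}
    (hG : G ∈ unitaryGroup (Fin n) ℂ)
    (hx : ∀ j, x' j = (if j.val = p then border G else 1) * x j)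
    (hW : ∀ j, W' j = (if j.val = p then border G else 1) * W j *
      (if j.val + 1 = p then (border G)ᴴ else 1)) :
    Represents x₀ x' W₀ W' (if p = 0 then G * U else U) (if p = k then G * V else V) ε := by
  obtain ⟨Z, h1, h2, h3, h4⟩ := h
  have hGG : (border G)ᴴ * border G = 1 := (mem_unitaryGroup_iff').1 (border_mem_unitaryGroup hG)
  have cancel : ∀ {m : ℕ} (A : Matrix (Fin (n + 1)) (Fin m) ℂ),
      (border G)ᴴ * (border G * A) = A := fun A => by rw [← Matrix.mul_assoc, hGG, Matrix.one_mul]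
  refine ⟨Function.update Z p (G * Z p), fun i => ?_, ?_, ?_, fun j => ?_⟩
  · by_cases hi : i = p
    · subst hi; rw [Function.update_self]; exact mul_mem hG (h1 _)
    · rw [Function.update_of_ne hi]; exact h1 i
  · by_cases hp : p = 0
    · subst hp; simp [h2]
    · rw [Function.update_of_ne (Ne.symm hp), if_neg hp, h2]
  · by_cases hp : p = k
    · subst hp; simp [h3]
    · rw [Function.update_of_ne (Ne.symm hp), if_neg hp, h3]
  · rw [hx, hW]
    by_cases hj : j.val = p
    · have hj1 : j.val + 1 ≠ p := by omega
      rw [Function.update_of_ne hj1, if_pos hj, if_neg hj1, ← hj, Function.update_self, border_mul,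
        conjTranspose_mul, Matrix.mul_one]
      have e := h4 j
      simp only [Matrix.mul_assoc, cancel] at e ⊢
      exact e
    · rw [Function.update_of_ne hj, if_neg hj, Matrix.one_mul, Matrix.one_mul]
      by_cases hj1 : j.val + 1 = p
      · rw [if_pos hj1, ← hj1, Function.update_self, border_mul]
        have e := h4 j
        simp only [Matrix.mul_assoc, cancel] at e ⊢
        exact e
      · rw [if_neg hj1, Function.update_of_ne hj1, Matrix.mul_one]
        exact h4 j

theorem perturb (h : Represents x₀ x W₀ W U V ε) {η : ℝ}
    (hx : ∀ j, ‖x' j - x j‖ ≤ η) (hW : ∀ j, ‖W' j - W j‖ ≤ η) :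
    Represents x₀ x' W₀ W' U V (ε + ((n : ℝ) + 1) ^ 4 * η) := by
  obtain ⟨Z, h1, h2, h3, h4⟩ := h
  refine ⟨Z, h1, h2, h3, fun j => ?_⟩
  have b : ∀ i, ‖border (Z i)‖ ≤ ((n : ℝ) + 1) ^ 2 := fun i => by
    have := norm_unitary_le (border_mem_unitaryGroup (h1 i))
    simpa using this
  have hη : 0 ≤ η := (norm_nonneg _).trans (hx j)
  have hn : (1 : ℝ) ≤ ((n : ℝ) + 1) ^ 2 := one_le_pow₀ (by linarith [n.cast_nonneg (α := ℝ)])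
  constructor
  · have e : (border (Z j))ᴴ * x' j - x₀ j
        = ((border (Z j))ᴴ * x j - x₀ j) + (border (Z j))ᴴ * (x' j - x j) := by
      rw [Matrix.mul_sub]; abel
    rw [e]
    refine (norm_add_le _ _).trans (add_le_add (h4 j).1 ((frobenius_norm_mul _ _).trans ?_))
    rw [frobenius_norm_conjTranspose]
    calc _ ≤ ((n : ℝ) + 1) ^ 2 * η := mul_le_mul (b _) (hx j) (norm_nonneg _) (by positivity)
      _ ≤ ((n : ℝ) + 1) ^ 2 * η * ((n : ℝ) + 1) ^ 2 := le_mul_of_one_le_right (by positivity) hn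
      _ = _ := by ring
  · have e : (border (Z j))ᴴ * W' j * border (Z (j + 1)) - W₀ j
        = ((border (Z j))ᴴ * W j * border (Z (j + 1)) - W₀ j)
          + (border (Z j))ᴴ * (W' j - W j) * border (Z (j + 1)) := by
      rw [Matrix.mul_sub, Matrix.sub_mul]; abel
    rw [e]
    refine (norm_add_le _ _).trans (add_le_add (h4 j).2 ((norm_mul_mul_le _ _ _).trans ?_))
    rw [frobenius_norm_conjTranspose]
    calc _ ≤ ((n : ℝ) + 1) ^ 2 * η * ((n : ℝ) + 1) ^ 2 := by
          gcongr
          · exact b _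
          · exact hW j
          · exact b _
      _ = _ := by ring

end Represents

/-- The representation of the stored data in the original coordinates. -/
def State.Represents {n k : ℕ} (st : State n k) (x₀ : Fin k → Matrix (Fin (n + 1)) (Fin 1) ℂ)
    (W₀ : Fin k → Matrix (Fin (n + 1)) (Fin (n + 1)) ℂ) (ε : ℝ) : Prop :=
  CoreChasing.Represents x₀ st.column W₀ st.unitaryPart st.U st.V ε

theorem GoodWord.of_update {n k : ℕ} {u : ℝ} {f : Fin k → List Core} (h : ∀ j, GoodWord u n (f j))
    {j₀ : Fin k} {w : List Core} (hw : GoodWord u n w) (j : Fin k) :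
    GoodWord u n (Function.update f j₀ w j) := by
  by_cases hj : j = j₀
  · subst hj; rwa [Function.update_self]
  · rw [Function.update_of_ne hj]; exact h j

/-- A core transformation that does not act on the first row fixes the first unit vector. -/
theorem toMatrix_mul_firstColumn {n : ℕ} {G : Core} (h : 0 < G.idx) :
    G.toMatrix (n + 1) * firstColumn n = firstColumn n := by
  ext i j
  rw [mul_firstColumn_apply, Core.toMatrix_apply]
  have e : ∀ t, 0 < t → ((0 : Fin (n + 1)) : ℕ) ≠ t := fun t ht => by simpa using ht.ne
  rw [if_neg fun q => e _ h q.2, if_neg fun q => e _ (Nat.succ_pos _) q.2,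
    if_neg fun q => e _ h q.2, if_neg fun q => e _ (Nat.succ_pos _) q.2]
  rfl

/-- Every operation of the algorithm is, in the original coordinates, a perturbation of the vectors
and unitary matrices by a multiple of the unit round-off. -/
theorem exists_step_represents : ∃ C : ℝ, 0 ≤ C ∧ ∀ (a : Arith) {n k : ℕ} (st st' : State n k),
    Step a.fl a.u st st' → st.Good a.u →
      st'.Good a.u ∧ ∀ x₀ W₀ ε, st.Represents x₀ W₀ ε →
        st'.Represents x₀ W₀ (ε + C * ((n : ℝ) + 1) ^ 8 * a.u) := by
  obtain ⟨C, hC, hword⟩ := exists_wordStep_norm_le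
  refine ⟨C, hC, ?_⟩
  intro a n k st st' hs hg
  have hu := a.nonneg
  have hmono : ∀ ε : ℝ, ε ≤ ε + C * ((n : ℝ) + 1) ^ 8 * a.u := fun ε => by
    have : 0 ≤ C * ((n : ℝ) + 1) ^ 8 * a.u := by positivity
    linarith
  have gQ : ∀ j, GoodWord a.u n (st.Q j) := fun j => (hg j).1
  have gCs : ∀ j, GoodWord a.u (n + 1) (st.Cs j) := fun j => (hg j).2.1
  have gB : ∀ j, GoodWord a.u (n + 1) (st.B j) := fun j => (hg j).2.2
  have gQ' : ∀ j, GoodWord a.u (n + 1) (st.Q j) := fun j => (gQ j).mono n.le_succ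
  -- a perturbation of one of the sequences
  have pert : ∀ st' : State n k, st'.U = st.U → st'.V = st.V →
      (∀ j, ‖word (n + 1) (st'.Q j ++ st'.Cs j) - word (n + 1) (st.Q j ++ st.Cs j)‖
        ≤ C * ((n : ℝ) + 1) ^ 4 * a.u) →
      (∀ j, ‖st'.unitaryPart j - st.unitaryPart j‖ ≤ C * ((n : ℝ) + 1) ^ 4 * a.u) →
      ∀ x₀ W₀ ε, st.Represents x₀ W₀ ε →
        st'.Represents x₀ W₀ (ε + C * ((n : ℝ) + 1) ^ 8 * a.u) := by
    intro st' hU hV h1 h2 x₀ W₀ ε h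
    have h1' : ∀ j, ‖st'.column j - st.column j‖ ≤ C * ((n : ℝ) + 1) ^ 4 * a.u := fun j => by
      rw [State.column, State.column, ← Matrix.sub_mul]
      refine (frobenius_norm_mul _ _).trans ?_
      rw [norm_firstColumn, mul_one]
      exact h1 j
    have := CoreChasing.Represents.perturb h h1' h2
    rw [State.Represents, hU, hV]
    refine this.mono (le_of_eq ?_)
    ring
  have hword' := hword a (n + 1)
  push_cast at hword'
  have hz : 0 ≤ C * ((n : ℝ) + 1) ^ 4 * a.u := by positivity
  -- operations that leave the vectors and the unitary matrices unchanged
  have same : ∀ st' : State n k, st'.U = st.U → st'.V = st.V →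
      (∀ j, st'.column j = st.column j) → (∀ j, st'.unitaryPart j = st.unitaryPart j) →
      ∀ x₀ W₀ ε, st.Represents x₀ W₀ ε →
        st'.Represents x₀ W₀ (ε + C * ((n : ℝ) + 1) ^ 8 * a.u) := by
    intro st' hU hV h1 h2 x₀ W₀ ε h
    rw [State.Represents, hU, hV, funext h1, funext h2]
    exact CoreChasing.Represents.mono h (hmono ε)
  -- operations that change the coordinates at position `p`
  have gau : ∀ (st' : State n k) (p : ℕ) (G : Matrix (Fin n) (Fin n) ℂ),
      G ∈ unitaryGroup (Fin n) ℂ →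
      st'.U = (if p = 0 then G * st.U else st.U) → st'.V = (if p = k then G * st.V else st.V) →
      (∀ j, st'.column j = (if j.val = p then border G else 1) * st.column j) →
      (∀ j, st'.unitaryPart j = (if j.val = p then border G else 1) * st.unitaryPart j *
        (if j.val + 1 = p then (border G)ᴴ else 1)) →
      ∀ x₀ W₀ ε, st.Represents x₀ W₀ ε →
        st'.Represents x₀ W₀ (ε + C * ((n : ℝ) + 1) ^ 8 * a.u) := by
    intro st' p G hG hU hV h1 h2 x₀ W₀ ε h
    rw [State.Represents, hU, hV]
    exact (CoreChasing.Represents.gauge h p hG h1 h2).mono (hmono ε)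
  have mem : ∀ {G : Core}, G.Normalized a.u → G.idx + 1 < n →
      G.toMatrix n ∈ unitaryGroup (Fin n) ℂ := fun hG hi => hG.toMatrix_mem a.le hi
  have inv1 : ∀ {G : Core}, G.Normalized a.u → G.idx + 1 < n →
      G.toMatrix (n + 1) * (G.toMatrix (n + 1))ᴴ = 1 := fun hG hi =>
    (mem_unitaryGroup_iff).1 (hG.toMatrix_mem a.le (by omega))
  have inv2 : ∀ {G : Core}, G.Normalized a.u → G.idx + 1 < n →
      (G.toMatrix (n + 1))ᴴ * G.toMatrix (n + 1) = 1 := fun hG hi =>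
    (mem_unitaryGroup_iff').1 (hG.toMatrix_mem a.le (by omega))
  have mk : ∀ i x y q, (mkCore a.fl i x y q).Normalized a.u := fun i x y q =>
    mkCore_normalized a.model a.nonneg a.le i x y q
  have tail : ∀ {m : ℕ} {G : Core} {w : List Core}, GoodWord a.u m (G :: w) → GoodWord a.u m w :=
    fun h g hg => h g (by simp [hg])
  have cons : ∀ {m : ℕ} {G : Core} {w : List Core}, G.Normalized a.u → G.idx + 1 < m →
      GoodWord a.u m w → GoodWord a.u m (G :: w) := fun hG hi h g hg => by
    rcases List.mem_cons.1 hg with rfl | hg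
    exacts [⟨hG, hi⟩, h g hg]
  have init : ∀ {m : ℕ} {G : Core} {w : List Core}, GoodWord a.u m (w ++ [G]) →
      GoodWord a.u m w := fun h g hg => h g (by simp [hg])
  have snoc : ∀ {m : ℕ} {G : Core} {w : List Core}, G.Normalized a.u → G.idx + 1 < m →
      GoodWord a.u m w → GoodWord a.u m (w ++ [G]) := fun hG hi h =>
    h.append (cons hG hi fun g hg => by simp at hg)
  have snil : ∀ {m : ℕ} {G : Core}, word m [G] = G.toMatrix m := by
    intro m G; simp [word]
  cases hs with
  | onQ j w h =>
    have hw := (hword a n _ _ h (gQ j)).1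
    refine ⟨fun i => ⟨GoodWord.of_update gQ hw i, gCs i, gB i⟩, pert _ rfl rfl ?_ ?_⟩
    · intro i
      by_cases hi : i = j
      · subst hi
        have := (hword' _ _ (h.append [] (st.Cs i)) ((gQ' i).append (gCs i))).2
        simpa using this
      · simpa [Function.update_of_ne hi] using hz
    · intro i
      by_cases hi : i = j
      · subst hi
        have := (hword' _ _ (h.append [] (st.Cs i ++ st.B i))
          ((gQ' i).append ((gCs i).append (gB i)))).2
        simpa [State.unitaryPart] using this
      · simpa [State.unitaryPart, Function.update_of_ne hi] using hz
  | onCs j w h =>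
    have hw := (hword' _ _ h (gCs j)).1
    refine ⟨fun i => ⟨gQ i, GoodWord.of_update gCs hw i, gB i⟩, pert _ rfl rfl ?_ ?_⟩
    · intro i
      by_cases hi : i = j
      · subst hi
        have := (hword' _ _ (h.append (st.Q i) []) (by simpa using (gQ' i).append (gCs i))).2
        simpa using this
      · simpa [Function.update_of_ne hi] using hz
    · intro i
      by_cases hi : i = j
      · subst hi
        have := (hword' _ _ (h.append (st.Q i) (st.B i))
          (((gQ' i).append (gCs i)).append (gB i))).2
        simpa [State.unitaryPart] using this
      · simpa [State.unitaryPart, Function.update_of_ne hi] using hz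
  | onB j w h =>
    have hw := (hword' _ _ h (gB j)).1
    refine ⟨fun i => ⟨gQ i, gCs i, GoodWord.of_update gB hw i⟩, pert _ rfl rfl ?_ ?_⟩
    · intro i
      simpa using hz
    · intro i
      by_cases hi : i = j
      · subst hi
        have := (hword' _ _ (h.append (st.Q i ++ st.Cs i) [])
          (by simpa using ((gQ' i).append (gCs i)).append (gB i))).2
        simpa [State.unitaryPart] using this
      · simpa [State.unitaryPart, Function.update_of_ne hi] using hz
  | QtoCs j w G h =>
    have hQ := gQ j
    rw [h] at hQ
    have hG := hQ G (by simp)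
    refine ⟨fun i => ⟨GoodWord.of_update gQ (init hQ) i,
      GoodWord.of_update gCs (cons hG.1 (by omega) (gCs j)) i, gB i⟩, same _ rfl rfl ?_ ?_⟩ <;>
    · intro i
      by_cases hi : i = j
      · subst hi; simp [State.column, State.unitaryPart, h]
      · simp [State.column, State.unitaryPart, Function.update_of_ne hi]
  | CstoQ j w G h hi =>
    have hC := gCs j
    rw [h] at hC
    have hG := hC G (by simp)
    refine ⟨fun i => ⟨GoodWord.of_update gQ (snoc hG.1 hi (gQ j)) i,
      GoodWord.of_update gCs (tail hC) i, gB i⟩, same _ rfl rfl ?_ ?_⟩ <;>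
    · intro i
      by_cases hi : i = j
      · subst hi; simp [State.column, State.unitaryPart, h]
      · simp [State.column, State.unitaryPart, Function.update_of_ne hi]
  | CstoB j w G h hi =>
    have hC := gCs j
    rw [h] at hC
    have hG := hC G (by simp)
    refine ⟨fun i => ⟨gQ i, GoodWord.of_update gCs (init hC) i,
      GoodWord.of_update gB (cons hG.1 hG.2 (gB j)) i⟩, same _ rfl rfl ?_ ?_⟩
    · intro i
      by_cases hij : i = j
      · subst hij
        simp only [State.column, Function.update_self, h]
        rw [← List.append_assoc, word_append _ _ [G], snil, Matrix.mul_assoc,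
          toMatrix_mul_firstColumn hi]
      · simp [State.column, Function.update_of_ne hij]
    · intro i
      by_cases hij : i = j
      · subst hij; simp [State.unitaryPart, h]
      · simp [State.unitaryPart, Function.update_of_ne hij]
  | BtoCs j w G h hi =>
    have hB := gB j
    rw [h] at hB
    have hG := hB G (by simp)
    refine ⟨fun i => ⟨gQ i, GoodWord.of_update gCs (snoc hG.1 hG.2 (gCs j)) i,
      GoodWord.of_update gB (tail hB) i⟩, same _ rfl rfl ?_ ?_⟩
    · intro i
      by_cases hij : i = j
      · subst hij
        simp only [State.column, Function.update_self]
        rw [← List.append_assoc, word_append _ _ [G], snil, Matrix.mul_assoc,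
          toMatrix_mul_firstColumn hi]
      · simp [State.column, Function.update_of_ne hij]
    · intro i
      by_cases hij : i = j
      · subst hij; simp [State.unitaryPart, h]
      · simp [State.unitaryPart, Function.update_of_ne hij]
  | BtoQ j j' hj w G h hi =>
    have hB := gB j
    rw [h] at hB
    have hG := hB G (by simp)
    have hjj : j ≠ j' := fun e => by rw [e] at hj; omega
    refine ⟨fun i => ⟨GoodWord.of_update gQ (cons hG.1 hi (gQ j')) i, gCs i,
      GoodWord.of_update gB (init hB) i⟩, gau _ j'.val _ (mem hG.1 hi) ?_ ?_ ?_ ?_⟩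
    · rw [if_neg (by omega)]
    · rw [if_neg (by omega)]
    · intro i
      rw [← Core.toMatrix_succ hi]
      by_cases hij : i = j'
      · subst hij
        simp [State.column, word_cons, Matrix.mul_assoc]
      · have : i.val ≠ j'.val := fun e => hij (Fin.ext e)
        simp [State.column, Function.update_of_ne hij, this]
    · intro i
      rw [← Core.toMatrix_succ hi]
      by_cases hij : i = j'
      · subst hij
        simp [State.unitaryPart, word_cons, Function.update_of_ne hjj.symm]
      · have h1 : i.val ≠ j'.val := fun e => hij (Fin.ext e)
        by_cases hij' : i = j
        · subst hij'
          rw [if_neg h1, if_pos hj.symm, Matrix.one_mul]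
          simp only [State.unitaryPart, Function.update_of_ne hij, Function.update_self, h]
          rw [← List.append_assoc, word_append _ _ [G], snil, Matrix.mul_assoc, inv1 hG.1 hi,
            Matrix.mul_one]
        · have h2 : i.val + 1 ≠ j'.val := fun e => hij' (Fin.ext (by omega))
          simp [State.unitaryPart, Function.update_of_ne hij, Function.update_of_ne hij', h1, h2]
  | QtoB j j' hj w G h =>
    have hQ := gQ j'
    rw [h] at hQ
    have hG := hQ G (by simp)
    have hi := hG.2
    have hjj : j ≠ j' := fun e => by rw [e] at hj; omega
    refine ⟨fun i => ⟨GoodWord.of_update gQ (tail hQ) i, gCs i,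
      GoodWord.of_update gB (snoc hG.1 (by omega) (gB j)) i⟩,
      gau _ j'.val _ (Unitary.star_mem (mem hG.1 hi)) ?_ ?_ ?_ ?_⟩
    · rw [if_neg (by omega)]
    · rw [if_neg (by omega)]
    · intro i
      rw [star_eq_conjTranspose, border_conjTranspose, ← Core.toMatrix_succ hi]
      by_cases hij : i = j'
      · subst hij
        simp only [State.column, Function.update_self, if_true, h, List.cons_append, word_cons,
          ← Matrix.mul_assoc]
        rw [inv2 hG.1 hi, Matrix.one_mul]
      · have : i.val ≠ j'.val := fun e => hij (Fin.ext e)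
        simp [State.column, Function.update_of_ne hij, this]
    · intro i
      rw [star_eq_conjTranspose, border_conjTranspose, ← Core.toMatrix_succ hi,
        conjTranspose_conjTranspose]
      by_cases hij : i = j'
      · subst hij
        rw [if_pos rfl, if_neg (by omega), Matrix.mul_one]
        simp only [State.unitaryPart, Function.update_self, Function.update_of_ne hjj.symm, h,
          List.cons_append, word_cons, ← Matrix.mul_assoc]
        rw [inv2 hG.1 hi, Matrix.one_mul]
      · have h1 : i.val ≠ j'.val := fun e => hij (Fin.ext e)
        by_cases hij' : i = j
        · subst hij'
          rw [if_neg h1, if_pos hj.symm, Matrix.one_mul]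
          simp only [State.unitaryPart, Function.update_of_ne hij, Function.update_self]
          rw [← List.append_assoc, word_append _ _ [G], snil]
        · have h2 : i.val + 1 ≠ j'.val := fun e => hij' (Fin.ext (by omega))
          simp [State.unitaryPart, Function.update_of_ne hij, Function.update_of_ne hij', h1, h2]
  | applyLeft j hj i hi x y q =>
    set G := mkCore a.fl i x y q with hGdef
    have hG : G.Normalized a.u := mk _ _ _ _
    have hi' : G.idx + 1 < n := hi
    refine ⟨fun i => ⟨GoodWord.of_update gQ (cons hG hi' (gQ j)) i, gCs i, gB i⟩,
      gau _ 0 _ (mem hG hi') (by rw [if_pos rfl]) ?_ ?_ ?_⟩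
    · rw [if_neg (by omega)]
    · intro i
      rw [← Core.toMatrix_succ hi']
      by_cases hij : i = j
      · subst hij
        simp [State.column, word_cons, Matrix.mul_assoc, hj]
      · have : i.val ≠ 0 := fun e => hij (Fin.ext (by omega))
        simp [State.column, Function.update_of_ne hij, this]
    · intro i
      rw [← Core.toMatrix_succ hi']
      by_cases hij : i = j
      · subst hij
        simp [State.unitaryPart, word_cons, hj]
      · have : i.val ≠ 0 := fun e => hij (Fin.ext (by omega))
        simp [State.unitaryPart, Function.update_of_ne hij, this]
  | removeLeft j hj w G h =>
    have hQ := gQ j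
    rw [h] at hQ
    have hG := hQ G (by simp)
    have hi := hG.2
    refine ⟨fun i => ⟨GoodWord.of_update gQ (tail hQ) i, gCs i, gB i⟩,
      gau _ 0 _ (Unitary.star_mem (mem hG.1 hi)) (by rw [if_pos rfl]; rfl) ?_ ?_ ?_⟩
    · rw [if_neg (by omega)]
    · intro i
      rw [star_eq_conjTranspose, border_conjTranspose, ← Core.toMatrix_succ hi]
      by_cases hij : i = j
      · subst hij
        simp only [State.column, Function.update_self, hj, if_true, h, List.cons_append, word_cons,
          ← Matrix.mul_assoc]
        rw [inv2 hG.1 hi, Matrix.one_mul]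
      · have : i.val ≠ 0 := fun e => hij (Fin.ext (by omega))
        simp [State.column, Function.update_of_ne hij, this]
    · intro i
      rw [star_eq_conjTranspose, border_conjTranspose, ← Core.toMatrix_succ hi]
      by_cases hij : i = j
      · subst hij
        rw [if_pos hj, if_neg (by omega), Matrix.mul_one]
        simp only [State.unitaryPart, Function.update_self, h,
          List.cons_append, word_cons, ← Matrix.mul_assoc]
        rw [inv2 hG.1 hi, Matrix.one_mul]
      · have : i.val ≠ 0 := fun e => hij (Fin.ext (by omega))
        simp [State.unitaryPart, Function.update_of_ne hij, this]
  | applyRight j hj i hi x y q =>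
    set G := mkCore a.fl i x y q with hGdef
    have hG : G.Normalized a.u := mk _ _ _ _
    have hi' : G.idx + 1 < n := hi
    refine ⟨fun i => ⟨gQ i, gCs i, GoodWord.of_update gB (snoc hG (by omega) (gB j)) i⟩,
      gau _ k _ (Unitary.star_mem (mem hG hi')) ?_ (by rw [if_pos rfl]; rfl) ?_ ?_⟩
    · rw [if_neg (by omega)]
    · intro i
      have : i.val ≠ k := i.isLt.ne
      simp [State.column, this]
    · intro i
      rw [star_eq_conjTranspose, border_conjTranspose, ← Core.toMatrix_succ hi',
        conjTranspose_conjTranspose, if_neg i.isLt.ne, Matrix.one_mul]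
      by_cases hij : i = j
      · subst hij
        simp only [State.unitaryPart, Function.update_self, hj, if_true]
        rw [← List.append_assoc, word_append _ _ [G], snil]
      · have : i.val + 1 ≠ k := fun e => hij (Fin.ext (by omega))
        simp [State.unitaryPart, Function.update_of_ne hij, this]
  | removeRight j hj w G h hi =>
    have hB := gB j
    rw [h] at hB
    have hG := hB G (by simp)
    refine ⟨fun i => ⟨gQ i, gCs i, GoodWord.of_update gB (init hB) i⟩,
      gau _ k _ (mem hG.1 hi) ?_ (by rw [if_pos rfl]) ?_ ?_⟩
    · rw [if_neg (by omega)]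
    · intro i
      have : i.val ≠ k := i.isLt.ne
      simp [State.column, this]
    · intro i
      rw [← Core.toMatrix_succ hi, if_neg i.isLt.ne, Matrix.one_mul]
      by_cases hij : i = j
      · subst hij
        simp only [State.unitaryPart, Function.update_self, hj, if_true, h]
        rw [← List.append_assoc, word_append _ _ [G], snil, Matrix.mul_assoc, inv1 hG.1 hi,
          Matrix.mul_one]
      · have : i.val + 1 ≠ k := fun e => hij (Fin.ext (by omega))
        simp [State.unitaryPart, Function.update_of_ne hij, this]

theorem exists_run_represents : ∃ C : ℝ, 0 ≤ C ∧ ∀ (a : Arith) {n k N : ℕ} (st st' : State n k),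
    Run a.fl a.u N st st' → st.Good a.u →
      st'.Good a.u ∧ ∀ x₀ W₀ ε, st.Represents x₀ W₀ ε →
        st'.Represents x₀ W₀ (ε + C * ((n : ℝ) + 1) ^ 8 * N * a.u) := by
  obtain ⟨C, hC, h⟩ := exists_step_represents
  refine ⟨C, hC, fun a n k N st st' hr hg => ?_⟩
  induction hr with
  | refl st => exact ⟨hg, fun x₀ W₀ ε hε => by simpa using hε⟩
  | step hr hs ih =>
    obtain ⟨g, r⟩ := ih hg
    obtain ⟨g', r'⟩ := h a _ _ hs g
    refine ⟨g', fun x₀ W₀ ε hε => ?_⟩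
    have := r' x₀ W₀ _ (r x₀ W₀ ε hε)
    refine CoreChasing.Represents.mono this (le_of_eq ?_)
    push_cast
    ring

theorem prod_ofFn_conj {n : ℕ} (k : ℕ) (A : Fin k → Matrix (Fin n) (Fin n) ℂ)
    (Z : ℕ → Matrix (Fin n) (Fin n) ℂ) (hZ : ∀ i, Z i ∈ unitaryGroup (Fin n) ℂ) :
    (List.ofFn fun j : Fin k => Z j * A j * (Z (j + 1))ᴴ).prod
      = Z 0 * (List.ofFn A).prod * (Z k)ᴴ := by
  induction k generalizing Z with
  | zero =>
    have := (mem_unitaryGroup_iff).1 (hZ 0)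
    simpa [star_eq_conjTranspose] using this.symm
  | succ k ih =>
    have := ih (fun j => A j.succ) (fun i => Z (i + 1)) fun i => hZ (i + 1)
    rw [List.ofFn_succ, List.prod_cons, List.ofFn_succ, List.prod_cons]
    simp only [Fin.val_succ, Fin.val_zero, zero_add] at this ⊢
    rw [this]
    have h1 : (Z 1)ᴴ * Z 1 = 1 := (mem_unitaryGroup_iff').1 (hZ 1)
    calc _ = Z 0 * A 0 * ((Z 1)ᴴ * Z 1) * (List.ofFn fun j => A j.succ).prod * (Z (k + 1))ᴴ := by
          simp only [Matrix.mul_assoc]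
      _ = _ := by rw [h1, Matrix.mul_one]; simp only [Matrix.mul_assoc]

/-- The represented matrix is `U S̃ V*`, where `S̃` is a product of factors formed from slightly
perturbed vectors and unitary matrices. -/
theorem State.Represents.exists_value_eq {n k : ℕ} {u : ℝ} {st : State n k} (hg : st.Good u)
    {x₀ : Fin k → Matrix (Fin (n + 1)) (Fin 1) ℂ}
    {W₀ : Fin k → Matrix (Fin (n + 1)) (Fin (n + 1)) ℂ} {ε : ℝ} (h : st.Represents x₀ W₀ ε) :
    st.U ∈ unitaryGroup (Fin n) ℂ ∧ st.V ∈ unitaryGroup (Fin n) ℂ ∧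
    ∃ (x : Fin k → Matrix (Fin (n + 1)) (Fin 1) ℂ)
      (W : Fin k → Matrix (Fin (n + 1)) (Fin (n + 1)) ℂ),
      (∀ j, ‖x j - x₀ j‖ ≤ ε) ∧ (∀ j, ‖W j - W₀ j‖ ≤ ε) ∧
      (∀ j, st.rho j = x j (Fin.last n) 0) ∧
      st.value = st.U * (List.ofFn fun j => obliqueFactor (x j) (W j)).prod * st.Vᴴ := by
  obtain ⟨Z, h1, h2, h3, h4⟩ := h
  refine ⟨h2 ▸ h1 0, h3 ▸ h1 k, fun j => (border (Z j))ᴴ * st.column j,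
    fun j => (border (Z j))ᴴ * st.unitaryPart j * border (Z (j + 1)), fun j => (h4 j).1,
    fun j => (h4 j).2, fun j => ?_, ?_⟩
  · change _ = ((border (Z j))ᴴ * st.column j) (Fin.last n) 0
    rw [hg.rho_eq, ← border_conjTranspose]
    simp [Matrix.mul_apply, Fin.sum_univ_castSucc]
  · rw [← h2, ← h3, ← prod_ofFn_conj k _ Z h1, State.value]
    congr 2
    funext j
    change _ = Z j * obliqueFactor ((border (Z j))ᴴ * st.column j) _ * _
    rw [hg.word_mul_R, obliqueFactor_mul_border, ← border_conjTranspose, obliqueFactor_border_mul]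
    have e1 : Z j * (Z j)ᴴ = 1 := (mem_unitaryGroup_iff).1 (h1 j)
    have e2 : Z (j + 1) * (Z (j + 1))ᴴ = 1 := (mem_unitaryGroup_iff).1 (h1 _)
    simp only [← Matrix.mul_assoc]
    rw [e1, Matrix.one_mul, Matrix.mul_assoc, e2, Matrix.mul_one]

/-! ### The initial data -/

theorem Core.toMatrix_eq_add {m : ℕ} {g : Core} (h : g.idx + 1 < m) (x y : Fin m) :
    g.toMatrix m x y =
      (if y.val = g.idx then (if x = ⟨g.idx, by omega⟩ then g.cosine else 0) +
          (if x = ⟨g.idx + 1, h⟩ then g.sine else 0)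
        else if y.val = g.idx + 1 then
          (if x = ⟨g.idx, by omega⟩ then -(star g.sine * g.phase) else 0) +
          (if x = ⟨g.idx + 1, h⟩ then star g.cosine * g.phase else 0)
        else if x = y then 1 else 0) := by
  rw [Core.toMatrix_apply]
  simp only [Fin.ext_iff]
  by_cases h1 : y.val = g.idx
  · have h2 : y.val ≠ g.idx + 1 := by omega
    by_cases h3 : x.val = g.idx
    · have h4 : x.val ≠ g.idx + 1 := by omega
      simp [h1, h3]
    · by_cases h4 : x.val = g.idx + 1 <;> simp [h1, h3, h4]
  · by_cases h2 : y.val = g.idx + 1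
    · by_cases h3 : x.val = g.idx
      · simp [h2, h3]
      · by_cases h4 : x.val = g.idx + 1 <;> simp [h2, h3, h4]
    · simp [h1, h2]

theorem mul_toMatrix_apply {m : ℕ} {g : Core} (h : g.idx + 1 < m) (A : Matrix (Fin m) (Fin m) ℂ)
    (x y : Fin m) :
    (A * g.toMatrix m) x y =
      if y.val = g.idx then A x ⟨g.idx, by omega⟩ * g.cosine + A x ⟨g.idx + 1, h⟩ * g.sine
      else if y.val = g.idx + 1 then A x ⟨g.idx, by omega⟩ * -(star g.sine * g.phase) +
        A x ⟨g.idx + 1, h⟩ * (star g.cosine * g.phase)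
      else A x y := by
  simp only [Matrix.mul_apply, Core.toMatrix_eq_add h]
  split_ifs <;> simp [mul_add, Finset.sum_add_distrib]

/-- The effect of a core transformation on a column that vanishes below the first of the two rows
acted upon. -/
theorem toMatrix_mul_apply {m : ℕ} {g : Core} (h : g.idx + 1 < m) {q : ℕ}
    (A : Matrix (Fin m) (Fin q) ℂ) (x : Fin m) (y : Fin q) (h0 : A ⟨g.idx + 1, h⟩ y = 0) :
    (g.toMatrix m * A) x y =
      if x.val = g.idx then g.cosine * A ⟨g.idx, by omega⟩ y
      else if x.val = g.idx + 1 then g.sine * A ⟨g.idx, by omega⟩ y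
      else A x y := by
  have e : ∀ l : Fin m, g.toMatrix m x l * A l y =
      (if x.val = g.idx then (if l = ⟨g.idx, by omega⟩ then g.cosine * A l y else 0)
      else if x.val = g.idx + 1 then (if l = ⟨g.idx, by omega⟩ then g.sine * A l y else 0)
      else if l = x then A l y else 0) := by
    intro l
    by_cases hl1 : l = ⟨g.idx + 1, h⟩
    · rw [hl1, h0]
      simp
    · have hl1' : l.val ≠ g.idx + 1 := fun e => hl1 (Fin.ext e)
      rw [Core.toMatrix_apply]
      simp only [Fin.ext_iff]
      by_cases h1 : x.val = g.idx
      · by_cases h3 : l.val = g.idx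
        · simp [h1, h3]
        · have h4 : g.idx ≠ l.val := fun e => h3 e.symm
          simp [h1, h3, hl1', h4]
      · by_cases h2 : x.val = g.idx + 1
        · by_cases h3 : l.val = g.idx
          · simp [h2, h3]
          · have h4 : g.idx + 1 ≠ l.val := fun e => hl1' e.symm
            simp [h2, h3, hl1', h4]
        · simp [h1, h2, eq_comm]
  rw [Matrix.mul_apply, Finset.sum_congr rfl fun l _ => e l]
  split_ifs <;> simp

/-- The exchange of the rows `i` and `i + 1`. -/
def swapCore (i : ℕ) : Core := { idx := i, c := 0, s := 1, p := -1 }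

theorem swapCore_normalized {u : ℝ} (hu : 0 ≤ u) (i : ℕ) : (swapCore i).Normalized u := by
  constructor <;> simp [swapCore, hypot, hu]

theorem swapCore_cosine (i : ℕ) : (swapCore i).cosine = 0 := by simp [swapCore, Core.cosine]
theorem swapCore_sine (i : ℕ) : (swapCore i).sine = 1 := by simp [swapCore, Core.sine, hypot]
theorem swapCore_phase (i : ℕ) : (swapCore i).phase = -1 := by simp [swapCore, Core.phase]

/-- The product of the first `t` exchanges is the cyclic downshift of the first `t + 1`
coordinates. -/
theorem word_swapCore_apply {m t : ℕ} (ht : t < m) (x y : Fin m) :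
    word m ((List.range t).map swapCore) x y =
      if y.val = (if x.val = 0 then t else if x.val ≤ t then x.val - 1 else x.val) then 1
      else 0 := by
  induction t generalizing y with
  | zero =>
    simp only [List.range_zero, List.map_nil, word_nil, Matrix.one_apply, Fin.ext_iff]
    congr 1
    apply propext
    split_ifs <;> omega
  | succ t ih =>
    rw [List.range_succ, List.map_append, word_append]
    simp only [List.map_cons, List.map_nil, word_cons, word_nil, mul_one]
    have hi : (swapCore t).idx = t := rfl
    rw [mul_toMatrix_apply (show (swapCore t).idx + 1 < m from ht), ih (by omega), ih (by omega),
      ih (by omega), swapCore_cosine, swapCore_sine, swapCore_phase]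
    simp only [hi, mul_zero, zero_add, mul_one, star_one, star_zero, zero_mul, add_zero, one_mul,
      neg_neg]
    have c : ∀ {p q : Prop} [Decidable p] [Decidable q], (p ↔ q) →
        (if p then (1 : ℂ) else 0) = if q then 1 else 0 := fun h => if_congr h rfl rfl
    split_ifs <;> first | rfl | omega

/-- The cyclic downshift of size `n + 1`. -/
def cyclicShift (n : ℕ) : Matrix (Fin (n + 1)) (Fin (n + 1)) ℂ :=
  word (n + 1) ((List.range n).map swapCore)

theorem cyclicShift_castSucc (n : ℕ) (x : Fin (n + 1)) (j : Fin n) :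
    cyclicShift n x j.castSucc = if x.val = j.val + 1 then 1 else 0 := by
  rw [cyclicShift, word_swapCore_apply n.lt_succ_self]
  have hx := x.isLt
  have hj := j.isLt
  simp only [Fin.val_castSucc]
  split_ifs <;> first | rfl | omega

theorem storeQ_good {u : ℝ} (hu : 0 ≤ u) (n : ℕ) : GoodWord u n (storeQ n) := by
  intro g hg
  simp only [storeQ, List.mem_map, List.mem_range] at hg
  obtain ⟨i, hi, rfl⟩ := hg
  exact ⟨swapCore_normalized hu i, by simp only; omega⟩

section Spike

variable (a : Arith) (n : ℕ) (v : ℕ → ℂ)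

theorem spikeCore_normalized (i : ℕ) : (spikeCore a.fl n v i).Normalized a.u :=
  mkCore_normalized a.model a.nonneg a.le _ _ _ _

theorem storeCs_good : GoodWord a.u (n + 1) (storeCs a.fl n v) := by
  intro g hg
  simp only [storeCs, List.mem_reverse, List.mem_map, List.mem_range] at hg
  obtain ⟨i, hi, rfl⟩ := hg
  exact ⟨spikeCore_normalized a n v i, by simp only [spikeCore, mkCore]; omega⟩

theorem hypot_star_neg (x y : ℂ) : hypot (star x) (-y) = hypot x y := by simp [hypot]

theorem hypot_star_swap (x y : ℂ) : hypot (star y) x = hypot x y := by simp [hypot, add_comm]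

theorem storeB_good : GoodWord a.u (n + 1) (storeB a.fl n v) := by
  intro g hg
  simp only [storeB, List.mem_map, List.mem_range] at hg
  obtain ⟨i, hi, rfl⟩ := hg
  have h := spikeCore_normalized a n v i
  have hu := a.nonneg
  split_ifs
  · refine ⟨⟨?_, by simp [hu]⟩, by simp only; omega⟩
    rw [hypot_star_neg]; exact h.hypot_le
  · refine ⟨⟨?_, by simp [hu]⟩, by simp only; omega⟩
    rw [hypot_star_swap]; exact h.hypot_le

theorem toMatrix_mul_adjoint {m i : ℕ} (hi : i + 2 ≤ m) :
    (spikeCore a.fl n v i).toMatrix m * Core.toMatrix m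
      { idx := i, c := star (spikeCore a.fl n v i).c, s := -(spikeCore a.fl n v i).s, p := 1 }
      = 1 := by
  set g := spikeCore a.fl n v i with hg
  have hn := spikeCore_normalized a n v i
  have hp : g.phase = 1 := mkCore_phase_one a.model a.nonneg a.le _ _ _
  have h1 := hn.cosine_sq_add a.le
  rw [← hg] at h1
  have e : ({ idx := i, c := star g.c, s := -g.s, p := 1 } : Core).active
      = active (star g.cosine) (-g.sine) 1 := by
    simp only [Core.active, Core.cosine, Core.sine, Core.phase, hypot_star_neg]
    simp only [star_div₀, Complex.star_def, Complex.conj_ofReal, norm_one,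
      Complex.ofReal_one, div_one, neg_div]
  rw [Core.toMatrix_eq_extend_active (g := g) hi,
    Core.toMatrix_eq_extend_active (g := { idx := i, c := star g.c, s := -g.s, p := 1 }) hi]
  change extend (consecutive 2 hi) _ * extend (consecutive 2 hi) _ = 1
  rw [extend_mul (consecutive_injective hi), e, ← extend_one (e := consecutive 2 hi)]
  congr 1
  simp only [Complex.star_def] at h1
  ext x y
  fin_cases x <;> fin_cases y <;> simp [Core.active, active, hp] <;> grind

theorem toMatrix_mul_exchanged {m i : ℕ} (hi : i + 2 ≤ m) :
    (spikeCore a.fl n v i).toMatrix m * Core.toMatrix m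
      { idx := i, c := star (spikeCore a.fl n v i).s, s := (spikeCore a.fl n v i).c, p := -1 }
      = (swapCore i).toMatrix m := by
  set g := spikeCore a.fl n v i with hg
  have hn := spikeCore_normalized a n v i
  have hp : g.phase = 1 := mkCore_phase_one a.model a.nonneg a.le _ _ _
  have h1 := hn.cosine_sq_add a.le
  rw [← hg] at h1
  have e : ({ idx := i, c := star g.s, s := g.c, p := -1 } : Core).active
      = active (star g.sine) g.cosine (-1) := by
    simp only [Core.active, Core.cosine, Core.sine, Core.phase, hypot_star_swap]
    simp only [star_div₀, Complex.star_def, Complex.conj_ofReal, norm_neg, norm_one,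
      Complex.ofReal_one, div_one]
  rw [Core.toMatrix_eq_extend_active (g := g) hi,
    Core.toMatrix_eq_extend_active (g := swapCore i) hi,
    Core.toMatrix_eq_extend_active (g := { idx := i, c := star g.s, s := g.c, p := -1 }) hi]
  change extend (consecutive 2 hi) _ * extend (consecutive 2 hi) _ = extend (consecutive 2 hi) _
  rw [extend_mul (consecutive_injective hi), e]
  congr 1
  simp only [Complex.star_def] at h1
  ext x y
  fin_cases x <;> fin_cases y <;>
    simp [Core.active, active, hp, swapCore_cosine, swapCore_sine, swapCore_phase] <;> grind

/-- The stored factors `C*` and `B` are made from the same computed numbers, so that their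
product is an exact permutation matrix. -/
theorem word_storeCs_mul_storeB (hn : 1 ≤ n) :
    word (n + 1) (storeCs a.fl n v) * word (n + 1) (storeB a.fl n v)
      = (swapCore (n - 1)).toMatrix (n + 1) := by
  obtain ⟨l, rfl⟩ : ∃ l, n = l + 1 := ⟨n - 1, by omega⟩
  set f : ℕ → Core := fun i =>
    { idx := i, c := star (spikeCore a.fl (l + 1) v i).c, s := -(spikeCore a.fl (l + 1) v i).s,
      p := 1 } with hf
  let g : Core :=
    { idx := l, c := star (spikeCore a.fl (l + 1) v l).s, s := (spikeCore a.fl (l + 1) v l).c,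
      p := -1 }
  have key : ∀ t, t ≤ l → word (l + 1 + 1) ((List.range t).map (spikeCore a.fl (l + 1) v)).reverse *
      word (l + 1 + 1) ((List.range t).map f) = 1 := by
    intro t ht
    induction t with
    | zero => simp [word_nil]
    | succ t ih =>
      rw [List.range_succ, List.map_append, List.map_append, List.reverse_append, word_append,
        word_append]
      simp only [List.map_cons, List.map_nil, List.reverse_singleton, word_cons, word_nil, mul_one]
      calc _ = (spikeCore a.fl (l + 1) v t).toMatrix (l + 1 + 1) *
            (word (l + 1 + 1) ((List.range t).map (spikeCore a.fl (l + 1) v)).reverse *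
              word (l + 1 + 1) ((List.range t).map f)) * (f t).toMatrix (l + 1 + 1) := by
            simp only [Matrix.mul_assoc]
        _ = 1 := by
          rw [ih (by omega), Matrix.mul_one]
          exact toMatrix_mul_adjoint a (l + 1) v (by omega)
  have hB : storeB a.fl (l + 1) v = (List.range l).map f ++
      [g] := by
    rw [storeB, List.range_succ, List.map_append]
    congr 1
    · refine List.map_congr_left fun i hi => ?_
      rw [List.mem_range] at hi
      simp only [hf]
      rw [if_pos (by omega)]
    · simp [g]
  have hC : storeCs a.fl (l + 1) v = spikeCore a.fl (l + 1) v l ::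
      ((List.range l).map (spikeCore a.fl (l + 1) v)).reverse := by
    rw [storeCs, List.range_succ]
    simp
  rw [hB, hC, word_append, word_cons]
  simp only [word_cons, word_nil, mul_one]
  calc _ = (spikeCore a.fl (l + 1) v l).toMatrix (l + 1 + 1) *
        (word (l + 1 + 1) ((List.range l).map (spikeCore a.fl (l + 1) v)).reverse *
          word (l + 1 + 1) ((List.range l).map f)) * _ := by
        simp only [Matrix.mul_assoc]
        rfl
    _ = _ := by
      rw [key l le_rfl, Matrix.mul_one]
      exact toMatrix_mul_exchanged a (l + 1) v (by omega)

/-- Whatever the rounding errors, the initial unitary matrices are exact. -/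
theorem unitaryPart_start (hn : 1 ≤ n) :
    word (n + 1) (storeQ n ++ storeCs a.fl n v ++ storeB a.fl n v) = cyclicShift n := by
  rw [word_append, word_append, Matrix.mul_assoc, word_storeCs_mul_storeB a n v hn, cyclicShift]
  obtain ⟨l, rfl⟩ : ∃ l, n = l + 1 := ⟨n - 1, by omega⟩
  rw [List.range_succ, List.map_append, word_append]
  simp only [List.map_cons, List.map_nil, word_cons, word_nil, mul_one]
  rfl

/-- The first column of `C*`, in terms of the exactly normalized data. -/
theorem word_storeCs_apply {t : ℕ} (ht : t ≤ n) (x : Fin (n + 1)) (y : Fin 1) :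
    (word (n + 1) ((List.range t).map (spikeCore a.fl n v)).reverse * firstColumn n) x y =
      if x.val < t then (∏ l ∈ Finset.range x.val, (spikeCore a.fl n v l).sine) *
        (spikeCore a.fl n v x.val).cosine
      else if x.val = t then ∏ l ∈ Finset.range t, (spikeCore a.fl n v l).sine else 0 := by
  induction t generalizing x with
  | zero =>
    simp only [List.range_zero, List.map_nil, List.reverse_nil, word_nil, Matrix.one_mul,
      firstColumn, Matrix.of_apply, Fin.ext_iff, Fin.val_zero]
    simp
  | succ t ih =>
    rw [List.range_succ, List.map_append, List.reverse_append]
    simp only [List.map_cons, List.map_nil, List.reverse_singleton, List.singleton_append,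
      word_cons, Matrix.mul_assoc]
    have hi : (spikeCore a.fl n v t).idx = t := rfl
    rw [toMatrix_mul_apply (show (spikeCore a.fl n v t).idx + 1 < n + 1 by rw [hi]; omega),
      ih (by omega), ih (by omega)]
    · simp only [hi]
      by_cases h1 : x.val = t
      · simp [h1, mul_comm]
      · by_cases h2 : x.val = t + 1
        · simp [h2, Finset.prod_range_succ, mul_comm]
        · simp only [if_neg h1, if_neg h2]
          by_cases h3 : x.val < t
          · rw [if_pos h3, if_pos (by omega)]
          · rw [if_neg h3, if_neg (by omega)]
    · rw [ih (by omega)]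
      simp [hi]

/-- One step of the computation of the trailing norms, with relative errors. -/
theorem spikeCore_step (i : ℕ) (hT : trailingNorm a.fl n v (n - 1 - i) ≠ 0) :
    ∃ r : ℝ, 0 < r ∧ r = flHypot a.fl (v i) (trailingNorm a.fl n v (n - 1 - i)) ∧
      ‖v i‖ ≤ 1.01 * r ∧
      r ≤ (1 + 7 * a.u) * (‖v i‖ + ‖trailingNorm a.fl n v (n - 1 - i)‖) ∧
      ‖(spikeCore a.fl n v i).cosine * r - v i‖ ≤ 28 * a.u * ‖v i‖ ∧
      ‖(spikeCore a.fl n v i).sine * r - trailingNorm a.fl n v (n - 1 - i)‖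
        ≤ 28 * a.u * ‖trailingNorm a.fl n v (n - 1 - i)‖ := by
  set T := trailingNorm a.fl n v (n - 1 - i) with hTdef
  have hu := a.nonneg
  have hu1 := a.le
  have hr := a.model.abs_flHypot_sub_le hu hu1 (v i) T
  set r := flHypot a.fl (v i) T with hrdef
  set h := hypot (v i) T with hh
  have hTh : ‖T‖ ≤ h := norm_le_hypot_right _ _
  have hvh : ‖v i‖ ≤ h := norm_le_hypot_left _ _
  have hpos : 0 < h := (norm_pos_iff.2 hT).trans_le hTh
  have hr' := abs_le.1 hr
  have hsum : h ≤ ‖v i‖ + ‖T‖ := by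
    refine Real.sqrt_le_iff.2 ⟨by positivity, ?_⟩
    nlinarith [mul_nonneg (norm_nonneg (v i)) (norm_nonneg T)]
  have rel : ∀ y w : ℂ, ‖y * (h : ℂ) - w‖ ≤ 20 * a.u * ‖w‖ →
      ‖y * (r : ℂ) - w‖ ≤ 28 * a.u * ‖w‖ := by
    intro y w hy
    have e1 : ‖y‖ * h ≤ (1 + 20 * a.u) * ‖w‖ := by
      have : ‖y * (h : ℂ)‖ ≤ ‖y * (h : ℂ) - w‖ + ‖w‖ := by
        simpa using norm_add_le (y * (h : ℂ) - w) w
      rw [norm_mul, Complex.norm_real, Real.norm_eq_abs, abs_of_pos hpos] at this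
      linarith
    have e2 : y * (r : ℂ) - w = y * ((r - h : ℝ) : ℂ) + (y * (h : ℂ) - w) := by
      push_cast; ring
    rw [e2]
    refine (norm_add_le _ _).trans ?_
    rw [norm_mul, Complex.norm_real, Real.norm_eq_abs]
    calc _ ≤ ‖y‖ * (7 * a.u * h) + 20 * a.u * ‖w‖ := by gcongr
      _ = 7 * a.u * (‖y‖ * h) + 20 * a.u * ‖w‖ := by ring
      _ ≤ 7 * a.u * ((1 + 20 * a.u) * ‖w‖) + 20 * a.u * ‖w‖ := by gcongr
      _ = (7 * (1 + 20 * a.u) + 20) * (a.u * ‖w‖) := by ring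
      _ ≤ 28 * (a.u * ‖w‖) := by gcongr; linarith
      _ = _ := by ring
  refine ⟨r, by nlinarith, rfl, by nlinarith, ?_, rel _ _ (mkCore_cosine a.model hu hu1 _ _ _ _),
    rel _ _ (mkCore_sine a.model hu hu1 _ _ _ _)⟩
  calc r ≤ (1 + 7 * a.u) * h := by linarith
    _ ≤ _ := by gcongr

theorem trailingNorm_ne_zero (t : ℕ) : trailingNorm a.fl n v t ≠ 0 := by
  have hu := a.nonneg
  have hu1 := a.le
  induction t with
  | zero => simp [trailingNorm]
  | succ t ih =>
    have hr := a.model.abs_flHypot_sub_le hu hu1 (v (n - 1 - t)) (trailingNorm a.fl n v t)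
    have hpos : 0 < hypot (v (n - 1 - t)) (trailingNorm a.fl n v t) :=
      (norm_pos_iff.2 ih).trans_le (norm_le_hypot_right _ _)
    have hr' := abs_le.1 hr
    rw [trailingNorm, Complex.ofReal_ne_zero]
    have : 0 < flHypot a.fl (v (n - 1 - t)) (trailingNorm a.fl n v t) := by nlinarith
    exact this.ne'

theorem trailingNorm_eq {t : ℕ} (ht : t < n) : trailingNorm a.fl n v (n - t) =
    ((flHypot a.fl (v t) (trailingNorm a.fl n v (n - 1 - t)) : ℝ) : ℂ) := by
  have e : n - t = (n - 1 - t) + 1 := by omega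
  rw [e, trailingNorm, show n - 1 - (n - 1 - t) = t by omega]

/-- The product of the computed sines telescopes to the reciprocal of the trailing norm, with a
relative error. -/
theorem norm_trailingNorm_mul_prod_add_one_le {t : ℕ} (ht : t ≤ n)
    (hs : 56 * (n : ℝ) * a.u ≤ 1) :
    ‖trailingNorm a.fl n v t * (∏ l ∈ Finset.Ico (n - t) n, (spikeCore a.fl n v l).sine) + 1‖
      ≤ 56 * (t : ℝ) * a.u := by
  have hu := a.nonneg
  induction t with
  | zero => simp [trailingNorm]
  | succ t ih =>
    have ih := ih (by omega)
    set p := ∏ l ∈ Finset.Ico (n - t) n, (spikeCore a.fl n v l).sine with hp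
    have e2 : n - 1 - (n - (t + 1)) = t := by omega
    obtain ⟨r, hr, hr1, -, -, -, hr2⟩ := spikeCore_step a n v (n - (t + 1))
      (trailingNorm_ne_zero a n v _)
    rw [e2] at hr1 hr2
    have hT : trailingNorm a.fl n v (t + 1) = (r : ℂ) := by
      rw [hr1, trailingNorm, show n - 1 - t = n - (t + 1) by omega]
    have hprod : ∏ l ∈ Finset.Ico (n - (t + 1)) n, (spikeCore a.fl n v l).sine
        = (spikeCore a.fl n v (n - (t + 1))).sine * p := by
      rw [Finset.prod_eq_prod_Ico_succ_bot (by omega), show n - (t + 1) + 1 = n - t by omega]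
    rw [hT, hprod]
    set T := trailingNorm a.fl n v t with hTdef
    have hz : ‖T * p‖ ≤ 2 := by
      have h1 : ‖T * p‖ ≤ ‖T * p + 1‖ + 1 := by
        simpa using norm_sub_le (T * p + 1) 1
      have h2 : (t : ℝ) ≤ n := by exact_mod_cast (by omega : t ≤ n)
      have h3 : 56 * (t : ℝ) * a.u ≤ 56 * (n : ℝ) * a.u := by gcongr
      linarith
    have e : (r : ℂ) * ((spikeCore a.fl n v (n - (t + 1))).sine * p) + 1
        = ((spikeCore a.fl n v (n - (t + 1))).sine * r - T) * p + (T * p + 1) := by ring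
    rw [e]
    refine (norm_add_le _ _).trans ?_
    rw [norm_mul] at hz ⊢
    have h4 : ‖(spikeCore a.fl n v (n - (t + 1))).sine * r - T‖ * ‖p‖ ≤ 28 * a.u * 2 := by
      calc _ ≤ 28 * a.u * ‖T‖ * ‖p‖ := by gcongr
        _ = 28 * a.u * (‖T‖ * ‖p‖) := by ring
        _ ≤ _ := by gcongr
    push_cast
    linarith

theorem norm_prod_sine_le (s : Finset ℕ) : ‖∏ l ∈ s, (spikeCore a.fl n v l).sine‖ ≤ 1 := by
  rw [norm_prod]
  exact Finset.prod_le_one (fun _ _ => norm_nonneg _) fun l _ =>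
    (spikeCore_normalized a n v l).norm_sine a.le

/-- The first column of the computed `C*` is proportional to `(v, -1)`, up to an absolute error of
the size of the unit round-off. -/
theorem norm_spike_error_le {t : ℕ} (ht : t < n) (hs : 56 * (n : ℝ) * a.u ≤ 1) :
    ‖(∏ l ∈ Finset.range t, (spikeCore a.fl n v l).sine) * (spikeCore a.fl n v t).cosine
      + (∏ l ∈ Finset.range n, (spikeCore a.fl n v l).sine) * v t‖ ≤ 85 * (n : ℝ) * a.u := by
  have hu := a.nonneg
  have hn : (1 : ℝ) ≤ n := by exact_mod_cast (by omega : 1 ≤ n)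
  rw [← Finset.prod_range_mul_prod_Ico _ ht.le]
  set p := ∏ l ∈ Finset.Ico t n, (spikeCore a.fl n v l).sine with hp
  set q := ∏ l ∈ Finset.range t, (spikeCore a.fl n v l).sine with hq
  set γ := (spikeCore a.fl n v t).cosine with hγ
  have hz := norm_trailingNorm_mul_prod_add_one_le a n v (Nat.sub_le n t) hs
  rw [show n - (n - t) = t by omega, ← hp, trailingNorm_eq a n v ht] at hz
  obtain ⟨r, hr, hr1, hv, -, hc, -⟩ := spikeCore_step a n v t (trailingNorm_ne_zero a n v _)
  rw [← hr1] at hz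
  have h1 : ((n - t : ℕ) : ℝ) ≤ n := by exact_mod_cast Nat.sub_le n t
  have e : (γ + v t * p) * (r : ℂ) = (γ * r - v t) + v t * ((r : ℂ) * p + 1) := by ring
  have hmul : ‖γ + v t * p‖ * r ≤ 85 * (n : ℝ) * a.u * r := by
    have : ‖(γ + v t * p) * (r : ℂ)‖ = ‖γ + v t * p‖ * r := by
      rw [norm_mul, Complex.norm_real, Real.norm_eq_abs, abs_of_pos hr]
    rw [← this, e]
    refine (norm_add_le _ _).trans ?_
    rw [norm_mul]
    have h2 : 56 * ((n - t : ℕ) : ℝ) * a.u ≤ 56 * (n : ℝ) * a.u := by gcongr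
    calc _ ≤ 28 * a.u * ‖v t‖ + ‖v t‖ * (56 * (n : ℝ) * a.u) := by
          gcongr
          exact hz.trans h2
      _ = (28 + 56 * (n : ℝ)) * a.u * ‖v t‖ := by ring
      _ ≤ (84 * (n : ℝ)) * a.u * (1.01 * r) := by gcongr; linarith
      _ ≤ _ := by nlinarith [mul_nonneg (mul_nonneg (by linarith : (0 : ℝ) ≤ n) hu) hr.le]
  have hfin := le_of_mul_le_mul_right hmul hr
  have e' : q * γ + q * p * v t = q * (γ + v t * p) := by ring
  rw [e', norm_mul]
  calc _ ≤ 1 * (85 * (n : ℝ) * a.u) :=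
        mul_le_mul (norm_prod_sine_le a n v _) hfin (norm_nonneg _) zero_le_one
    _ = _ := one_mul _

theorem norm_trailingNorm_le {s : ℝ} (hs1 : 1 ≤ s) (hv : ∀ i, ‖v i‖ ≤ s)
    (hs : 56 * (n : ℝ) * a.u ≤ 1) {t : ℕ} (ht : t ≤ n) :
    ‖trailingNorm a.fl n v t‖ ≤ (1 + 14 * (t : ℝ) * a.u) * ((t : ℝ) + 1) * s := by
  have hu := a.nonneg
  induction t with
  | zero => simpa [trailingNorm] using hs1
  | succ t ih =>
    have ih := ih (by omega)
    obtain ⟨r, hr, hr1, -, hr2, -⟩ := spikeCore_step a n v (n - (t + 1))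
      (trailingNorm_ne_zero a n v _)
    rw [show n - 1 - (n - (t + 1)) = t by omega] at hr1 hr2
    have hT : trailingNorm a.fl n v (t + 1) = (r : ℂ) := by
      rw [hr1, trailingNorm, show n - 1 - t = n - (t + 1) by omega]
    rw [hT, Complex.norm_real, Real.norm_eq_abs, abs_of_pos hr]
    have h2 : (t : ℝ) ≤ n := by exact_mod_cast (by omega : t ≤ n)
    have h3 : 56 * (t : ℝ) * a.u ≤ 56 * (n : ℝ) * a.u := by gcongr
    have ht0 : (0 : ℝ) ≤ t := t.cast_nonneg
    have hv' := hv (n - (t + 1))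
    have h4 : (1 + 7 * a.u) * (1 + 14 * (t : ℝ) * a.u) ≤ 1 + 14 * ((t : ℝ) + 1) * a.u := by
      nlinarith [mul_nonneg ht0 hu]
    have h5 : s ≤ (1 + 14 * (t : ℝ) * a.u) * s :=
      le_mul_of_one_le_left (by linarith) (by nlinarith [mul_nonneg ht0 hu])
    calc r ≤ (1 + 7 * a.u) * (s + (1 + 14 * (t : ℝ) * a.u) * ((t : ℝ) + 1) * s) := by
          refine hr2.trans ?_
          gcongr
      _ ≤ (1 + 7 * a.u) * ((1 + 14 * (t : ℝ) * a.u) * s +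
            (1 + 14 * (t : ℝ) * a.u) * ((t : ℝ) + 1) * s) := by gcongr
      _ = (1 + 7 * a.u) * (1 + 14 * (t : ℝ) * a.u) * (((t : ℝ) + 2) * s) := by ring
      _ ≤ (1 + 14 * ((t : ℝ) + 1) * a.u) * (((t : ℝ) + 2) * s) := by gcongr
      _ = _ := by push_cast; ring

/-- The last entry of the first column of the computed `C*` is not much smaller than the
reciprocal of the norm of the spike. -/
theorem one_le_mul_norm_prod_sine {s : ℝ} (hs1 : 1 ≤ s) (hv : ∀ i, ‖v i‖ ≤ s)
    (hs : 112 * (n : ℝ) * a.u ≤ 1) :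
    1 ≤ 4 * ((n : ℝ) + 1) * s * ‖∏ l ∈ Finset.range n, (spikeCore a.fl n v l).sine‖ := by
  have hu := a.nonneg
  have hn : (0 : ℝ) ≤ n := n.cast_nonneg
  have hs' : 56 * (n : ℝ) * a.u ≤ 1 := by nlinarith [mul_nonneg hn hu]
  have hz := norm_trailingNorm_mul_prod_add_one_le a n v le_rfl hs'
  have hT := norm_trailingNorm_le a n v hs1 hv hs' le_rfl
  rw [Nat.sub_self, ← Finset.range_eq_Ico] at hz
  set p := ∏ l ∈ Finset.range n, (spikeCore a.fl n v l).sine with hp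
  set T := trailingNorm a.fl n v n with hTdef
  have h1 : 1 - ‖T * p‖ ≤ ‖T * p + 1‖ := by
    have := norm_sub_le (T * p + 1) (T * p)
    rw [add_sub_cancel_left, norm_one] at this
    linarith
  have h2 : 1 / 2 ≤ ‖T‖ * ‖p‖ := by rw [← norm_mul]; linarith
  have h3 : ‖T‖ ≤ 2 * ((n : ℝ) + 1) * s := by
    refine hT.trans ?_
    gcongr
    linarith
  nlinarith [norm_nonneg p]

end Spike

/-- The multiple of `(c₀, …, c_{n-1}, 1)` with factor `β`. -/
def spikeColumn (n : ℕ) (c : ℕ → ℂ) (β : ℂ) : Matrix (Fin (n + 1)) (Fin 1) ℂ :=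
  Matrix.of fun x _ => β * if x.val < n then c x.val else 1

theorem word_storeQ_mul_apply {n q : ℕ} (hn : 1 ≤ n) (A : Matrix (Fin (n + 1)) (Fin q) ℂ)
    (x : Fin (n + 1)) (y : Fin q) :
    (word (n + 1) (storeQ n) * A) x y =
      A ⟨if x.val = 0 then n - 1 else if x.val ≤ n - 1 then x.val - 1 else x.val,
        by split_ifs <;> omega⟩ y := by
  have e : word (n + 1) (storeQ n) = word (n + 1) ((List.range (n - 1)).map swapCore) := rfl
  have hlt : (if x.val = 0 then n - 1 else if x.val ≤ n - 1 then x.val - 1 else x.val) < n + 1 := by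
    split_ifs <;> omega
  rw [e, Matrix.mul_apply, Finset.sum_eq_single ⟨_, hlt⟩]
  · rw [word_swapCore_apply (by omega), if_pos rfl, one_mul]
  · intro b _ hb
    rw [word_swapCore_apply (by omega), if_neg fun h => hb (Fin.ext h), zero_mul]
  · simp

theorem norm_startColumn_sub_le (a : Arith) {n : ℕ} (hn : 1 ≤ n) (v c : ℕ → ℂ)
    (hv : ∀ i, v i = if i + 1 < n then -c (i + 1) else -c 0) (hs : 56 * (n : ℝ) * a.u ≤ 1) :
    ‖word (n + 1) (storeQ n ++ storeCs a.fl n v) * firstColumn n -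
        spikeColumn n c (∏ l ∈ Finset.range n, (spikeCore a.fl n v l).sine)‖
      ≤ ((n : ℝ) + 1) * (85 * (n : ℝ) * a.u) := by
  refine (norm_le_of_apply_le _ (r := 85 * (n : ℝ) * a.u) fun x y => ?_).trans (by simp)
  have hu := a.nonneg
  have key : ∀ (b : ℕ) (hb : b < n),
      ‖(word (n + 1) (storeCs a.fl n v) * firstColumn n) ⟨b, by omega⟩ y
      + (∏ l ∈ Finset.range n, (spikeCore a.fl n v l).sine) * v b‖ ≤ 85 * (n : ℝ) * a.u := by
    intro b hb
    rw [storeCs, word_storeCs_apply a n v le_rfl, if_pos (by exact hb)]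
    exact norm_spike_error_le a n v hb hs
  rw [word_append, Matrix.mul_assoc, Matrix.sub_apply, word_storeQ_mul_apply hn]
  simp only [spikeColumn, Matrix.of_apply]
  rcases Nat.lt_or_ge x.val n with hx | hx
  · simp only [if_pos hx]
    by_cases h0 : x.val = 0
    · have := key (n - 1) (by omega)
      rw [hv, if_neg (by omega), mul_neg, ← sub_eq_add_neg] at this
      simpa only [h0, if_true] using this
    · have := key (x.val - 1) (by omega)
      rw [hv, if_pos (by omega), mul_neg, ← sub_eq_add_neg, Nat.sub_add_cancel (by omega)] at this
      simpa only [if_neg h0, if_pos (show x.val ≤ n - 1 by omega)] using this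
  · have hxn : x.val = n := by have := x.isLt; omega
    have e : (word (n + 1) (storeCs a.fl n v) * firstColumn n) ⟨n, by omega⟩ y
        = ∏ l ∈ Finset.range n, (spikeCore a.fl n v l).sine := by
      rw [storeCs, word_storeCs_apply a n v le_rfl]
      simp
    simp only [hxn, lt_irrefl, if_false, mul_one, if_neg (show ¬ n = 0 by omega),
      if_neg (show ¬ n ≤ n - 1 by omega)]
    rw [e, sub_self, norm_zero]
    positivity

/-- The initial data represent the companion factors: the vectors `C_j* e₁` are, up to rounding,
multiples of `(a_j, 1)` that are not too small. -/
theorem frobeniusStart_represents (a : Arith) {d k : ℕ} (hn : 1 ≤ d * k)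
    (M : Fin d → Matrix (Fin k) (Fin k) ℂ) (hs : 112 * ((d * k : ℕ) : ℝ) * a.u ≤ 1) {s : ℝ}
    (hs1 : 1 ≤ s) (hM : ∀ j i, ‖frobeniusCoeff M j i‖ ≤ s) :
    (frobeniusStart a.fl M).Good a.u ∧ ∃ β : Fin k → ℂ,
      (∀ j, 1 ≤ 4 * (((d * k : ℕ) : ℝ) + 1) * s * ‖β j‖) ∧
      (frobeniusStart a.fl M).Represents (fun j => spikeColumn (d * k) (frobeniusCoeff M j) (β j))
        (fun _ => cyclicShift (d * k)) (85 * (((d * k : ℕ) : ℝ) + 1) ^ 2 * a.u) := by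
  have hu := a.nonneg
  set n := d * k with hnd
  have hn0 : (0 : ℝ) ≤ n := n.cast_nonneg
  have hspike : ∀ j i, ‖frobeniusSpike M j i‖ ≤ s := by
    intro j i
    rw [frobeniusSpike]
    split_ifs <;> rw [norm_neg] <;> exact hM _ _
  refine ⟨fun j => ⟨storeQ_good hu n, storeCs_good a n _, storeB_good a n _⟩,
    fun j => ∏ l ∈ Finset.range n, (spikeCore a.fl n (frobeniusSpike M j) l).sine,
    fun j => one_le_mul_norm_prod_sine a n _ hs1 (hspike j) hs,
    fun _ => 1, fun _ => one_mem _, rfl, rfl, fun j => ⟨?_, ?_⟩⟩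
  · rw [border_one, conjTranspose_one, Matrix.one_mul]
    refine (norm_startColumn_sub_le a hn _ (frobeniusCoeff M j) (fun i => rfl) ?_).trans ?_
    · nlinarith [mul_nonneg hn0 hu]
    · nlinarith [mul_nonneg hn0 hu, mul_nonneg (mul_nonneg hn0 hn0) hu]
  · have e : (frobeniusStart a.fl M).unitaryPart j = cyclicShift n :=
      unitaryPart_start a n _ hn
    rw [border_one, conjTranspose_one, Matrix.one_mul, Matrix.mul_one, e, sub_self, norm_zero]
    positivity

/-! ### Products of companion matrices -/

/-- The product `A_p A_{p+1} ⋯ A_{p+t-1}`. -/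
def segment {n : ℕ} (A : ℕ → Matrix (Fin n) (Fin n) ℂ) (p : ℕ) : ℕ → Matrix (Fin n) (Fin n) ℂ
  | 0 => 1
  | t + 1 => segment A p t * A (p + t)

theorem segment_succ_left {n : ℕ} (A : ℕ → Matrix (Fin n) (Fin n) ℂ) (p t : ℕ) :
    segment A p (t + 1) = A p * segment A (p + 1) t := by
  induction t with
  | zero => simp [segment]
  | succ t ih =>
    rw [segment, ih, segment, Matrix.mul_assoc, show p + (t + 1) = p + 1 + t by omega]

theorem prod_ofFn_eq_segment {n : ℕ} (A : ℕ → Matrix (Fin n) (Fin n) ℂ) (k : ℕ) :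
    (List.ofFn fun j : Fin k => A j).prod = segment A 0 k := by
  induction k with
  | zero => simp [segment]
  | succ k ih =>
    rw [List.ofFn_succ', List.concat_eq_append, List.prod_append, segment, ← ih]
    simp

theorem norm_one_le (n : ℕ) : ‖(1 : Matrix (Fin n) (Fin n) ℂ)‖ ≤ (n : ℝ) ^ 2 := by
  have := norm_unitary_le (one_mem (unitaryGroup (Fin n) ℂ))
  simpa using this

theorem norm_segment_le {n : ℕ} {A : ℕ → Matrix (Fin n) (Fin n) ℂ} {σ : ℝ} (hσ : 0 ≤ σ)
    (hA : ∀ i, ‖A i‖ ≤ σ) (p t : ℕ) : ‖segment A p t‖ ≤ (n : ℝ) ^ 2 * σ ^ t := by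
  induction t with
  | zero => simpa [segment] using norm_one_le n
  | succ t ih =>
    refine (frobenius_norm_mul _ _).trans ?_
    rw [pow_succ σ, ← mul_assoc]
    gcongr
    exact hA _

/-- A crude bound, which serves only to show that products depend continuously on the factors. -/
theorem norm_segment_sub_segment_le {n : ℕ} {A F : ℕ → Matrix (Fin n) (Fin n) ℂ} {σ τ : ℝ}
    (hσ : 1 ≤ σ) (hA : ∀ i, ‖A i‖ ≤ σ) (hF : ∀ i, ‖F i‖ ≤ σ) (h : ∀ i, ‖F i - A i‖ ≤ τ) (p t : ℕ) :
    ‖segment F p t - segment A p t‖ ≤ (n : ℝ) ^ 2 * t * σ ^ t * τ := by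
  have hτ : 0 ≤ τ := (norm_nonneg _).trans (h 0)
  induction t with
  | zero => simp [segment]
  | succ t ih =>
    have e : segment F p (t + 1) - segment A p (t + 1) =
        segment F p t * (F (p + t) - A (p + t)) +
          (segment F p t - segment A p t) * A (p + t) := by
      rw [segment, segment]
      noncomm_ring
    rw [e]
    calc _ ≤ ‖segment F p t‖ * ‖F (p + t) - A (p + t)‖ +
          ‖segment F p t - segment A p t‖ * ‖A (p + t)‖ :=
        (norm_add_le _ _).trans (add_le_add (frobenius_norm_mul _ _) (frobenius_norm_mul _ _))
      _ ≤ (n : ℝ) ^ 2 * σ ^ t * τ + (n : ℝ) ^ 2 * t * σ ^ t * τ * σ := by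
        gcongr
        · exact norm_segment_le (by linarith) hF p t
        · exact h _
        · exact hA _
      _ ≤ (n : ℝ) ^ 2 * σ ^ t * τ * σ + (n : ℝ) ^ 2 * t * σ ^ t * τ * σ := by
        have := le_mul_of_one_le_right (show 0 ≤ (n : ℝ) ^ 2 * σ ^ t * τ by positivity) hσ
        linarith
      _ = _ := by push_cast; ring

/-- Replacing the factors of a product one by one, from the left. -/
theorem norm_segment_mul_sub_le {n : ℕ} {A F : ℕ → Matrix (Fin n) (Fin n) ℂ} {b : ℝ} (p t : ℕ)
    (h : ∀ i j, i + j + 1 = p + t →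
      ‖segment A 0 i * ((F i - A i) * segment F (i + 1) j)‖ ≤ b) :
    ‖segment A 0 p * (segment F p t - segment A p t)‖ ≤ t * b := by
  induction t generalizing p with
  | zero => simp [segment]
  | succ t ih =>
    have e : segment A 0 p * (segment F p (t + 1) - segment A p (t + 1)) =
        segment A 0 p * ((F p - A p) * segment F (p + 1) t) +
          segment A 0 (p + 1) * (segment F (p + 1) t - segment A (p + 1) t) := by
      rw [segment_succ_left, segment_succ_left, segment, zero_add]
      noncomm_ring
    rw [e]
    have h1 := h p t (by omega)
    have h2 := ih (p + 1) fun i j hij => h i j (by omega)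
    refine (norm_add_le _ _).trans ((add_le_add h1 h2).trans (le_of_eq ?_))
    push_cast
    ring

/-- The scalar companion matrix with ones on the subdiagonal and last column `-c`. -/
def companion (n : ℕ) (c : ℕ → ℂ) : Matrix (Fin n) (Fin n) ℂ :=
  Matrix.of fun l i => if i.val + 1 < n then (if l.val = i.val + 1 then 1 else 0) else -c l.val

theorem companion_apply_of_lt {n : ℕ} (c : ℕ → ℂ) (l : Fin n) {i : Fin n} (h : i.val + 1 < n) :
    companion n c l i = if l.val = i.val + 1 then 1 else 0 := by simp [companion, h]

theorem companion_apply_last {n : ℕ} (c : ℕ → ℂ) (l : Fin n) {i : Fin n} (h : i.val + 1 = n) :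
    companion n c l i = -c l.val := by simp [companion, h]

/-- The product of consecutive Frobenius companion factors of an array `m` with `n` rows: it shifts
the coordinates, and its last columns are columns of `m`. -/
theorem segment_companion_apply {n : ℕ} (m : ℕ → ℕ → ℂ) (hm : ∀ r j, n ≤ r → m r j = 0)
    (p t : ℕ) (l i : Fin n) :
    segment (fun j => companion n fun x => m (x + j) j) p t l i =
      if i.val + t < n then (if l.val = i.val + t then 1 else 0)
      else -(if i.val + p + t - n ≤ l.val + p then m (l.val + p) (i.val + p + t - n) else 0) := by
  induction t generalizing i with
  | zero => simp [segment, Matrix.one_apply, Fin.ext_iff]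
  | succ t ih =>
    have hi := i.isLt
    have hl := l.isLt
    rw [segment, Matrix.mul_apply]
    by_cases h1 : i.val + 1 < n
    · rw [Finset.sum_eq_single ⟨i.val + 1, h1⟩]
      · rw [ih]
        rw [companion_apply_of_lt _ _ h1, if_pos rfl, mul_one]
        rw [show i.val + 1 + t = i.val + (t + 1) by omega,
          show i.val + 1 + p + t = i.val + p + (t + 1) by omega]
      · intro b _ hb
        have : b.val ≠ i.val + 1 := fun e => hb (Fin.ext e)
        simp [companion_apply_of_lt _ _ h1, this]
      · simp
    · have hin : i.val + 1 = n := by omega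
      rw [if_neg (by omega), show i.val + p + (t + 1) - n = p + t by omega]
      simp only [companion_apply_last _ _ hin]
      have e : ∀ x : Fin n, segment (fun j => companion n fun x => m (x + j) j) p t l x *
          -m (x.val + (p + t)) (p + t) =
          if l.val = x.val + t then -m (l.val + p) (p + t) else 0 := by
        intro x
        rw [ih]
        by_cases h2 : x.val + t < n
        · rw [if_pos h2]
          split_ifs with h3
          · rw [h3, one_mul, show x.val + (p + t) = x.val + t + p by omega]
          · rw [zero_mul]
        · rw [hm (x.val + (p + t)) _ (by omega), neg_zero, mul_zero, if_neg (by omega)]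
      rw [Finset.sum_congr rfl fun x _ => e x]
      by_cases h4 : t ≤ l.val
      · rw [if_pos (by omega), Finset.sum_eq_single ⟨l.val - t, by omega⟩]
        · rw [if_pos (by simp only; omega)]
        · intro b _ hb
          exact if_neg fun h => hb (Fin.ext (by simp only; omega))
        · simp
      · rw [if_neg (by omega), neg_zero]
        exact Finset.sum_eq_zero fun x _ => if_neg (by omega)

theorem norm_segment_companion_apply_le {n : ℕ} {m : ℕ → ℕ → ℂ} (hm : ∀ r j, n ≤ r → m r j = 0)
    {s : ℝ} (hs : 1 ≤ s) (hms : ∀ r j, ‖m r j‖ ≤ s) (p t : ℕ) (l i : Fin n) :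
    ‖segment (fun j => companion n fun x => m (x + j) j) p t l i‖ ≤ s := by
  rw [segment_companion_apply m hm]
  split_ifs
  · simpa using hs
  · simpa using zero_le_one.trans hs
  · simpa using hms _ _
  · simpa using zero_le_one.trans hs

theorem norm_segment_companion_le {n : ℕ} {m : ℕ → ℕ → ℂ} (hm : ∀ r j, n ≤ r → m r j = 0)
    {s : ℝ} (hs : 1 ≤ s) (hms : ∀ r j, ‖m r j‖ ≤ s) (p t : ℕ) :
    ‖segment (fun j => companion n fun x => m (x + j) j) p t‖ ≤ (n : ℝ) ^ 2 * s := by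
  refine (norm_le_of_apply_le _ fun l i =>
    norm_segment_companion_apply_le hm hs hms p t l i).trans (le_of_eq ?_)
  simp only [Fintype.card_fin]
  ring

/-- The last row of a product of Frobenius companion factors does not involve the data, unless the
product contains the first factor. -/
theorem norm_segment_companion_last_le {n : ℕ} {m : ℕ → ℕ → ℂ} (hm : ∀ r j, n ≤ r → m r j = 0)
    (p t : ℕ) (l i : Fin n) (hl : l.val + 1 = n) :
    ‖segment (fun j => companion n fun x => m (x + j) j) (p + 1) t l i‖ ≤ 1 := by
  rw [segment_companion_apply m hm]
  split_ifs
  · simp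
  · simp
  · rw [hm _ _ (by omega)]; simp
  · simp

/-- The matrix `[I, -c]`. -/
def projectAlong (n : ℕ) (c : ℕ → ℂ) : Matrix (Fin n) (Fin (n + 1)) ℂ :=
  Matrix.of fun l => Fin.lastCases (-c l.val) fun x => if l = x then 1 else 0

@[simp] theorem projectAlong_castSucc (n : ℕ) (c : ℕ → ℂ) (l x : Fin n) :
    projectAlong n c l x.castSucc = if l = x then 1 else 0 := by simp [projectAlong]

@[simp] theorem projectAlong_last (n : ℕ) (c : ℕ → ℂ) (l : Fin n) :
    projectAlong n c l (Fin.last n) = -c l.val := by simp [projectAlong]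

theorem norm_projectAlong_le {n : ℕ} {c : ℕ → ℂ} {s : ℝ} (hs : 1 ≤ s) (hc : ∀ i, ‖c i‖ ≤ s) :
    ‖projectAlong n c‖ ≤ (n : ℝ) * ((n : ℝ) + 1) * s := by
  refine (norm_le_of_apply_le _ (r := s) fun l x => ?_).trans (le_of_eq (by simp))
  refine Fin.lastCases ?_ (fun x => ?_) x
  · simpa using hc _
  · rw [projectAlong_castSucc]
    split_ifs
    · simpa using hs
    · simpa using zero_le_one.trans hs

/-- Although both factors may be as large as `s`, so is their product, because its columns are
columns of products of companion factors. -/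
theorem norm_segment_mul_projectAlong_le {n : ℕ} {m : ℕ → ℕ → ℂ} (hm : ∀ r j, n ≤ r → m r j = 0)
    {s : ℝ} (hs : 1 ≤ s) (hms : ∀ r j, ‖m r j‖ ≤ s) (p : ℕ) :
    ‖segment (fun j => companion n fun x => m (x + j) j) 0 p * projectAlong n fun x => m (x + p) p‖
      ≤ (n : ℝ) * ((n : ℝ) + 1) * s := by
  refine (norm_le_of_apply_le _ (r := s) fun l x => ?_).trans (le_of_eq (by simp))
  refine Fin.lastCases ?_ (fun x => ?_) x
  · have hn : n - 1 < n := by have := l.isLt; omega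
    have := norm_segment_companion_apply_le hm hs hms 0 (p + 1) l ⟨n - 1, hn⟩
    rw [segment, Matrix.mul_apply] at this
    rw [Matrix.mul_apply]
    simp only [projectAlong_last]
    simpa only [companion_apply_last _ _
      (show (⟨n - 1, hn⟩ : Fin n).val + 1 = n by simp only; omega),
      zero_add] using this
  · have := norm_segment_companion_apply_le hm hs hms 0 p l x
    simpa [Matrix.mul_apply] using this

/-- The error of a perturbed factor, factored in such a way that the possibly large left factor
can be combined with the preceding companion factors. -/
theorem obliqueFactor_sub_companion {n : ℕ} (c : ℕ → ℂ) (β : ℂ)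
    (x : Matrix (Fin (n + 1)) (Fin 1) ℂ) (W : Matrix (Fin (n + 1)) (Fin (n + 1)) ℂ)
    (hx : x (Fin.last n) 0 ≠ 0) :
    obliqueFactor x W - companion n c = projectAlong n c *
      ((W - cyclicShift n).submatrix id Fin.castSucc - (x (Fin.last n) 0)⁻¹ •
        ((x - spikeColumn n c β) *
          W.submatrix (fun _ : Fin 1 => Fin.last n) Fin.castSucc)) := by
  ext l i
  have hl := l.isLt
  have hi := i.isLt
  have e0 : (if l.val = i.val + 1 then (1 : ℂ) else 0) - c l.val * (if n = i.val + 1 then 1 else 0)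
      = companion n c l i := by
    simp only [companion, Matrix.of_apply]
    by_cases h : i.val + 1 < n
    · rw [if_pos h, if_neg (show ¬ n = i.val + 1 by omega)]; ring
    · rw [if_neg h, if_pos (show n = i.val + 1 by omega), if_neg (by omega)]; ring
  rw [Matrix.sub_apply, ← e0, Matrix.mul_apply, Fin.sum_univ_castSucc]
  simp only [projectAlong_castSucc, projectAlong_last, Matrix.sub_apply, Matrix.smul_apply,
    Matrix.submatrix_apply, Matrix.mul_apply, Finset.univ_unique, Finset.sum_singleton,
    cyclicShift_castSucc, id_eq, smul_eq_mul, ite_mul, one_mul, zero_mul, Finset.sum_ite_eq,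
    Finset.mem_univ, if_true, obliqueFactor, Matrix.of_apply, spikeColumn, Fin.val_castSucc,
    Fin.val_last, hl, lt_irrefl, if_false, Fin.default_eq_zero]
  field_simp
  ring

/-! ### The error of the product -/

section Factor

variable {n : ℕ} {c : ℕ → ℂ} {β : ℂ} {x : Matrix (Fin (n + 1)) (Fin 1) ℂ}
  {W : Matrix (Fin (n + 1)) (Fin (n + 1)) ℂ} {s ε : ℝ}

/-- Division by the last entry of the perturbed vector costs at most a multiple of `s`. -/
theorem norm_inv_last_le (hn : 1 ≤ n) (hβ : 1 ≤ 4 * ((n : ℝ) + 1) * s * ‖β‖)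
    (hx : ‖x - spikeColumn n c β‖ ≤ ε) (hs : 1 ≤ s) (hε : 16 * (n : ℝ) * s * ε ≤ 1) :
    x (Fin.last n) 0 ≠ 0 ∧ ‖(x (Fin.last n) 0)⁻¹‖ ≤ 16 * n * s := by
  have hn' : (1 : ℝ) ≤ n := by exact_mod_cast hn
  have h1 : ‖x (Fin.last n) 0 - β‖ ≤ ε := by
    have := (norm_apply_le _ (Fin.last n) 0).trans hx
    simpa [spikeColumn] using this
  have h2 : ‖β‖ ≤ ‖x (Fin.last n) 0‖ + ε := by
    have := norm_sub_le (x (Fin.last n) 0) (x (Fin.last n) 0 - β)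
    rw [sub_sub_cancel] at this
    linarith
  have h3 : 4 * ((n : ℝ) + 1) * s * ‖β‖ ≤ 8 * n * s * ‖β‖ := by
    have : 4 * ((n : ℝ) + 1) ≤ 8 * n := by linarith
    gcongr
  have h4 : 8 * (n : ℝ) * s * ‖β‖ ≤ 8 * n * s * (‖x (Fin.last n) 0‖ + ε) := by gcongr
  have h5 : 1 ≤ 16 * n * s * ‖x (Fin.last n) 0‖ := by linarith
  have h6 : 0 < ‖x (Fin.last n) 0‖ := by
    by_contra h
    have : ‖x (Fin.last n) 0‖ = 0 := le_antisymm (not_lt.1 h) (norm_nonneg _)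
    rw [this] at h5
    linarith
  refine ⟨norm_pos_iff.1 h6, ?_⟩
  rw [norm_inv]
  exact inv_le_of_inv_le₀ (by positivity) ((inv_le_iff_one_le_mul₀ (by positivity)).2 (by linarith))

/-- The right factor in `obliqueFactor_sub_companion`, multiplied by the subsequent factors `T`:
the large term involves only one row of the product with `T`. -/
theorem norm_errorFactor_mul_le {q : ℕ} (hn : 1 ≤ n) (hβ : 1 ≤ 4 * ((n : ℝ) + 1) * s * ‖β‖)
    (hx : ‖x - spikeColumn n c β‖ ≤ ε) (hW : ‖W - cyclicShift n‖ ≤ ε) (hs : 1 ≤ s)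
    (hε : 16 * (n : ℝ) * s * ε ≤ 1) (T : Matrix (Fin n) (Fin q) ℂ) :
    ‖((W - cyclicShift n).submatrix id Fin.castSucc - (x (Fin.last n) 0)⁻¹ •
        ((x - spikeColumn n c β) *
          W.submatrix (fun _ : Fin 1 => Fin.last n) Fin.castSucc)) * T‖ ≤
      2 * (n : ℝ) ^ 2 * ε * ‖T‖ +
        16 * n * s * ε * ‖W.submatrix (fun _ : Fin 1 => Fin.last n) Fin.castSucc * T‖ := by
  have hn' : (1 : ℝ) ≤ n := by exact_mod_cast hn
  have hε0 : 0 ≤ ε := (norm_nonneg _).trans hx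
  rw [Matrix.sub_mul, Matrix.smul_mul, Matrix.mul_assoc]
  refine (norm_sub_le _ _).trans (add_le_add ?_ ?_)
  · refine (frobenius_norm_mul _ _).trans ?_
    gcongr
    refine (norm_le_of_apply_le _ (r := ε) fun i j => ?_).trans ?_
    · exact (norm_apply_le (W - cyclicShift n) _ _).trans hW
    · simp only [Fintype.card_fin, Nat.cast_add, Nat.cast_one]
      nlinarith [mul_nonneg (mul_nonneg hε0 (by linarith : (0 : ℝ) ≤ n))
        (by linarith : 0 ≤ (n : ℝ) - 1)]
  · have e : ∀ (z : ℂ) (A : Matrix (Fin (n + 1)) (Fin q) ℂ), ‖z • A‖ ≤ ‖z‖ * ‖A‖ := by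
      intro z A
      have h := norm_sq_eq_sum (z • A)
      simp only [Matrix.smul_apply, smul_eq_mul, norm_mul, mul_pow, ← Finset.mul_sum] at h
      rw [← norm_sq_eq_sum, ← mul_pow] at h
      exact (pow_le_pow_iff_left₀ (norm_nonneg _) (by positivity) two_ne_zero).1 h.le
    refine (e _ _).trans ?_
    calc _ ≤ 16 * n * s * (ε * ‖W.submatrix (fun _ : Fin 1 => Fin.last n) Fin.castSucc * T‖) := by
          gcongr
          · exact (norm_inv_last_le hn hβ hx hs hε).2
          · exact (frobenius_norm_mul _ _).trans (by gcongr)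
      _ = _ := by ring

/-- If `T` and `T'` are close, and the last row of `T'` is small, then the last row of the cyclic
shift, up to rounding, annihilates what is large in `T`. -/
theorem norm_lastRow_mul_le (hn : 1 ≤ n) (hW : ‖W - cyclicShift n‖ ≤ ε) (hs : 1 ≤ s)
    (hε : 2 * (n : ℝ) ^ 2 * s * ε ≤ 1) {T T' : Matrix (Fin n) (Fin n) ℂ} (hT : ‖T - T'‖ ≤ 1)
    (hT' : ‖T'‖ ≤ (n : ℝ) ^ 2 * s) (hrow : ∀ l i : Fin n, l.val + 1 = n → ‖T' l i‖ ≤ 1) :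
    ‖T‖ ≤ 2 * (n : ℝ) ^ 2 * s ∧
      ‖W.submatrix (fun _ : Fin 1 => Fin.last n) Fin.castSucc * T‖ ≤ 3 * n := by
  have hn' : (1 : ℝ) ≤ n := by exact_mod_cast hn
  have hε0 : 0 ≤ ε := (norm_nonneg _).trans hW
  have hT1 : ‖T‖ ≤ 2 * (n : ℝ) ^ 2 * s := by
    have h1 : ‖T‖ ≤ ‖T - T'‖ + ‖T'‖ := by simpa using norm_add_le (T - T') T'
    have h2 : 1 ≤ (n : ℝ) ^ 2 * s := one_le_mul_of_one_le_of_one_le (one_le_pow₀ hn') hs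
    linarith
  refine ⟨hT1, ?_⟩
  set J : Matrix (Fin 1) (Fin n) ℂ :=
    (cyclicShift n).submatrix (fun _ : Fin 1 => Fin.last n) Fin.castSucc with hJ
  set D : Matrix (Fin 1) (Fin n) ℂ :=
    (W - cyclicShift n).submatrix (fun _ : Fin 1 => Fin.last n) Fin.castSucc with hD
  have e : W.submatrix (fun _ : Fin 1 => Fin.last n) Fin.castSucc * T
      = D * T + (J * (T - T') + J * T') := by
    rw [← Matrix.mul_add, sub_add_cancel, ← Matrix.add_mul]
    congr 1
    ext i j
    simp [hJ, hD]
  have hJe : ∀ i (j : Fin n), J i j = if j.val + 1 = n then 1 else 0 := by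
    intro i j
    simp only [hJ, Matrix.submatrix_apply, cyclicShift_castSucc, Fin.val_last, eq_comm]
  have hJn : ‖J‖ ≤ n := by
    refine (norm_le_of_apply_le _ (r := 1) fun i j => ?_).trans (by simp)
    rw [hJe]
    split_ifs <;> simp
  have hDn : ‖D‖ ≤ n * ε := by
    refine (norm_le_of_apply_le _ (r := ε) fun i j => ?_).trans (by simp)
    exact (norm_apply_le (W - cyclicShift n) _ _).trans hW
  have hJT : ‖J * T'‖ ≤ n := by
    refine (norm_le_of_apply_le _ (r := 1) fun i j => ?_).trans (by simp)
    rw [Matrix.mul_apply, Finset.sum_eq_single ⟨n - 1, by omega⟩]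
    · rw [hJe, if_pos (by simp only; omega), one_mul]
      exact hrow _ _ (by simp only; omega)
    · intro b _ hb
      rw [hJe, if_neg fun h => hb (Fin.ext (by simp only; omega)), zero_mul]
    · simp
  rw [e]
  have h1 : ‖D * T‖ ≤ n := by
    calc _ ≤ n * ε * (2 * (n : ℝ) ^ 2 * s) := by
          refine (frobenius_norm_mul _ _).trans ?_
          gcongr
      _ = n * (2 * (n : ℝ) ^ 2 * s * ε) := by ring
      _ ≤ n * 1 := by gcongr
      _ = n := mul_one _
  have h2 : ‖J * (T - T')‖ ≤ n := by
    calc _ ≤ (n : ℝ) * 1 := (frobenius_norm_mul _ _).trans (by gcongr)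
      _ = n := mul_one _
  have h3 := norm_add_le (D * T) (J * (T - T') + J * T')
  have h4 := norm_add_le (J * (T - T')) (J * T')
  linarith

/-- A crude bound for the error of a single factor. -/
theorem norm_obliqueFactor_sub_companion_le (hn : 1 ≤ n)
    (hβ : 1 ≤ 4 * ((n : ℝ) + 1) * s * ‖β‖)
    (hx : ‖x - spikeColumn n c β‖ ≤ ε) (hW : ‖W - cyclicShift n‖ ≤ ε) (hs : 1 ≤ s)
    (hc : ∀ i, ‖c i‖ ≤ s) (hε : 16 * (n : ℝ) * s * ε ≤ 1) :
    ‖obliqueFactor x W - companion n c‖ ≤ 68 * (n : ℝ) ^ 6 * s ^ 2 * ε := by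
  have hn' : (1 : ℝ) ≤ n := by exact_mod_cast hn
  have hε0 : 0 ≤ ε := (norm_nonneg _).trans hx
  have hε1 : ε ≤ 1 := by
    have : 1 ≤ 16 * (n : ℝ) * s :=
      one_le_mul_of_one_le_of_one_le (by linarith) hs
    nlinarith
  rw [obliqueFactor_sub_companion c β x W (norm_inv_last_le hn hβ hx hs hε).1]
  set E := (W - cyclicShift n).submatrix id Fin.castSucc - (x (Fin.last n) 0)⁻¹ •
        ((x - spikeColumn n c β) *
          W.submatrix (fun _ : Fin 1 => Fin.last n) Fin.castSucc) with hE
  have hEn := norm_errorFactor_mul_le hn hβ hx hW hs hε (1 : Matrix (Fin n) (Fin n) ℂ)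
  rw [Matrix.mul_one, Matrix.mul_one, ← hE] at hEn
  have hrow : ‖W.submatrix (fun _ : Fin 1 => Fin.last n) Fin.castSucc‖ ≤ 2 * n := by
    refine (norm_le_of_apply_le _ (r := 2) fun i j => ?_).trans (le_of_eq (by simp [mul_comm]))
    have h1 := (norm_apply_le (W - cyclicShift n) (Fin.last n) j.castSucc).trans hW
    have h2 : ‖cyclicShift n (Fin.last n) j.castSucc‖ ≤ 1 := by
      rw [cyclicShift_castSucc]; split_ifs <;> simp
    have h3 := norm_add_le ((W - cyclicShift n) (Fin.last n) j.castSucc)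
      (cyclicShift n (Fin.last n) j.castSucc)
    rw [Matrix.sub_apply] at h1 h3
    rw [sub_add_cancel] at h3
    rw [Matrix.submatrix_apply]
    linarith
  have hE2 : ‖E‖ ≤ 34 * (n : ℝ) ^ 4 * s * ε := by
    have h24 : (n : ℝ) ^ 2 ≤ (n : ℝ) ^ 4 := pow_le_pow_right₀ hn' (by norm_num)
    calc ‖E‖ ≤ 2 * (n : ℝ) ^ 2 * ε * (n : ℝ) ^ 2 + 16 * n * s * ε * (2 * n) := by
          refine hEn.trans ?_
          gcongr
          exact norm_one_le n
      _ = 2 * (n : ℝ) ^ 4 * 1 * ε + 32 * (n : ℝ) ^ 2 * s * ε := by ring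
      _ ≤ 2 * (n : ℝ) ^ 4 * s * ε + 32 * (n : ℝ) ^ 4 * s * ε := by gcongr
      _ = _ := by ring
  calc _ ≤ (n : ℝ) * ((n : ℝ) + 1) * s * (34 * (n : ℝ) ^ 4 * s * ε) := by
        refine (frobenius_norm_mul _ _).trans ?_
        gcongr
        exact norm_projectAlong_le hs hc
    _ ≤ (n : ℝ) * ((n : ℝ) + n) * s * (34 * (n : ℝ) ^ 4 * s * ε) := by gcongr
    _ = _ := by ring

end Factor

/-- Perturbations of the vectors and matrices that represent the Frobenius companion factors change
their product by an amount that is quadratic in the size of the data. One power of this size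
stems from the division by `x_{n+1}`, and the other from the preceding companion factors; the
subsequent ones contribute nothing, since the error of size `1 / x_{n+1}` is only multiplied by
the last row of their product. -/
theorem norm_prod_obliqueFactor_sub_le {n k : ℕ} (hn : 1 ≤ n) (hk : 1 ≤ k) {m : ℕ → ℕ → ℂ}
    (hm : ∀ r j, n ≤ r → m r j = 0) {s : ℝ} (hs : 1 ≤ s) (hms : ∀ r j, ‖m r j‖ ≤ s)
    {β : Fin k → ℂ} (hβ : ∀ j, 1 ≤ 4 * ((n : ℝ) + 1) * s * ‖β j‖)
    {x : Fin k → Matrix (Fin (n + 1)) (Fin 1) ℂ}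
    {W : Fin k → Matrix (Fin (n + 1)) (Fin (n + 1)) ℂ} {ε : ℝ}
    (hx : ∀ j : Fin k, ‖x j - spikeColumn n (fun i => m (i + j) j) (β j)‖ ≤ ε)
    (hW : ∀ j, ‖W j - cyclicShift n‖ ≤ ε)
    (hε : 68 * (n : ℝ) ^ 8 * k * ((n : ℝ) ^ 2 * s + 1) ^ k * s ^ 2 * ε ≤ 1) :
    (∀ j, x j (Fin.last n) 0 ≠ 0) ∧
    ‖(List.ofFn fun j => obliqueFactor (x j) (W j)).prod
        - segment (fun j => companion n fun i => m (i + j) j) 0 k‖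
      ≤ k * (104 * (n : ℝ) ^ 6 * s ^ 2 * ε) := by
  have hn' : (1 : ℝ) ≤ n := by exact_mod_cast hn
  have hk' : (1 : ℝ) ≤ k := by exact_mod_cast hk
  have hε0 : 0 ≤ ε := (norm_nonneg _).trans (hx ⟨0, hk⟩)
  set σ := (n : ℝ) ^ 2 * s + 1 with hσdef
  have hσ : 1 ≤ σ := by
    have : 0 ≤ (n : ℝ) ^ 2 * s := by positivity
    linarith
  set τ := 68 * (n : ℝ) ^ 6 * s ^ 2 * ε with hτdef
  have hτ0 : 0 ≤ τ := by positivity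
  have hσk : 1 ≤ σ ^ k := one_le_pow₀ hσ
  have hτ : (n : ℝ) ^ 2 * k * σ ^ k * τ ≤ 1 := by
    refine le_trans (le_of_eq ?_) hε
    rw [hτdef]; ring
  have hτ1 : τ ≤ 1 := by
    have : 1 ≤ (n : ℝ) ^ 2 * k * σ ^ k := one_le_mul_of_one_le_of_one_le
      (one_le_mul_of_one_le_of_one_le (one_le_pow₀ hn') hk') hσk
    nlinarith
  have hpow : ∀ i : ℕ, i ≤ 6 → (n : ℝ) ^ i ≤ (n : ℝ) ^ 6 := fun i hi => pow_le_pow_right₀ hn' hi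
  have hs2 : s ≤ s ^ 2 := by nlinarith
  have hε16 : 16 * (n : ℝ) * s * ε ≤ 1 := by
    refine le_trans ?_ hτ1
    have := hpow 1 (by norm_num)
    rw [pow_one] at this
    rw [hτdef]
    gcongr
    norm_num
  have hε2 : 2 * (n : ℝ) ^ 2 * s * ε ≤ 1 := by
    refine le_trans ?_ hτ1
    have := hpow 2 (by norm_num)
    rw [hτdef]
    gcongr
    norm_num
  set A : ℕ → Matrix (Fin n) (Fin n) ℂ := fun j => companion n fun i => m (i + j) j with hA
  set F : ℕ → Matrix (Fin n) (Fin n) ℂ := fun j =>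
    if h : j < k then obliqueFactor (x ⟨j, h⟩) (W ⟨j, h⟩) else A j with hF
  have hFA : ∀ j, ‖F j - A j‖ ≤ τ := by
    intro j
    by_cases h : j < k
    · simp only [hF, dif_pos h, hA]
      exact norm_obliqueFactor_sub_companion_le hn (hβ _) (hx ⟨j, h⟩) (hW _) hs
        (fun _ => hms _ _) hε16
    · simp only [hF, dif_neg h, sub_self, norm_zero]
      exact hτ0
  have hAσ' : ∀ j, ‖A j‖ ≤ (n : ℝ) ^ 2 * s := by
    intro j
    have := norm_segment_companion_le hm hs hms j 1
    simpa [segment] using this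
  have hAσ : ∀ j, ‖A j‖ ≤ σ := fun j => (hAσ' j).trans (by linarith)
  have hFσ : ∀ j, ‖F j‖ ≤ σ := by
    intro j
    have : ‖F j‖ ≤ ‖F j - A j‖ + ‖A j‖ := by simpa using norm_add_le (F j - A j) (A j)
    linarith [hFA j, hAσ' j]
  refine ⟨fun j => (norm_inv_last_le hn (hβ j) (hx j) hs hε16).1, ?_⟩
  have hprod : (List.ofFn fun j => obliqueFactor (x j) (W j)).prod = segment F 0 k := by
    rw [← prod_ofFn_eq_segment]
    congr 2
    funext j
    simp [hF]
  rw [hprod]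
  have main := norm_segment_mul_sub_le (A := A) (F := F) (b := 104 * (n : ℝ) ^ 6 * s ^ 2 * ε) 0 k ?_
  · simpa [segment] using main
  intro i j hij
  have hik : i < k := by omega
  have hjk : j ≤ k := by omega
  have htail : ‖segment F (i + 1) j - segment A (i + 1) j‖ ≤ 1 := by
    refine (norm_segment_sub_segment_le hσ hAσ hFσ hFA (i + 1) j).trans (le_trans ?_ hτ)
    have : (j : ℝ) ≤ k := by exact_mod_cast hjk
    gcongr
  obtain ⟨h1, h2⟩ := norm_lastRow_mul_le hn (hW ⟨i, hik⟩) hs hε2 htail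
    (norm_segment_companion_le hm hs hms (i + 1) j)
    (fun l i' hl => norm_segment_companion_last_le hm i j l i' hl)
  have h3 := norm_errorFactor_mul_le hn (hβ ⟨i, hik⟩) (hx ⟨i, hik⟩) (hW ⟨i, hik⟩) hs hε16
    (segment F (i + 1) j)
  have hFi : F i - A i =
      obliqueFactor (x ⟨i, hik⟩) (W ⟨i, hik⟩) - companion n fun i' => m (i' + i) i := by
    simp only [hF, dif_pos hik, hA]
  rw [hFi, obliqueFactor_sub_companion _ (β ⟨i, hik⟩) _ _
    (norm_inv_last_le hn (hβ ⟨i, hik⟩) (hx ⟨i, hik⟩) hs hε16).1, Matrix.mul_assoc,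
    ← Matrix.mul_assoc]
  refine (frobenius_norm_mul _ _).trans ?_
  have h4 : 2 * (n : ℝ) ^ 2 * ε * ‖segment F (i + 1) j‖ + 16 * n * s * ε *
      ‖(W ⟨i, hik⟩).submatrix (fun _ : Fin 1 => Fin.last n) Fin.castSucc * segment F (i + 1) j‖
      ≤ 52 * (n : ℝ) ^ 4 * s * ε := by
    have h24 : (n : ℝ) ^ 2 ≤ (n : ℝ) ^ 4 := pow_le_pow_right₀ hn' (by norm_num)
    calc _ ≤ 2 * (n : ℝ) ^ 2 * ε * (2 * (n : ℝ) ^ 2 * s) + 16 * n * s * ε * (3 * n) := by gcongr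
      _ = 4 * (n : ℝ) ^ 4 * s * ε + 48 * (n : ℝ) ^ 2 * s * ε := by ring
      _ ≤ 4 * (n : ℝ) ^ 4 * s * ε + 48 * (n : ℝ) ^ 4 * s * ε := by gcongr
      _ = _ := by ring
  calc _ ≤ ((n : ℝ) * ((n : ℝ) + 1) * s) * (52 * (n : ℝ) ^ 4 * s * ε) :=
        mul_le_mul (norm_segment_mul_projectAlong_le hm hs hms i) (h3.trans h4) (norm_nonneg _)
          (by positivity)
    _ ≤ ((n : ℝ) * ((n : ℝ) + n) * s) * (52 * (n : ℝ) ^ 4 * s * ε) := by gcongr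
    _ = _ := by ring

/-! ### The block companion matrix -/

section BlockCompanion

variable {d k : ℕ} (M : Fin d → Matrix (Fin k) (Fin k) ℂ)

/-- The entries of the stacked matrix `[M₀; M₁; …; M_{d-1}]`, extended by zeros. -/
def stackedEntry (r j : ℕ) : ℂ :=
  if hj : j < k then
    if hr : r < d * k then M (Fin.divNat ⟨r, hr⟩) (Fin.modNat ⟨r, hr⟩) ⟨j, hj⟩ else 0
  else 0

theorem frobeniusCoeff_eq (j : Fin k) (i : ℕ) :
    frobeniusCoeff M j i = stackedEntry M (i + j) j := by
  simp [frobeniusCoeff, stackedEntry]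

theorem blockCompanion_apply (l i : Fin (d * k)) :
    blockCompanion M l i =
      (if l.val / k = i.val / k + 1 ∧ l.val % k = i.val % k then (1 : ℂ) else 0)
        - (if i.val / k + 1 = d then M l.divNat l.modNat i.modNat else 0) := by
  change (if l.divNat.val = i.divNat.val + 1 ∧ l.modNat = i.modNat then (1 : ℂ) else 0)
    - (if i.divNat.val + 1 = d then M l.divNat l.modNat i.modNat else 0) = _
  simp only [Fin.ext_iff, Fin.coe_divNat, Fin.coe_modNat]
  congr

theorem segment_companion_eq_blockCompanion (hd : 1 ≤ d) (hk : 1 ≤ k)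
    (hM : ∀ (i : Fin d) (r c : Fin k), i.val = 0 → r < c → M i r c = 0) :
    segment (fun j => companion (d * k) fun i => stackedEntry M (i + j) j) 0 k
      = blockCompanion M := by
  obtain ⟨d, rfl⟩ : ∃ d', d = d' + 1 := ⟨d - 1, by omega⟩
  ext l i
  have hl := l.isLt
  have hi := i.isLt
  have hdk : (d + 1) * k = d * k + k := by ring
  rw [segment_companion_apply _ (fun r j hr => by simp [stackedEntry, hr]), blockCompanion_apply]
  have hlk := Nat.div_add_mod l.val k
  have hik := Nat.div_add_mod i.val k
  have hlm := Nat.mod_lt l.val hk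
  have him := Nat.mod_lt i.val hk
  have hld : l.val / k < d + 1 := (Nat.div_lt_iff_lt_mul hk).2 (by assumption)
  by_cases h : i.val + k < (d + 1) * k
  · have h1 : i.val / k < d := (Nat.div_lt_iff_lt_mul hk).2 (by omega)
    rw [if_pos h, if_neg (show ¬ i.val / k + 1 = d + 1 by omega), sub_zero]
    refine if_congr ⟨fun e => ?_, fun ⟨e1, e2⟩ => ?_⟩ rfl rfl
    · rw [e, Nat.add_div_right _ hk, Nat.add_mod_right]
      exact ⟨rfl, rfl⟩
    · rw [← hlk, e1, e2, mul_add]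
      omega
  · have h1 : i.val / k = d := by
      refine le_antisymm (Nat.lt_succ_iff.1 ((Nat.div_lt_iff_lt_mul hk).2 (by assumption))) ?_
      rw [Nat.le_div_iff_mul_le hk]
      omega
    have h2 : i.val + 0 + k - (d + 1) * k = i.val % k := by
      rw [h1, mul_comm] at hik
      omega
    rw [if_neg h, if_neg (show ¬ (l.val / k = i.val / k + 1 ∧ l.val % k = i.val % k) by omega), 
      if_pos (show i.val / k + 1 = d + 1 by omega), h2,
      zero_sub, add_zero]
    have e : stackedEntry M l.val (i.val % k) = M l.divNat l.modNat i.modNat := by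
      rw [stackedEntry, dif_pos him, dif_pos hl]
      rfl
    rw [e]
    split_ifs with h3
    · rfl
    · rw [hM]
      · rw [Fin.coe_divNat]
        exact Nat.div_eq_of_lt (by omega)
      · rw [Fin.lt_def, Fin.coe_modNat, Fin.coe_modNat]
        have := Nat.mod_le l.val k
        omega

theorem norm_stackedEntry_le (r j : ℕ) : ‖stackedEntry M r j‖ ≤ ‖blockCompanion M‖ := by
  rw [stackedEntry]
  split_ifs with hj hr
  · have hk : 0 < k := by omega
    obtain ⟨d, rfl⟩ : ∃ d', d = d' + 1 := ⟨d - 1, by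
      have : d ≠ 0 := by rintro rfl; simp at hr
      omega⟩
    have hdk : (d + 1) * k = d * k + k := by ring
    have hi : d * k + j < (d + 1) * k := by omega
    have h1 : (d * k + j) / k = d := by
      rw [mul_comm, Nat.mul_add_div hk, Nat.div_eq_of_lt hj, add_zero]
    have h2 : (d * k + j) % k = j := by rw [mul_comm, Nat.mul_add_mod, Nat.mod_eq_of_lt hj]
    have hld : r / k < d + 1 := (Nat.div_lt_iff_lt_mul hk).2 (by assumption)
    have h := norm_apply_le (blockCompanion M) ⟨r, hr⟩ ⟨d * k + j, hi⟩
    have e : Fin.modNat (⟨d * k + j, hi⟩ : Fin ((d + 1) * k)) = ⟨j, hj⟩ := by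
      ext
      rw [Fin.coe_modNat]
      exact h2
    rw [blockCompanion_apply, e] at h
    simp only [h1] at h
    rw [if_neg fun e => by have := e.1; omega, zero_sub, norm_neg, if_pos trivial] at h
    exact h
  · simp
  · simp

theorem one_le_norm_blockCompanion (hd : 1 ≤ d) (hk : 1 ≤ k)
    (hS : d = 1 → 1 ≤ ‖blockCompanion M‖) : 1 ≤ ‖blockCompanion M‖ := by
  by_cases h : d = 1
  · exact hS h
  · obtain ⟨d, rfl⟩ : ∃ d', d = d' + 2 := ⟨d - 2, by omega⟩
    have hdk : (d + 2) * k = d * k + k + k := by ring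
    have h := norm_apply_le (blockCompanion M) ⟨k, by omega⟩ ⟨0, by omega⟩
    rw [blockCompanion_apply] at h
    simpa [Nat.div_self hk] using h

end BlockCompanion

end CoreChasing

end

theorem mainTheorem5 :
    ∃ (K : ℝ) (a : ℕ),
      ∀ (d k : ℕ), 1 ≤ d → 1 ≤ k →
      ∀ M : Fin d → Matrix (Fin k) (Fin k) ℂ,
        (∀ (i : Fin d) (r c : Fin k), i.val = 0 → r < c → M i r c = 0) →
        (d = 1 → 1 ≤ ‖CoreChasing.blockCompanion M‖) →
      ∀ N : ℕ, ∃ u₀ : ℝ, 0 < u₀ ∧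
        ∀ (u : ℝ) (fl : ℝ → ℝ), 0 ≤ u → u ≤ u₀ → CoreChasing.StandardModel u fl →
        ∀ st : CoreChasing.State (d * k) k,
          CoreChasing.Run fl u N (CoreChasing.frobeniusStart fl M) st →
            st.U ∈ Matrix.unitaryGroup (Fin (d * k)) ℂ ∧
            st.V ∈ Matrix.unitaryGroup (Fin (d * k)) ℂ ∧
            (∀ j : Fin k, st.rho j ≠ 0) ∧
            ∃ δS : Matrix (Fin (d * k)) (Fin (d * k)) ℂ,
              st.value = st.U * (CoreChasing.blockCompanion M + δS) * st.Vᴴ ∧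
              ‖δS‖ ≤ K * ((d : ℝ) * (k : ℝ)) ^ a * ((N : ℝ) + 1)
                * ‖CoreChasing.blockCompanion M‖ ^ 2 * u := by
  obtain ⟨C, hC, hrun⟩ := CoreChasing.exists_run_represents
  refine ⟨26624 * (85 + C), 15, fun d k hd hk M hM hS N => ?_⟩
  have hn : 1 ≤ d * k := Nat.mul_pos hd hk
  have hn' : (1 : ℝ) ≤ ((d * k : ℕ) : ℝ) := by exact_mod_cast hn
  have hkn : (k : ℝ) ≤ ((d * k : ℕ) : ℝ) := by exact_mod_cast Nat.le_mul_of_pos_left k hd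
  have hs := CoreChasing.one_le_norm_blockCompanion M hd hk hS
  rw [← Nat.cast_mul]
  set n : ℝ := ((d * k : ℕ) : ℝ) with hndef
  set s := ‖CoreChasing.blockCompanion M‖ with hsdef
  set G : ℝ := (85 + C) * 256 * n ^ 8 * ((N : ℝ) + 1) with hG
  set D : ℝ := 68 * n ^ 8 * k * (n ^ 2 * s + 1) ^ k * s ^ 2 * G with hD
  have hG0 : 0 ≤ G := by positivity
  have hD0 : 0 ≤ D := by positivity
  -- the three summands ensure `u ≤ 1 / 1000`, the smallness required of `u` for the initial data,
  -- and the smallness required of the error for the product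
  refine ⟨1 / (1000 + 112 * n + D), by positivity, fun u fl hu hu0 hfl st hst => ?_⟩
  have hsum : (1000 + 112 * n + D) * u ≤ 1 := by
    rw [le_div_iff₀ (by positivity)] at hu0
    linarith
  have hDu : 0 ≤ D * u := by positivity
  have hnu : 0 ≤ n * u := by positivity
  let a : CoreChasing.Arith := ⟨u, fl, hu, by linarith, hfl⟩
  obtain ⟨hgood, β, hβ, hrep⟩ := CoreChasing.frobeniusStart_represents a hn M
    (show 112 * n * u ≤ 1 by linarith) hs fun j i => by
      rw [CoreChasing.frobeniusCoeff_eq]; exact CoreChasing.norm_stackedEntry_le M _ _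
  obtain ⟨hgood', hrep'⟩ := hrun a _ st hst hgood
  obtain ⟨hU, hV, x, W, hx, hW, hrho, hval⟩ := (hrep' _ _ _ hrep).exists_value_eq hgood'
  set ε : ℝ := 85 * (n + 1) ^ 2 * u + C * (n + 1) ^ 8 * N * u with hε
  have hεG : ε ≤ G * u := by
    have h28 : (n + 1) ^ 2 ≤ (n + 1) ^ 8 := pow_le_pow_right₀ (by linarith) (by norm_num)
    have h8 : (n + 1) ^ 8 ≤ 256 * n ^ 8 := by
      calc (n + 1) ^ 8 ≤ (n + n) ^ 8 := by gcongr
        _ = _ := by ring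
    have hN : (0 : ℝ) ≤ N := N.cast_nonneg
    calc ε ≤ 85 * (n + 1) ^ 8 * u + C * (n + 1) ^ 8 * N * u := by rw [hε]; gcongr
      _ ≤ 85 * (n + 1) ^ 8 * ((N : ℝ) + 1) * u + C * (n + 1) ^ 8 * ((N : ℝ) + 1) * u := by
        refine add_le_add (mul_le_mul_of_nonneg_right
          (le_mul_of_one_le_right (by positivity) (by linarith)) hu) ?_
        gcongr
        linarith
      _ = (85 + C) * ((N : ℝ) + 1) * u * (n + 1) ^ 8 := by ring
      _ ≤ (85 + C) * ((N : ℝ) + 1) * u * (256 * n ^ 8) := by gcongr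
      _ = G * u := by rw [hG]; ring
  obtain ⟨hne, hprod⟩ := CoreChasing.norm_prod_obliqueFactor_sub_le hn hk
    (m := CoreChasing.stackedEntry M)
    (fun r j hr => by simp [CoreChasing.stackedEntry, hr]) hs
    (CoreChasing.norm_stackedEntry_le M) hβ
    (x := x) (W := W) (ε := ε)
    (fun j => by simpa only [← CoreChasing.frobeniusCoeff_eq] using hx j) hW (by
      calc _ ≤ 68 * n ^ 8 * k * (n ^ 2 * s + 1) ^ k * s ^ 2 * (G * u) := by gcongr
        _ = D * u := by rw [hD]; ring
        _ ≤ 1 := by linarith)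
  rw [CoreChasing.segment_companion_eq_blockCompanion M hd hk hM] at hprod
  refine ⟨hU, hV, fun j => (hrho j).symm ▸ hne j, _, ?_, hprod.trans ?_⟩
  · -- `δS` is the difference of the perturbed and the exact product
    rw [add_sub_cancel]
    exact hval
  · calc (k : ℝ) * (104 * n ^ 6 * s ^ 2 * ε) ≤ n * (104 * n ^ 6 * s ^ 2 * (G * u)) := by gcongr
      _ = _ := by rw [hG]; ring
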